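/- Let $n$ be a positive integer, $K\in[1,\infty)$ and $\varepsilon\in(0,n-1)$ (so $n\ge 2$). There is a constant $C=C(n,K,\varepsilon)<\infty$ with the following property. Let $h=(h_{\mathbb R},h_{\mathbb S^{n-1}})\colon\mathbb R^n\to\mathbb R\times\mathbb S^{n-1}$ be continuous and non-constant, where $\mathbb R\times\mathbb S^{n-1}\subset\mathbb R\times\mathbb R^n$ carries the product Riemannian metric and the volume form $dt\wedge\mathrm{vol}_{\mathbb S^{n-1}}$, with $\mathrm{vol}_{\mathbb S^{n-1}}$ at $\theta$ given by $(w_1,\dots,w_{n-1})\mapsto\det(\theta,w_1,\dots,w_{n-1})$. Suppose that $h\in W^{1,n}_{\mathrm{loc}}(\mathbb R^n,\mathbb R\times\mathbb S^{n-1})$ (that is, $h\in W^{1,n}_{\mathrm{loc}}$ as a map into $\mathbb R\times\mathbb R^n$), with weak derivative $Dh$ satisfying $|Dh|\in L^n(\mathbb R^n)$, where $|Dh(x)|$ denotes the operator norm. Let $J_h$ denote the Jacobian of $h$, defined by $h^*(dt\wedge\mathrm{vol}_{\mathbb S^{n-1}})=J_h\,dx$; equivalently, $J_h(x)$ is the determinant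 of the linear map $v\mapsto (Dh_{\mathbb R}(x)v)\,h_{\mathbb S^{n-1}}(x)+Dh_{\mathbb S^{n-1}}(x)v$ on $\mathbb R^n$. Suppose that $$|Dh(x)|^n\le K J_h(x)+\sigma(x)^n\qquad\text{for a.e. }x\in\mathbb R^n,$$ where $\sigma\ge 0$ and $\sigma\in L^{n-\varepsilon}(\mathbb R^n)\cap L^n(\mathbb R^n)$. Then $$\int_{\mathbb R^n}|Dh|^n\log^n\!\left(1+\frac{1}{M(|Dh|)}\right)\le C\int_{\mathbb R^n}\left(\sigma^n+\sigma^{n-\varepsilon}\right)<\infty,$$ where $M(g)(x)=\sup_{r>0}\frac{1}{|B(x,r)|}\int_{B(x,r)}|g|$ is the (centered) Hardy–Littlewood maximal function, and $\log(1+1/\infty)=0$. -/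

import Mathlib

open MeasureTheory
open scoped ENNReal NNReal

noncomputable section

/-- Euclidean `n`-space. -/
abbrev Euc (n : ℕ) : Type := EuclideanSpace ℝ (Fin n)

/-- The unit sphere `S^{n-1}` in `ℝ^n`. -/
abbrev UnitSphere (n : ℕ) : Type := Metric.sphere (0 : Euc n) 1

/-- The Euclidean space `ℝ × ℝ^n` (with the `ℓ²` product norm), in which `ℝ × S^{n-1}` is
isometrically embedded as a Riemannian submanifold. -/
abbrev Ambient (n : ℕ) : Type := WithLp 2 (ℝ × Euc n)

/-- The inclusion of `ℝ × S^{n-1}` into `ℝ × ℝ^n`. -/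
def cylinderIncl {n : ℕ} (p : ℝ × UnitSphere n) : Ambient n :=
  WithLp.toLp 2 (p.1, (p.2 : Euc n))

/-- `f ∈ L^p_loc(ℝ^n)`. -/
def MemLpLocal {n : ℕ} {F : Type*} [NormedAddCommGroup F] (p : ℝ≥0∞) (f : Euc n → F) : Prop :=
  ∀ S : Set (Euc n), IsCompact S → MemLp f p (volume.restrict S)

/-- `f'` is (a representative of) the weak derivative of `f`: both are locally integrable and
`∫ (∂_v φ) f = - ∫ φ (f' v)` for all test functions `φ ∈ C_c^∞(ℝ^n)` and all directions `v`. -/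
structure IsWeakDerivative {n : ℕ} {F : Type*} [NormedAddCommGroup F] [NormedSpace ℝ F]
    (f : Euc n → F) (f' : Euc n → Euc n →L[ℝ] F) : Prop where
  locallyIntegrable : LocallyIntegrable f volume
  locallyIntegrable_deriv : LocallyIntegrable f' volume
  integral_eq : ∀ φ : Euc n → ℝ, ContDiff ℝ ((⊤ : ℕ∞) : WithTop ℕ∞) φ → HasCompactSupport φ → ∀ v : Euc n,
    ∫ x, (fderiv ℝ φ x v) • f x = - ∫ x, φ x • f' x v

/-- The local Sobolev space `W^{1,p}_loc(ℝ^n, F)`. -/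
def MemSobolevLocal {n : ℕ} {F : Type*} [NormedAddCommGroup F] [NormedSpace ℝ F]
    (p : ℝ≥0∞) (f : Euc n → F) : Prop :=
  MemLpLocal p f ∧ ∃ f' : Euc n → Euc n →L[ℝ] F, IsWeakDerivative f f' ∧ MemLpLocal p f'

/-- The linear map `ℝ × ℝ^n → ℝ^n`, `(t, w) ↦ t θ + w`. For a unit vector `θ` and any `s`, its
restriction to the tangent space `T_{(s, θ)}(ℝ × S^{n-1}) = ℝ × θ^⊥` is a linear isometry onto
`ℝ^n`, and it pulls the standard volume form of `ℝ^n` back to the volume form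
`dt ∧ vol_{S^{n-1}}` of `ℝ × S^{n-1}`, where `vol_{S^{n-1}}` at `θ` is
`(w_1, …, w_{n-1}) ↦ det (θ, w_1, …, w_{n-1})`. -/
def cylinderFrame {n : ℕ} (θ : UnitSphere n) : Ambient n →ₗ[ℝ] Euc n where
  toFun w := w.fst • (θ : Euc n) + w.snd
  map_add' a b := by simp only [WithLp.add_fst, WithLp.add_snd]; module
  map_smul' c a := by
    simp only [WithLp.smul_fst, WithLp.smul_snd, RingHom.id_apply, smul_eq_mul]; module

/-- The Jacobian `J_h` at `x` of a map `h : ℝ^n → ℝ × S^{n-1}` with weak derivative `Dh`, i.e.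
`h^*(dt ∧ vol_{S^{n-1}}) = J_h dx`: the determinant of `Dh x`, read as an endomorphism of `ℝ^n`
through the oriented isometry `T_{h x}(ℝ × S^{n-1}) ≅ ℝ^n` above. -/
def cylinderJacobian {n : ℕ} (h : Euc n → ℝ × UnitSphere n)
    (Dh : Euc n → Euc n →L[ℝ] Ambient n) (x : Euc n) : ℝ :=
  LinearMap.det (cylinderFrame (h x).2 ∘ₗ (Dh x : Euc n →ₗ[ℝ] Ambient n))

/-- The (centered) Hardy–Littlewood maximal function
`M g (x) = sup_{r > 0} |B(x,r)|⁻¹ ∫_{B(x,r)} |g|`, with values in `[0, ∞]`. -/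
def hlMaximal {n : ℕ} (g : Euc n → ℝ) (x : Euc n) : ℝ≥0∞ :=
  ⨆ (r : ℝ) (_ : 0 < r),
    (volume (Metric.ball x r))⁻¹ * ∫⁻ y in Metric.ball x r, ‖g y‖ₑ

/-- The function `t ↦ log (1 + 1/t)` from `[0, ∞]` to `[0, ∞]`, equal to `∞` at `0` and to `0`
at `∞`. -/
def logOneAddInv (t : ℝ≥0∞) : ℝ≥0∞ := (ENNReal.log (1 + t⁻¹)).toENNReal

end

open Metric Set Filter Topology ContinuousLinearMap
open scoped Convolution ContDiff

/-! Write `h = (f, g)`, with weak derivatives `a` of `f` and `G` of `g`. Since `|g| = 1`, the image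
of `G` is orthogonal to `g`, so `det G = 0` and the Jacobian `det (a ⊗ g + G)` reduces to its part
linear in `a`, the cofactor pairing of `a`, `g` and `G` (`cylinderJacobian_eq`). This is `df ∧ g^*
vol`, and `g^* vol` is closed. Hence the pairing integrates to zero when `a` is replaced by `∇η`
with `η` Lipschitz and `∇η ∈ L^n` (`integral_cofactorPairing_fderiv_eq_zero`).

Put `M = M(|Dh|)`. By the pointwise Sobolev inequality `f` is Lipschitz with constant of order `t`
on `{M ≤ t}`. Let `η` be a Lipschitz extension from that set; then `∇η = a` almost everywhere on it
(`exists_lipschitz_truncation`). As the total integral vanishes, the Jacobian over `{M ≤ t}` is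
controlled by `t ∫_{M > t} |Dh|^(n-1)`, and the distortion inequality gives the level set estimate
of `exists_setLIntegral_sublevel_le`: `∫_{M ≤ t} |Dh|^n ≤ B t ∫_{M > t} |Dh|^(n-1) + ∫_{M ≤ t} S`,
with `S ≤ σ^n` and `S ≤ c |Dh|^n`.

Letting `t → ∞` yields `∫ |Dh|^n ≤ ∫ σ^n`. Taking `t = 2^(-k)` and summing with weights
`(k+1)^(n-1)` produces `|Dh|^n log^n (1/M)` on the left, up to constants and lower order terms. On
the right, the first term becomes about `|Dh|^(n-1) M log^(n-1) (1/M)`, which Young's inequality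
splits into a small multiple of the left side and a multiple of `M^n`; the latter is handled by the
maximal theorem in `L^n`. In the second term, `|Dh| ≤ C M` almost everywhere gives by interpolation
`S ≤ C σ^(n-ε) M^ε`, and the factor `M^ε ≤ 2^(-kε)` makes the weighted sum converge. The sums are
truncated at `k < N`, so the quantity to be absorbed is finite (`exists_lintegral_pow_mul_log_le`).
-/

/-- The centered maximal function of an `[0, ∞]`-valued function. -/
noncomputable def ballMaximal {n : ℕ} (u : Euc n → ℝ≥0∞) (x : Euc n) : ℝ≥0∞ :=
  ⨆ (r : ℝ) (_ : 0 < r), (volume (ball x r))⁻¹ * ∫⁻ y in ball x r, u y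

theorem volume_ball_euc {n : ℕ} (x : Euc n) {r : ℝ} (hr : 0 < r) :
    volume (ball x r) = ENNReal.ofReal r ^ n * volume (ball (0 : Euc n) 1) := by
  rw [Measure.addHaar_ball_of_pos _ _ hr, finrank_euclideanSpace_fin, ENNReal.ofReal_pow hr.le]

theorem volume_ball_scale {n : ℕ} (x : Euc n) {r c : ℝ} (hr : 0 < r) (hc : 0 < c) :
    volume (ball x (c * r)) = ENNReal.ofReal c ^ n * volume (ball x r) := by
  rw [volume_ball_euc x hr, volume_ball_euc x (mul_pos hc hr), ENNReal.ofReal_mul hc.le, mul_pow,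
    mul_assoc]

theorem volume_ball_center {n : ℕ} (x y : Euc n) (r : ℝ) :
    volume (ball x r) = volume (ball y r) := by
  rw [Measure.addHaar_ball_center, Measure.addHaar_ball_center volume y]

theorem volume_ball_euc_ne_zero {n : ℕ} (x : Euc n) {r : ℝ} (hr : 0 < r) :
    volume (ball x r) ≠ 0 := (measure_ball_pos volume x hr).ne'

theorem volume_ball_euc_ne_top {n : ℕ} (x : Euc n) {r : ℝ} : volume (ball x r) ≠ ⊤ :=
  measure_ball_lt_top.ne

/-! ### The Hardy–Littlewood maximal function: weak and strong type bounds. -/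

section ballMaximal

variable {n : ℕ} {u v : Euc n → ℝ≥0∞}

theorem setLIntegral_ball_le (u : Euc n → ℝ≥0∞) (x : Euc n) {r : ℝ} (hr : 0 < r) :
    ∫⁻ y in ball x r, u y ≤ volume (ball x r) * ballMaximal u x := by
  have h : (volume (ball x r))⁻¹ * ∫⁻ y in ball x r, u y ≤ ballMaximal u x :=
    le_iSup₂ (f := fun (r : ℝ) (_ : 0 < r) =>
      (volume (ball x r))⁻¹ * ∫⁻ y in ball x r, u y) r hr
  calc ∫⁻ y in ball x r, u y
      = volume (ball x r) * ((volume (ball x r))⁻¹ * ∫⁻ y in ball x r, u y) := by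
        rw [← mul_assoc, ENNReal.mul_inv_cancel (volume_ball_euc_ne_zero x hr)
          (volume_ball_euc_ne_top x), one_mul]
    _ ≤ _ := by gcongr

theorem ballMaximal_le_of_forall {x : Euc n} {C : ℝ≥0∞}
    (h : ∀ r : ℝ, 0 < r → ∫⁻ y in ball x r, u y ≤ volume (ball x r) * C) :
    ballMaximal u x ≤ C := by
  refine iSup₂_le fun r hr => ?_
  calc _ ≤ (volume (ball x r))⁻¹ * (volume (ball x r) * C) := by gcongr; exact h r hr
    _ = C := by
      rw [← mul_assoc, ENNReal.inv_mul_cancel (volume_ball_euc_ne_zero x hr)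
          (volume_ball_euc_ne_top x), one_mul]

theorem lt_ballMaximal_iff {x : Euc n} {a : ℝ≥0∞} :
    a < ballMaximal u x ↔ ∃ r : ℝ, 0 < r ∧ a * volume (ball x r) < ∫⁻ y in ball x r, u y := by
  simp only [ballMaximal, lt_iSup_iff, exists_prop]
  refine exists_congr fun r => and_congr_right fun hr => ?_
  rw [mul_comm, ← div_eq_mul_inv, ENNReal.lt_div_iff_mul_lt
    (Or.inl (volume_ball_euc_ne_zero x hr)) (Or.inl (volume_ball_euc_ne_top x))]

theorem ballMaximal_mono_ae (h : ∀ᵐ x, u x ≤ v x) (x : Euc n) :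
    ballMaximal u x ≤ ballMaximal v x :=
  iSup₂_mono fun _ _ => by gcongr 1; exact lintegral_mono_ae (ae_restrict_of_ae h)

theorem ballMaximal_add_le (hu : AEMeasurable u) (x : Euc n) :
    ballMaximal (fun y => u y + v y) x ≤ ballMaximal u x + ballMaximal v x := by
  refine ballMaximal_le_of_forall fun r hr => ?_
  rw [lintegral_add_left' hu.restrict, mul_add]
  exact add_le_add (setLIntegral_ball_le u x hr) (setLIntegral_ball_le v x hr)

theorem ballMaximal_const_le (c : ℝ≥0∞) (x : Euc n) : ballMaximal (fun _ => c) x ≤ c :=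
  ballMaximal_le_of_forall fun r _ => by simp [mul_comm]

/-- A strict inequality on `ball x r` survives a slight decrease of the radius, by continuity from
below of the measure `u dx`, and the smaller ball lies in `ball y r` for `y` near `x`. No
measurability of `u` is needed. -/
theorem lowerSemicontinuous_ballMaximal (u : Euc n → ℝ≥0∞) :
    LowerSemicontinuous (ballMaximal u) := by
  intro x a ha
  obtain ⟨r, hr, h⟩ := lt_ballMaximal_iff.1 ha
  have hU : ball x r = ⋃ k : ℕ, ball x (r - 1 / ((k : ℝ) + 1)) := by
    ext y
    simp only [mem_ball, mem_iUnion]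
    constructor
    · intro hy
      obtain ⟨k, hk⟩ := exists_nat_one_div_lt (sub_pos.2 hy)
      exact ⟨k, by linarith⟩
    · rintro ⟨k, hk⟩
      have : (0 : ℝ) < 1 / ((k : ℝ) + 1) := by positivity
      linarith
  have hmono : Monotone fun k : ℕ => ball x (r - 1 / ((k : ℝ) + 1)) := fun k l hkl =>
    ball_subset_ball (by
      have : (1 : ℝ) / ((l : ℝ) + 1) ≤ 1 / ((k : ℝ) + 1) := by gcongr
      linarith)
  have hlim := tendsto_measure_iUnion_atTop (μ := volume.withDensity u) hmono
  rw [← hU, withDensity_apply _ measurableSet_ball] at hlim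
  obtain ⟨k, hk⟩ := (hlim.eventually (lt_mem_nhds h)).exists
  simp only [Function.comp, withDensity_apply _ measurableSet_ball] at hk
  have hpos : (0 : ℝ) < 1 / ((k : ℝ) + 1) := by positivity
  filter_upwards [ball_mem_nhds x hpos] with y hy
  refine lt_ballMaximal_iff.2 ⟨r, hr, ?_⟩
  rw [volume_ball_center y x]
  refine hk.trans_le (lintegral_mono_set (ball_subset_ball' ?_))
  rw [mem_ball, dist_comm] at hy
  linarith

@[fun_prop]
theorem measurable_ballMaximal (u : Euc n → ℝ≥0∞) : Measurable (ballMaximal u) :=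
  (lowerSemicontinuous_ballMaximal u).measurable

/-- The weak type `(1, 1)` estimate for the maximal function. -/
theorem mul_volume_ballMaximal_gt_le (hn : n ≠ 0) (u : Euc n → ℝ≥0∞) (a : ℝ≥0∞) :
    a * volume {x | a < ballMaximal u x} ≤ 4 ^ n * ∫⁻ x, u x := by
  rcases eq_or_ne (∫⁻ x, u x) ⊤ with hI | hI
  · rw [hI, ENNReal.mul_top (by positivity)]; exact le_top
  rcases eq_or_ne a 0 with rfl | ha0
  · simp
  rcases eq_or_ne a ⊤ with rfl | haT
  · simp
  set t : Set (Euc n) := {x | a < ballMaximal u x}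
  have hr : ∀ x : Euc n, ∃ r : ℝ, x ∈ t → 0 < r ∧ a * volume (ball x r) < ∫⁻ y in ball x r, u y := by
    intro x
    by_cases hx : x ∈ t
    · obtain ⟨r, h⟩ := lt_ballMaximal_iff.1 hx
      exact ⟨r, fun _ => h⟩
    · exact ⟨0, fun h => absurd h hx⟩
  choose r hr using hr
  set V₁ := volume (ball (0 : Euc n) 1)
  have hV0 : V₁ ≠ 0 := volume_ball_euc_ne_zero _ one_pos
  have hVT : V₁ ≠ ⊤ := volume_ball_euc_ne_top _
  -- Vitali's lemma needs bounded radii: an admissible radius satisfies `r ^ n ≤ R`, hence `r ≤ R`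
  -- as soon as `r ≥ 1`.
  set R : ℝ≥0∞ := (∫⁻ x, u x) / (a * V₁)
  have hRT : R ≠ ⊤ := ENNReal.div_ne_top hI (mul_ne_zero ha0 hV0)
  have hbd : ∀ x ∈ t, r x ≤ 1 + R.toReal := by
    intro x hx
    by_contra! hlt
    obtain ⟨h0, h1⟩ := hr x hx
    have h2 : a * (ENNReal.ofReal (r x) ^ n * V₁) ≤ ∫⁻ x, u x := by
      rw [← volume_ball_euc x h0]
      exact h1.le.trans (setLIntegral_le_lintegral _ _)
    have h3 : ENNReal.ofReal (r x) ^ n ≤ R := by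
      rw [ENNReal.le_div_iff_mul_le (Or.inl (mul_ne_zero ha0 hV0))
        (Or.inl (ENNReal.mul_ne_top haT hVT))]
      calc _ = a * (ENNReal.ofReal (r x) ^ n * V₁) := by ring
        _ ≤ _ := h2
    have h4 : (1 : ℝ≥0∞) ≤ ENNReal.ofReal (r x) := by
      rw [ENNReal.one_le_ofReal]
      have : 0 ≤ R.toReal := ENNReal.toReal_nonneg
      linarith
    have h5 : ENNReal.ofReal (r x) ≤ R := (le_self_pow h4 hn).trans h3
    have h6 := (ENNReal.ofReal_le_iff_le_toReal hRT).1 h5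
    linarith
  obtain ⟨s, hst, hdisj, hcov⟩ := Vitali.exists_disjoint_subfamily_covering_enlargement_ball
    t id r _ hbd 4 (by norm_num)
  have hcount : s.Countable := hdisj.countable_of_isOpen (fun _ _ => isOpen_ball)
    (fun x hx => ⟨x, mem_ball_self (hr x (hst hx)).1⟩)
  have hsub : t ⊆ ⋃ b ∈ s, ball b (4 * r b) := by
    intro x hx
    obtain ⟨b, hb, h⟩ := hcov x hx
    exact mem_biUnion hb (h (mem_ball_self (hr x hx).1))
  calc a * volume t ≤ a * ∑' b : s, volume (ball (b : Euc n) (4 * r b)) := by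
        gcongr
        exact (measure_mono hsub).trans (measure_biUnion_le _ hcount _)
    _ = 4 ^ n * ∑' b : s, a * volume (ball (b : Euc n) (r b)) := by
        rw [← ENNReal.tsum_mul_left, ← ENNReal.tsum_mul_left]
        refine tsum_congr fun b => ?_
        rw [volume_ball_scale _ (hr b (hst b.2)).1 (by norm_num)]
        norm_num
        ring
    _ ≤ 4 ^ n * ∑' b : s, ∫⁻ y in ball (b : Euc n) (r b), u y := by
        gcongr with b
        exact (hr b (hst b.2)).2.le
    _ = 4 ^ n * ∫⁻ y in ⋃ b ∈ s, ball b (r b), u y := by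
        congr 1
        exact (lintegral_biUnion hcount (fun _ _ => measurableSet_ball) hdisj _).symm
    _ ≤ _ := by
        gcongr
        exact Measure.restrict_le_self

/-- The part of `u` not exceeding `a` adds at most `a` to the maximal function, so only the part
above `a` has to enter the weak type bound. This localized right side is what can be summed over
levels. -/
theorem mul_volume_ballMaximal_gt_two_mul_le (hn : n ≠ 0) (hu : Measurable u) (a : ℝ≥0∞) :
    a * volume {x | 2 * a < ballMaximal u x} ≤ 4 ^ n * ∫⁻ x in {x | a < u x}, u x := by
  have hm : MeasurableSet {x | a < u x} := measurableSet_lt measurable_const hu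
  rw [← lintegral_indicator hm]
  refine le_trans ?_ (mul_volume_ballMaximal_gt_le hn _ a)
  gcongr a * volume ?_
  intro x hx
  have h1 : ballMaximal u x ≤ ballMaximal ({x | a < u x}.indicator u) x + a := by
    refine (ballMaximal_mono_ae (v := fun y => {x | a < u x}.indicator u y + a)
      (Filter.Eventually.of_forall fun y => ?_) x).trans
      ((ballMaximal_add_le (hu.indicator hm).aemeasurable x).trans ?_)
    · by_cases hy : a < u y
      · simp [indicator, hy]
      · simp [indicator, hy, not_lt.1 hy]
    · gcongr
      exact ballMaximal_const_le a x
  rw [mem_ofPred_eq] at hx ⊢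
  by_contra! h
  exact absurd (hx.trans_le h1) (not_lt.2 (by rw [two_mul]; gcongr))

/-- A dyadic sum comparable to `t ^ q`. -/
noncomputable def dyadicSum (q : ℕ) (t : ℝ≥0∞) : ℝ≥0∞ :=
  ∑' k : ℤ, if (2 : ℝ≥0∞) ^ k < t then ((2 : ℝ≥0∞) ^ k) ^ q else 0

/-- For `0 < t < ∞` the single term with `2 ^ k < t ≤ 2 ^ (k + 1)` suffices. -/
theorem pow_le_dyadicSum {q : ℕ} (hq : q ≠ 0) (t : ℝ≥0∞) : t ^ q ≤ 2 ^ q * dyadicSum q t := by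
  rcases eq_or_ne t 0 with rfl | h0
  · simp [hq]
  rcases eq_or_ne t ⊤ with rfl | hT
  · have : dyadicSum q ⊤ = ⊤ := by
      rw [eq_top_iff, dyadicSum]
      calc (⊤ : ℝ≥0∞) = ∑' k : ℕ, (1 : ℝ≥0∞) := (ENNReal.tsum_const_eq_top_of_ne_zero one_ne_zero).symm
        _ ≤ ∑' k : ℕ, if (2 : ℝ≥0∞) ^ (k : ℤ) < ⊤ then ((2 : ℝ≥0∞) ^ (k : ℤ)) ^ q else 0 := by
          gcongr with k
          have : (2 : ℝ≥0∞) ^ (k : ℤ) < ⊤ := by simp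
          rw [if_pos this, zpow_natCast]
          exact one_le_pow₀ (one_le_pow₀ (by norm_num))
        _ ≤ _ := ENNReal.tsum_comp_le_tsum_of_injective Nat.cast_injective _
    rw [this, ENNReal.mul_top (by positivity)]
    exact le_top
  obtain ⟨k, hk1, hk2⟩ := ENNReal.exists_mem_Ioc_zpow h0 hT (y := 2) (by norm_num) (by norm_num)
  calc t ^ q ≤ (2 ^ (k + 1)) ^ q := by gcongr
    _ = 2 ^ q * (2 ^ k) ^ q := by
      rw [ENNReal.zpow_add (by norm_num) (by norm_num), zpow_one, mul_pow, mul_comm]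
    _ ≤ _ := by
      gcongr
      refine le_trans ?_ (ENNReal.le_tsum k)
      rw [if_pos hk1]

/-- Below the top index the terms decay geometrically with ratio `2 ^ (-q) ≤ 1 / 2`; this is where
`q ≠ 0` is essential. -/
theorem dyadicSum_le {q : ℕ} (hq : q ≠ 0) (t : ℝ≥0∞) : dyadicSum q t ≤ 2 * t ^ q := by
  rcases eq_or_ne t 0 with rfl | h0
  · simp [dyadicSum]
  rcases eq_or_ne t ⊤ with rfl | hT
  · simp [hq]
  obtain ⟨k, hk1, hk2⟩ := ENNReal.exists_mem_Ioc_zpow h0 hT (y := 2) (by norm_num) (by norm_num)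
  have hinj : Function.Injective fun j : ℕ => k - (j : ℤ) := fun i j h => by simpa using h
  rw [dyadicSum, ← hinj.tsum_eq]
  · calc _ ≤ ∑' j : ℕ, (2 : ℝ≥0∞)⁻¹ ^ j * t ^ q := by
          gcongr with j
          split_ifs with h
          · rw [ENNReal.zpow_sub (by norm_num) (by norm_num), mul_pow, mul_comm]
            refine mul_le_mul' ?_ (by gcongr)
            rw [zpow_natCast, show (2⁻¹ : ℝ≥0∞) ^ j = (2 ^ j)⁻¹ from ENNReal.inv_pow.symm]
            have h2 : ((2 : ℝ≥0∞) ^ j)⁻¹ ≤ 1 := ENNReal.inv_le_one.2 (one_le_pow₀ (by norm_num))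
            exact pow_le_of_le_one (by positivity) h2 hq
          · positivity
      _ = 2 * t ^ q := by
          rw [ENNReal.tsum_mul_right, ENNReal.tsum_geometric, ENNReal.one_sub_inv_two, inv_inv]
  · intro l hl
    have : (2 : ℝ≥0∞) ^ l < t := by
      by_contra h
      simp [h] at hl
    have h2 : l < k + 1 := by
      by_contra! h
      have : (2 : ℝ≥0∞) ^ (k + 1) ≤ 2 ^ l := ENNReal.zpow_le_of_le (by norm_num) h
      exact absurd (hk2.trans this) (not_le.2 ‹_›)
    exact ⟨(k - l).toNat, by simp only; omega⟩

/-- The strong type `(p, p)` estimate for the maximal function, for integers `p ≥ 2`. -/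
theorem lintegral_ballMaximal_pow_le (hn : n ≠ 0) {q : ℕ} (hq : q ≠ 0) (hu : AEMeasurable u) :
    ∫⁻ x, ballMaximal u x ^ (q + 1) ≤ 2 ^ (2 * q + 3) * 4 ^ n * ∫⁻ x, u x ^ (q + 1) := by
  wlog hu' : Measurable u generalizing u
  · have h1 : ∀ x, ballMaximal u x = ballMaximal (hu.mk u) x := fun x => le_antisymm
      (ballMaximal_mono_ae (hu.ae_eq_mk.mono fun _ h => h.le) x)
      (ballMaximal_mono_ae (hu.ae_eq_mk.mono fun _ h => h.ge) x)
    simp only [h1]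
    rw [lintegral_congr_ae (hu.ae_eq_mk.mono fun x hx => by simp only [hx] :
      (fun x => u x ^ (q + 1)) =ᵐ[volume] fun x => hu.mk u x ^ (q + 1))]
    exact this hu.measurable_mk.aemeasurable hu.measurable_mk
  have hz : ∀ k : ℤ, ((2 : ℝ≥0∞) ^ (k + 1)) = 2 * 2 ^ k := fun k => by
    rw [ENNReal.zpow_add (by norm_num) (by norm_num), zpow_one, mul_comm]
  have key : ∀ k : ℤ, (2 : ℝ≥0∞) ^ k * volume {x | (2 : ℝ≥0∞) ^ (k + 1) < ballMaximal u x} ≤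
      4 ^ n * ∫⁻ x in {x | (2 : ℝ≥0∞) ^ k < u x}, u x := by
    intro k
    rw [hz]
    exact mul_volume_ballMaximal_gt_two_mul_le hn hu' ((2 : ℝ≥0∞) ^ k)
  calc ∫⁻ x, ballMaximal u x ^ (q + 1)
      ≤ ∫⁻ x, 2 ^ (q + 1) * dyadicSum (q + 1) (ballMaximal u x) := by
        gcongr with x
        exact pow_le_dyadicSum (by omega) _
    _ = 2 ^ (q + 1) * ∑' k : ℤ, ((2 : ℝ≥0∞) ^ k) ^ (q + 1) *
          volume {x | (2 : ℝ≥0∞) ^ k < ballMaximal u x} := by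
        have hmeas : ∀ k : ℤ, MeasurableSet {x : Euc n | (2 : ℝ≥0∞) ^ k < ballMaximal u x} :=
          fun k => measurableSet_lt measurable_const (measurable_ballMaximal u)
        rw [lintegral_const_mul']
        · congr 1
          simp only [dyadicSum]
          rw [lintegral_tsum]
          · refine tsum_congr fun k => ?_
            rw [← lintegral_indicator_const (hmeas k)]
            exact lintegral_congr fun x => by simp [indicator]
          · exact fun k => (Measurable.ite (hmeas k) measurable_const
              measurable_const).aemeasurable
        · simp
    _ = 2 ^ (q + 1) * ∑' k : ℤ, ((2 : ℝ≥0∞) ^ (k + 1)) ^ (q + 1) *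
          volume {x | (2 : ℝ≥0∞) ^ (k + 1) < ballMaximal u x} := by
        rw [← (Equiv.addRight (1 : ℤ)).tsum_eq]
        rfl
    -- One factor `2 ^ k` is reserved for the weak type bound; the remaining `q` factors stay as
    -- weights and recombine below into `u * dyadicSum q u`.
    _ = 2 ^ (2 * q + 2) * ∑' k : ℤ, ((2 : ℝ≥0∞) ^ k) ^ q * ((2 : ℝ≥0∞) ^ k *
          volume {x | (2 : ℝ≥0∞) ^ (k + 1) < ballMaximal u x}) := by
        rw [← ENNReal.tsum_mul_left, ← ENNReal.tsum_mul_left]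
        refine tsum_congr fun k => ?_
        rw [show ((2 : ℝ≥0∞) ^ (k + 1)) ^ (q + 1) = (2 * 2 ^ k) ^ (q + 1) by rw [hz]]
        ring
    _ ≤ 2 ^ (2 * q + 2) * ∑' k : ℤ, ((2 : ℝ≥0∞) ^ k) ^ q *
          (4 ^ n * ∫⁻ x in {x | (2 : ℝ≥0∞) ^ k < u x}, u x) := by
        gcongr _ * ∑' k : ℤ, _ * ?_ with k
        exact key k
    _ = 2 ^ (2 * q + 2) * 4 ^ n * ∫⁻ x, u x * dyadicSum q (u x) := by
        have hmeas : ∀ k : ℤ, MeasurableSet {x : Euc n | (2 : ℝ≥0∞) ^ k < u x} :=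
          fun k => measurableSet_lt measurable_const hu'
        simp only [dyadicSum, ← ENNReal.tsum_mul_left]
        rw [lintegral_tsum]
        · rw [← ENNReal.tsum_mul_left]
          refine tsum_congr fun k => ?_
          rw [← lintegral_indicator (hmeas k)]
          rw [show (fun x => u x * if (2 : ℝ≥0∞) ^ k < u x then ((2 : ℝ≥0∞) ^ k) ^ q else 0) =
            fun x => ((2 : ℝ≥0∞) ^ k) ^ q * {x | (2 : ℝ≥0∞) ^ k < u x}.indicator u x by
              ext x; by_cases h : (2 : ℝ≥0∞) ^ k < u x <;> simp [h, mul_comm]]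
          rw [lintegral_const_mul _ (hu'.indicator (hmeas k))]
          ring
        · exact fun k => (hu'.mul (Measurable.ite (hmeas k) measurable_const
              measurable_const)).aemeasurable
    _ ≤ 2 ^ (2 * q + 2) * 4 ^ n * ∫⁻ x, 2 * u x ^ (q + 1) := by
        gcongr _ * ?_
        refine lintegral_mono fun x => ?_
        calc u x * dyadicSum q (u x) ≤ u x * (2 * u x ^ q) := by
              gcongr; exact dyadicSum_le hq _
          _ = 2 * u x ^ (q + 1) := by ring
    _ = _ := by
        rw [lintegral_const_mul _ (hu'.pow_const _)]
        ring

end ballMaximal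

/-! ### Mollification, dominated by the maximal function. -/

/-- A sequence of bump functions shrinking to the origin. -/
noncomputable def shrinkingBump (n k : ℕ) : ContDiffBump (0 : Euc n) where
  rIn := 1 / (2 * ((k : ℝ) + 1))
  rOut := 1 / ((k : ℝ) + 1)
  rIn_pos := by positivity
  rIn_lt_rOut := by
    have : (0 : ℝ) < (k : ℝ) + 1 := by positivity
    gcongr
    linarith

/-- Regularization by convolution with the bump functions `shrinkingBump`. -/
noncomputable def mollify {n : ℕ} {F : Type*} [NormedAddCommGroup F] [NormedSpace ℝ F]
    (k : ℕ) (f : Euc n → F) : Euc n → F :=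
  (shrinkingBump n k).normed volume ⋆[lsmul ℝ ℝ, volume] f

section mollify

variable {n : ℕ} {F : Type*} [NormedAddCommGroup F] [NormedSpace ℝ F]
  {f : Euc n → F} {f' : Euc n → Euc n →L[ℝ] F}

theorem shrinkingBump_rOut_tendsto : Tendsto (fun k => (shrinkingBump n k).rOut) atTop (𝓝 0) :=
  tendsto_one_div_add_atTop_nhds_zero_nat

theorem shrinkingBump_rOut_le (k : ℕ) : (shrinkingBump n k).rOut ≤ 1 := by
  change 1 / ((k : ℝ) + 1) ≤ 1
  rw [div_le_one (by positivity)]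
  have : (0 : ℝ) ≤ k := by positivity
  linarith

theorem shrinkingBump_rOut_eq (k : ℕ) :
    (shrinkingBump n k).rOut = 2 * (shrinkingBump n k).rIn := by
  change 1 / ((k : ℝ) + 1) = 2 * (1 / (2 * ((k : ℝ) + 1)))
  field_simp

theorem contDiff_mollify (k : ℕ) (hf : LocallyIntegrable f) : ContDiff ℝ ∞ (mollify k f) :=
  (shrinkingBump n k).hasCompactSupport_normed.contDiff_convolution_left _
    (shrinkingBump n k).contDiff_normed hf

theorem mollify_apply (k : ℕ) (f : Euc n → F) (x : Euc n) :
    mollify k f x = ∫ t, (shrinkingBump n k).normed volume (x - t) • f t := by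
  rw [mollify, convolution_eq_swap]
  simp only [lsmul_apply]

/-- The derivative falls on the kernel; testing the weak derivative against `t ↦ φ (x - t)` moves it
to `f`, and the two minus signs cancel. -/
theorem fderiv_mollify [CompleteSpace F] (h : IsWeakDerivative f f') (k : ℕ) (x : Euc n) :
    fderiv ℝ (mollify k f) x = mollify k f' x := by
  set φ : Euc n → ℝ := (shrinkingBump n k).normed volume with hφ
  have hc : HasCompactSupport φ := (shrinkingBump n k).hasCompactSupport_normed
  have hd : ContDiff ℝ ∞ φ := (shrinkingBump n k).contDiff_normed
  have hD := (hc.hasFDerivAt_convolution_left (lsmul ℝ ℝ) (hd.of_le (by norm_num))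
    h.locallyIntegrable x).fderiv
  rw [mollify, hD]
  ext v
  have hψ : ∀ t, HasFDerivAt (fun t => φ (x - t)) (-(fderiv ℝ φ (x - t))) t := by
    intro t
    have h1 := ((hd.differentiable (by norm_num)) (x - t)).hasFDerivAt
    have h2 : HasFDerivAt (fun t => x - t) (-(ContinuousLinearMap.id ℝ (Euc n))) t :=
      (hasFDerivAt_id t).const_sub x
    have h3 := h1.comp t h2
    rw [ContinuousLinearMap.comp_neg, ContinuousLinearMap.comp_id] at h3
    exact h3
  have hcψ : HasCompactSupport fun t => φ (x - t) :=
    hc.comp_homeomorph (Homeomorph.subLeft x)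
  have hI := h.integral_eq (fun t => φ (x - t)) (hd.comp (contDiff_const.sub contDiff_id)) hcψ v
  have hint : Integrable fun t => φ (x - t) • f' t :=
    h.locallyIntegrable_deriv.integrable_smul_left_of_hasCompactSupport
      (hd.continuous.comp (continuous_const.sub continuous_id)) hcψ
  have hint2 : ConvolutionExistsAt (fderiv ℝ φ) f x ((lsmul ℝ ℝ).precompL (Euc n)) volume :=
    (hc.fderiv ℝ).convolutionExists_left _ (hd.continuous_fderiv (by norm_num))
      h.locallyIntegrable x
  rw [mollify_apply, ContinuousLinearMap.integral_apply hint, convolution_eq_swap,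
    ContinuousLinearMap.integral_apply]
  · simp only [smul_apply] at hI ⊢
    rw [← neg_eq_iff_eq_neg] at hI
    rw [← hI, ← integral_neg]
    refine integral_congr_ae (Eventually.of_forall fun t => ?_)
    simp only [(hψ t).fderiv, neg_apply, neg_smul, neg_neg]
    rfl
  · exact hint2.integrable_swap

theorem ae_tendsto_mollify [CompleteSpace F] (hf : LocallyIntegrable f) :
    ∀ᵐ x, Tendsto (fun k => mollify k f x) atTop (𝓝 (f x)) :=
  ContDiffBump.ae_convolution_tendsto_right_of_locallyIntegrable (K := 2)
    shrinkingBump_rOut_tendsto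
    (Eventually.of_forall fun k => (shrinkingBump_rOut_eq k).le) hf

theorem tendsto_mollify_of_continuous [CompleteSpace F] (hf : Continuous f) (x : Euc n) :
    Tendsto (fun k => mollify k f x) atTop (𝓝 (f x)) :=
  ContDiffBump.convolution_tendsto_right_of_continuous shrinkingBump_rOut_tendsto hf x

theorem norm_mollify_le [CompleteSpace F] {C : ℝ}
    (h : ∀ x, ‖f x‖ ≤ C) (k : ℕ) (x : Euc n) : ‖mollify k f x‖ ≤ C := by
  set φ : Euc n → ℝ := (shrinkingBump n k).normed volume with hφ
  have hi : Integrable φ := (shrinkingBump n k).integrable_normed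
  rw [mollify, convolution_def]
  calc ‖∫ t, lsmul ℝ ℝ (φ t) (f (x - t))‖ ≤ ∫ t, φ t * C := by
        refine norm_integral_le_of_norm_le (hi.mul_const C) (Eventually.of_forall fun t => ?_)
        rw [lsmul_apply, norm_smul, Real.norm_of_nonneg ((shrinkingBump n k).nonneg_normed t)]
        exact mul_le_mul_of_nonneg_left (h _) ((shrinkingBump n k).nonneg_normed t)
    _ = C := by
        rw [integral_mul_const, (shrinkingBump n k).integral_normed, one_mul]

theorem dist_mollify_le_of_lipschitz [CompleteSpace F] {C : ℝ≥0} (hf : LipschitzWith C f) (k : ℕ)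
    (x : Euc n) : dist (mollify k f x) (f x) ≤ C :=
  ContDiffBump.dist_normed_convolution_le hf.continuous.aestronglyMeasurable fun y hy =>
    (hf.dist_le_mul y x).trans (by
      have : dist y x ≤ 1 := (mem_ball.1 hy).le.trans (shrinkingBump_rOut_le k)
      nlinarith [C.coe_nonneg])

/-- Because `rOut = 2 * rIn`, the normalized bump is at most `2 ^ n` over the volume of its support
ball. The bound is uniform in `k`, so the maximal function serves as dominating function in the
limits below. -/
theorem enorm_mollify_le (f : Euc n → F) (k : ℕ) (x : Euc n) :
    ‖mollify k f x‖ₑ ≤ 2 ^ n * ballMaximal (fun y => ‖f y‖ₑ) x := by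
  set b := shrinkingBump n k with hb
  have hr : 0 < b.rOut := b.rOut_pos
  have hbound : ∀ t, ‖b.normed volume (x - t) • f t‖ₑ ≤
      (ball x b.rOut).indicator (fun t => 2 ^ n * (volume (ball x b.rOut))⁻¹ * ‖f t‖ₑ) t := by
    intro t
    by_cases ht : t ∈ ball x b.rOut
    · rw [indicator_of_mem ht, enorm_smul]
      gcongr
      have h1 := b.normed_le_div_measure_closedBall_rOut volume 2 (shrinkingBump_rOut_eq k).le (x - t)
      rw [Real.enorm_of_nonneg (b.nonneg_normed _)]
      refine (ENNReal.ofReal_le_ofReal h1).trans_eq ?_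
      have hV : volume (closedBall (0 : Euc n) b.rOut) = volume (ball x b.rOut) := by
        rw [Measure.addHaar_closedBall _ _ hr.le, Measure.addHaar_ball_of_pos _ _ hr]
      rw [finrank_euclideanSpace_fin, measureReal_def, hV, ENNReal.ofReal_div_of_pos
        (ENNReal.toReal_pos (volume_ball_euc_ne_zero x hr) (volume_ball_euc_ne_top x)),
        ENNReal.ofReal_toReal (volume_ball_euc_ne_top x), ENNReal.ofReal_pow (by norm_num),
        div_eq_mul_inv]
      norm_num
    · have : b.normed volume (x - t) = 0 := by
        rw [← Function.notMem_support, b.support_normed_eq, mem_ball, dist_zero_right]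
        rwa [mem_ball, dist_comm, dist_eq_norm] at ht
      simp [this]
  rw [mollify_apply]
  calc ‖∫ t, b.normed volume (x - t) • f t‖ₑ ≤ ∫⁻ t, ‖b.normed volume (x - t) • f t‖ₑ :=
        enorm_integral_le_lintegral_enorm _
    _ ≤ ∫⁻ t, (ball x b.rOut).indicator
          (fun t => 2 ^ n * (volume (ball x b.rOut))⁻¹ * ‖f t‖ₑ) t := lintegral_mono hbound
    _ = 2 ^ n * ((volume (ball x b.rOut))⁻¹ * ∫⁻ t in ball x b.rOut, ‖f t‖ₑ) := by
        rw [lintegral_indicator measurableSet_ball, lintegral_const_mul', mul_assoc]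
        exact ENNReal.mul_ne_top (by simp)
          (ENNReal.inv_ne_top.2 (volume_ball_euc_ne_zero x hr))
    _ ≤ _ := by
        gcongr
        exact le_iSup₂ (f := fun (r : ℝ) (_ : 0 < r) =>
          (volume (ball x r))⁻¹ * ∫⁻ y in ball x r, ‖f y‖ₑ) b.rOut hr

theorem ae_enorm_le_ballMaximal [CompleteSpace F] (hf : LocallyIntegrable f) :
    ∀ᵐ x, ‖f x‖ₑ ≤ 2 ^ n * ballMaximal (fun y => ‖f y‖ₑ) x := by
  filter_upwards [ae_tendsto_mollify hf] with x hx
  exact le_of_tendsto ((continuous_enorm.tendsto _).comp hx)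
    (Eventually.of_forall fun k => enorm_mollify_le f k x)

end mollify

/-! ### Stability of weak derivatives. -/

section weakDerivative

variable {n : ℕ} {F G : Type*} [NormedAddCommGroup F] [NormedSpace ℝ F]
  [NormedAddCommGroup G] [NormedSpace ℝ G]
  {f : Euc n → F} {f' : Euc n → Euc n →L[ℝ] F}

theorem MeasureTheory.LocallyIntegrable.clm_comp {f : Euc n → F} (h : LocallyIntegrable f)
    (L : F →L[ℝ] G) : LocallyIntegrable fun x => L (f x) := fun x =>
  let ⟨s, hs, hi⟩ := h x
  ⟨s, hs, L.integrable_comp hi⟩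

theorem IsWeakDerivative.integrable_left (h : IsWeakDerivative f f') {φ : Euc n → ℝ}
    (hφ : ContDiff ℝ ∞ φ) (hc : HasCompactSupport φ) (v : Euc n) :
    Integrable fun x => (fderiv ℝ φ x v) • f x :=
  h.locallyIntegrable.integrable_smul_left_of_hasCompactSupport
    ((hφ.continuous_fderiv (by norm_num)).clm_apply continuous_const)
    ((hc.fderiv ℝ).comp_left (g := fun L : Euc n →L[ℝ] ℝ => L v) rfl)

theorem IsWeakDerivative.integrable_right (h : IsWeakDerivative f f') {φ : Euc n → ℝ}
    (hφ : ContDiff ℝ ∞ φ) (hc : HasCompactSupport φ) (v : Euc n) :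
    Integrable fun x => φ x • f' x v :=
  (h.locallyIntegrable_deriv.clm_comp
    (ContinuousLinearMap.apply ℝ F v)).integrable_smul_left_of_hasCompactSupport hφ.continuous hc

theorem IsWeakDerivative.clm_comp [CompleteSpace F] [CompleteSpace G] (h : IsWeakDerivative f f') (L : F →L[ℝ] G) :
    IsWeakDerivative (fun x => L (f x)) (fun x => L ∘L f' x) where
  locallyIntegrable := h.locallyIntegrable.clm_comp L
  locallyIntegrable_deriv :=
    h.locallyIntegrable_deriv.clm_comp (ContinuousLinearMap.compL ℝ (Euc n) F G L)
  integral_eq φ hφ hc v := by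
    have h1 := L.integral_comp_comm (h.integrable_left hφ hc v)
    have h2 := L.integral_comp_comm (h.integrable_right hφ hc v)
    simp only [map_smul] at h1 h2
    simp only [ContinuousLinearMap.comp_apply]
    rw [h1, h2, h.integral_eq φ hφ hc v, map_neg]

theorem IsWeakDerivative.sub {g : Euc n → F} {g' : Euc n → Euc n →L[ℝ] F}
    (h : IsWeakDerivative f f') (hg : IsWeakDerivative g g') :
    IsWeakDerivative (fun x => f x - g x) (fun x => f' x - g' x) where
  locallyIntegrable := h.locallyIntegrable.sub hg.locallyIntegrable
  locallyIntegrable_deriv := h.locallyIntegrable_deriv.sub hg.locallyIntegrable_deriv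
  integral_eq φ hφ hc v := by
    simp only [smul_sub, sub_apply]
    rw [integral_sub (h.integrable_left hφ hc v) (hg.integrable_left hφ hc v),
      integral_sub (h.integrable_right hφ hc v) (hg.integrable_right hφ hc v),
      h.integral_eq φ hφ hc v, hg.integral_eq φ hφ hc v]
    abel

/-- A real Lipschitz function has its almost everywhere derivative as weak derivative. -/
theorem LipschitzWith.isWeakDerivative {f : Euc n → ℝ} {C : ℝ≥0} (hf : LipschitzWith C f) :
    IsWeakDerivative f (fderiv ℝ f) where
  locallyIntegrable := hf.continuous.locallyIntegrable
  locallyIntegrable_deriv := by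
    refine (locallyIntegrable_const (C : ℝ)).mono (measurable_fderiv ℝ f).aestronglyMeasurable
      (Eventually.of_forall fun x => ?_)
    simpa using norm_fderiv_le_of_lipschitz ℝ hf
  integral_eq φ hφ hc v := by
    obtain ⟨D, hD⟩ := hφ.lipschitzWith_of_hasCompactSupport hc (by norm_num)
    have h1 := hf.integral_lineDeriv_mul_eq (μ := volume) hD hc v
    have h2 : ∫ x, lineDeriv ℝ φ x (-v) * f x = ∫ x, -((fderiv ℝ φ x v) • f x) := by
      refine integral_congr_ae (Eventually.of_forall fun x => ?_)
      simp only [((hφ.differentiable (by norm_num)) x).lineDeriv_eq_fderiv, map_neg, smul_eq_mul,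
        neg_mul]
    have h3 : ∫ x, lineDeriv ℝ f x v * φ x = ∫ x, φ x • fderiv ℝ f x v := by
      refine integral_congr_ae ?_
      filter_upwards [hf.ae_differentiableAt] with x hx
      simp only [hx.lineDeriv_eq_fderiv, smul_eq_mul, mul_comm]
    rw [← h3, h1, h2, integral_neg, neg_neg]

end weakDerivative

theorem lintegral_le_of_tendsto_of_le {α : Type*} [MeasurableSpace α] {μ : Measure α}
    {u : ℕ → α → ℝ≥0∞} {w : α → ℝ≥0∞} {c : ℕ → ℝ≥0∞} {C : ℝ≥0∞}
    (hu : ∀ k, AEMeasurable (u k) μ) (hw : ∀ᵐ x ∂μ, Tendsto (fun k => u k x) atTop (𝓝 (w x)))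
    (hle : ∀ k, ∫⁻ x, u k x ∂μ ≤ c k) (hc : Tendsto c atTop (𝓝 C)) : ∫⁻ x, w x ∂μ ≤ C :=
  calc ∫⁻ x, w x ∂μ = ∫⁻ x, liminf (fun k => u k x) atTop ∂μ :=
        lintegral_congr_ae (hw.mono fun _ h => h.liminf_eq.symm)
    _ ≤ liminf (fun k => ∫⁻ x, u k x ∂μ) atTop := lintegral_liminf_le' hu
    _ ≤ liminf c atTop := liminf_le_liminf (Eventually.of_forall hle)
    _ = C := hc.liminf_eq

/-! ### The pointwise Sobolev inequality. -/

section sobolev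

variable {n : ℕ} {F : Type*} [NormedAddCommGroup F] [NormedSpace ℝ F]
  {f : Euc n → F} {f' : Euc n → Euc n →L[ℝ] F}

theorem setLIntegral_ball_comp_homothety {w : Euc n → ℝ≥0∞} (hw : Measurable w) (x : Euc n)
    {t : ℝ} (ht : 0 < t) (r : ℝ) :
    ∫⁻ z in ball (0 : Euc n) r, w (x + t • z) =
      (ENNReal.ofReal t ^ n)⁻¹ * ∫⁻ y in ball x (t * r), w y := by
  set W : Euc n → ℝ≥0∞ := (ball x (t * r)).indicator w with hW
  have hWm : Measurable W := hw.indicator measurableSet_ball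
  have h1 : ∀ z, (ball (0 : Euc n) r).indicator (fun z => w (x + t • z)) z = W (x + t • z) := by
    intro z
    have : z ∈ ball (0 : Euc n) r ↔ x + t • z ∈ ball x (t * r) := by
      rw [mem_ball_zero_iff, mem_ball, dist_eq_norm, add_sub_cancel_left, norm_smul,
        Real.norm_of_nonneg ht.le, mul_lt_mul_iff_right₀ ht]
    by_cases hz : z ∈ ball (0 : Euc n) r
    · rw [indicator_of_mem hz, hW, indicator_of_mem (this.1 hz)]
    · rw [indicator_of_notMem hz, hW, indicator_of_notMem (mt this.2 hz)]
  rw [← lintegral_indicator measurableSet_ball, ← lintegral_indicator measurableSet_ball]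
  simp only [h1]
  have h2 : ∫⁻ z, W (x + t • z) = ∫⁻ y, W (x + y) ∂(Measure.map (t • ·) (volume : Measure (Euc n))) := by
    rw [lintegral_map (f := fun y => W (x + y)) (hWm.comp (measurable_const_add x))
      (measurable_const_smul t)]
  rw [h2, Measure.map_addHaar_smul _ ht.ne', lintegral_smul_measure, lintegral_add_left_eq_self,
    finrank_euclideanSpace_fin, abs_of_pos (by positivity), ENNReal.ofReal_inv_of_pos (by positivity),
    ENNReal.ofReal_pow ht.le]
  rfl

/-- Dominated convergence with a multiple of the maximal function as majorant; this is the reason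
for assuming it integrable on `s`. -/
theorem tendsto_setLIntegral_mollify_sub [CompleteSpace F] (hf : LocallyIntegrable f) {s : Set (Euc n)}
    (hM : ∫⁻ y in s, ballMaximal (fun y => ‖f y‖ₑ) y ≠ ⊤) :
    Tendsto (fun k => ∫⁻ y in s, ‖mollify k f y - f y‖ₑ) atTop (𝓝 0) := by
  have h0 : ∫⁻ _ in s, (0 : ℝ≥0∞) = 0 := lintegral_zero
  rw [← h0]
  refine tendsto_lintegral_of_dominated_convergence'
    (fun y => (2 ^ n + 2 ^ n) * ballMaximal (fun y => ‖f y‖ₑ) y) (fun k => ?_) (fun k => ?_) ?_ ?_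
  · exact ((contDiff_mollify k hf).continuous.aestronglyMeasurable.sub
      hf.aestronglyMeasurable.restrict).enorm
  · filter_upwards [ae_restrict_of_ae (ae_enorm_le_ballMaximal hf)] with y hy
    rw [add_mul]
    exact enorm_sub_le.trans (add_le_add (enorm_mollify_le f k y) hy)
  · rw [lintegral_const_mul' _ _ (by simp)]
    exact ENNReal.mul_ne_top (by simp) hM
  · filter_upwards [ae_restrict_of_ae (ae_tendsto_mollify hf)] with y hy
    have := (hy.sub_const (f y)).enorm
    simpa using this

/-- Integrate `∇g` along the rays `t ↦ x + t z` and exchange the integrals: for fixed `t` the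
homothety turns the `z`-integral into a rescaled integral over `ball x (t * r)`. Integrating in `z`
first avoids a singular kernel. -/
theorem lintegral_enorm_homothety_sub_le {g : Euc n → F} (hg : ContDiff ℝ 1 g) (x : Euc n) {r τ : ℝ}
    (hτ : 0 < τ) (hτ1 : τ ≤ 1) {A : ℝ≥0∞}
    (hA : ∀ t ∈ Icc τ 1, (ENNReal.ofReal t ^ n)⁻¹ * ∫⁻ y in ball x (t * r), ‖fderiv ℝ g y‖ₑ ≤ A) :
    ∫⁻ z in ball (0 : Euc n) r, ‖g (x + τ • z) - g (x + z)‖ₑ ≤ ENNReal.ofReal r * A := by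
  have hcont : Continuous fun p : Euc n × ℝ => ‖fderiv ℝ g (x + p.2 • p.1)‖ₑ :=
    ((hg.continuous_fderiv one_ne_zero).comp
      (continuous_const.add (continuous_snd.smul continuous_fst))).enorm
  have hcurve : ∀ z : Euc n, ContDiff ℝ 1 fun t : ℝ => g (x + t • z) := fun z =>
    hg.comp (contDiff_const.add (contDiff_id.smul contDiff_const))
  have hderiv : ∀ (z : Euc n) (t : ℝ), deriv (fun t : ℝ => g (x + t • z)) t =
      fderiv ℝ g (x + t • z) z := by
    intro z t
    have h1 : HasDerivAt (fun t : ℝ => x + t • z) z t := by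
      simpa using ((hasDerivAt_id t).smul_const z).const_add x
    exact (((hg.differentiable one_ne_zero) (x + t • z)).hasFDerivAt.comp_hasDerivAt t h1).deriv
  calc ∫⁻ z in ball (0 : Euc n) r, ‖g (x + τ • z) - g (x + z)‖ₑ
      ≤ ∫⁻ z in ball (0 : Euc n) r, ∫⁻ t in Icc τ 1,
          ENNReal.ofReal r * ‖fderiv ℝ g (x + t • z)‖ₑ := by
        refine setLIntegral_mono' measurableSet_ball fun z hz => ?_
        rw [← enorm_neg, neg_sub]
        have h := enorm_sub_le_lintegral_deriv_of_contDiffOn_Icc (hcurve z).contDiffOn hτ1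
        simp only [one_smul, hderiv] at h
        refine h.trans (lintegral_mono fun t => ?_)
        refine (ContinuousLinearMap.le_opENorm _ _).trans ?_
        rw [mul_comm]
        gcongr
        rw [← ofReal_norm]
        exact ENNReal.ofReal_le_ofReal (mem_ball_zero_iff.1 hz).le
    _ = ∫⁻ t in Icc τ 1, ∫⁻ z in ball (0 : Euc n) r,
          ENNReal.ofReal r * ‖fderiv ℝ g (x + t • z)‖ₑ :=
        lintegral_lintegral_swap (hcont.measurable.const_mul _).aemeasurable
    _ ≤ ∫⁻ t in Icc τ 1, ENNReal.ofReal r * A := by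
        refine setLIntegral_mono' measurableSet_Icc fun t ht => ?_
        rw [lintegral_const_mul' _ _ ENNReal.ofReal_ne_top,
          setLIntegral_ball_comp_homothety (hg.continuous_fderiv one_ne_zero).enorm.measurable x
            (hτ.trans_le ht.1)]
        gcongr
        exact hA t ht
    _ ≤ ENNReal.ofReal r * A := by
        rw [setLIntegral_const, Real.volume_Icc]
        refine mul_le_of_le_one_right (by positivity) ?_
        rw [ENNReal.ofReal_le_one]
        linarith

/-- The ray estimate is applied to mollifications. The parameter `τ` stays positive while `k → ∞`,
since the approximation error carries a factor `τ ^ (-n)`; only then does `τ → 0`, by continuity of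
`f`. -/
theorem lintegral_enorm_sub_center_le [CompleteSpace F] (h : IsWeakDerivative f f') (hf : Continuous f)
    (hM : ∀ x r, ∫⁻ y in ball x r, ballMaximal (fun y => ‖f' y‖ₑ) y ≠ ⊤) (x : Euc n) {r : ℝ}
    (hr : 0 < r) :
    ∫⁻ z in ball x r, ‖f x - f z‖ₑ ≤
      ENNReal.ofReal r * (volume (ball x r) * ballMaximal (fun y => ‖f' y‖ₑ) x) := by
  set M := ballMaximal (fun y => ‖f' y‖ₑ) x with hMdef
  have step : ∀ τ : ℝ, 0 < τ → τ ≤ 1 → ∫⁻ z in ball (0 : Euc n) r, ‖f (x + τ • z) - f (x + z)‖ₑ ≤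
      ENNReal.ofReal r * (volume (ball x r) * M) := by
    intro τ hτ hτ1
    have he := tendsto_setLIntegral_mollify_sub h.locallyIntegrable_deriv (hM x r)
    set e := fun k => ∫⁻ y in ball x r, ‖mollify k f' y - f' y‖ₑ
    have hc : Tendsto (fun k => ENNReal.ofReal r * (volume (ball x r) * M +
        (ENNReal.ofReal τ ^ n)⁻¹ * e k)) atTop
        (𝓝 (ENNReal.ofReal r * (volume (ball x r) * M + (ENNReal.ofReal τ ^ n)⁻¹ * 0))) := by
      refine ENNReal.Tendsto.const_mul ?_ (Or.inr ENNReal.ofReal_ne_top)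
      refine tendsto_const_nhds.add (ENNReal.Tendsto.const_mul he (Or.inr ?_))
      exact ENNReal.inv_ne_top.2 (pow_ne_zero _ (by simpa using hτ))
    rw [mul_zero, add_zero] at hc
    refine lintegral_le_of_tendsto_of_le
      (u := fun k z => ‖mollify k f (x + τ • z) - mollify k f (x + z)‖ₑ) (fun k => ?_)
      (Eventually.of_forall fun z => ?_) (fun k => ?_) hc
    · have hk := (contDiff_mollify k h.locallyIntegrable).continuous
      exact Continuous.aemeasurable (by fun_prop)
    · exact ((tendsto_mollify_of_continuous hf _).sub (tendsto_mollify_of_continuous hf _)).enorm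
    · refine lintegral_enorm_homothety_sub_le
        ((contDiff_mollify k h.locallyIntegrable).of_le (by norm_num)) x hτ hτ1 fun t ht => ?_
      have ht0 : 0 < t := hτ.trans_le ht.1
      have ht0' : ENNReal.ofReal t ^ n ≠ 0 := pow_ne_zero _ (by simpa using ht0)
      have htT : ENNReal.ofReal t ^ n ≠ ⊤ := by simp
      calc (ENNReal.ofReal t ^ n)⁻¹ * ∫⁻ y in ball x (t * r), ‖fderiv ℝ (mollify k f) y‖ₑ
          ≤ (ENNReal.ofReal t ^ n)⁻¹ * (∫⁻ y in ball x (t * r), ‖f' y‖ₑ +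
              ‖mollify k f' y - f' y‖ₑ) := by
            gcongr with y
            rw [fderiv_mollify h]
            calc _ = ‖f' y + (mollify k f' y - f' y)‖ₑ := by congr 1; abel
              _ ≤ _ := enorm_add_le (E := Euc n →L[ℝ] F) _ _
        _ = (ENNReal.ofReal t ^ n)⁻¹ * (∫⁻ y in ball x (t * r), ‖f' y‖ₑ) +
              (ENNReal.ofReal t ^ n)⁻¹ * ∫⁻ y in ball x (t * r), ‖mollify k f' y - f' y‖ₑ := by
            rw [lintegral_add_left' h.locallyIntegrable_deriv.aestronglyMeasurable.restrict.enorm,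
              mul_add]
        _ ≤ _ := by
            refine add_le_add ?_ (mul_le_mul' ?_ ?_)
            · calc _ ≤ (ENNReal.ofReal t ^ n)⁻¹ * (volume (ball x (t * r)) * M) := by
                    gcongr
                    exact setLIntegral_ball_le _ x (mul_pos ht0 hr)
                _ = _ := by
                    rw [volume_ball_scale x hr ht0, ← mul_assoc, ← mul_assoc,
                      ENNReal.inv_mul_cancel ht0' htT, one_mul]
            · gcongr
              exact ht.1
            · refine lintegral_mono_set (ball_subset_ball ?_)
              nlinarith [ht.2]
  have hlim : ∫⁻ z in ball (0 : Euc n) r, ‖f x - f (x + z)‖ₑ ≤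
      ENNReal.ofReal r * (volume (ball x r) * M) := by
    refine lintegral_le_of_tendsto_of_le
      (u := fun (k : ℕ) z => ‖f (x + (1 / ((k : ℝ) + 1)) • z) - f (x + z)‖ₑ) (fun k => ?_)
      (Eventually.of_forall fun z => ?_) (fun k => step _ (by positivity) ?_) tendsto_const_nhds
    · exact Continuous.aemeasurable (by fun_prop)
    · have h1 : Tendsto (fun k : ℕ => x + (1 / ((k : ℝ) + 1)) • z) atTop (𝓝 (x + (0 : ℝ) • z)) :=
        tendsto_const_nhds.add (tendsto_one_div_add_atTop_nhds_zero_nat.smul_const z)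
      rw [zero_smul, add_zero] at h1
      exact (((hf.tendsto x).comp h1).sub_const _).enorm
    · rw [div_le_one (by positivity)]
      linarith [(Nat.cast_nonneg k : (0 : ℝ) ≤ k)]
  have h1 := setLIntegral_ball_comp_homothety (w := fun z => ‖f x - f z‖ₑ)
    (Continuous.measurable (by fun_prop)) x one_pos r
  simp only [one_smul, one_mul, ENNReal.ofReal_one, one_pow, inv_one] at h1
  rwa [← h1]

/-- The pointwise Sobolev inequality `|f x - f y| ≤ C |x - y| (M|Df| x + M|Df| y)`. -/
theorem edist_le_edist_mul_ballMaximal [CompleteSpace F] (h : IsWeakDerivative f f') (hf : Continuous f)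
    (hM : ∀ x r, ∫⁻ y in ball x r, ballMaximal (fun y => ‖f' y‖ₑ) y ≠ ⊤) (x y : Euc n) :
    edist (f x) (f y) ≤ 2 ^ (n + 1) * edist x y *
      (ballMaximal (fun y => ‖f' y‖ₑ) x + ballMaximal (fun y => ‖f' y‖ₑ) y) := by
  rcases eq_or_ne x y with rfl | hxy
  · simp
  set M := ballMaximal (fun y => ‖f' y‖ₑ)
  set r := dist x y with hrdef
  have hr : 0 < r := dist_pos.2 hxy
  have hV0 := volume_ball_euc_ne_zero y hr
  have hVT := volume_ball_euc_ne_top y (r := r)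
  -- Both values are compared with `f z` and averaged over `z ∈ ball y r`, which is contained in
  -- `ball x (2 * r)`.
  have key : edist (f x) (f y) * volume (ball y r) ≤
      (2 ^ (n + 1) * edist x y * (M x + M y)) * volume (ball y r) := by
    calc edist (f x) (f y) * volume (ball y r) = ∫⁻ z in ball y r, edist (f x) (f y) := by
          rw [setLIntegral_const]
      _ ≤ ∫⁻ z in ball y r, (‖f x - f z‖ₑ + ‖f y - f z‖ₑ) := by
          refine lintegral_mono fun z => ?_
          rw [← edist_eq_enorm_sub, ← edist_eq_enorm_sub]
          exact edist_triangle_right _ _ _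
      _ = (∫⁻ z in ball y r, ‖f x - f z‖ₑ) + ∫⁻ z in ball y r, ‖f y - f z‖ₑ :=
          lintegral_add_left (Continuous.measurable (by fun_prop)) _
      _ ≤ (∫⁻ z in ball x (2 * r), ‖f x - f z‖ₑ) + ∫⁻ z in ball y r, ‖f y - f z‖ₑ := by
          gcongr ?_ + _
          refine lintegral_mono_set (ball_subset_ball' ?_)
          rw [dist_comm y x, ← hrdef]
          linarith
      _ ≤ ENNReal.ofReal (2 * r) * (volume (ball x (2 * r)) * M x) +
            ENNReal.ofReal r * (volume (ball y r) * M y) :=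
          add_le_add (lintegral_enorm_sub_center_le h hf hM x (by positivity))
            (lintegral_enorm_sub_center_le h hf hM y hr)
      _ = (2 ^ (n + 1) * edist x y * M x + edist x y * M y) * volume (ball y r) := by
          rw [volume_ball_scale x hr (by norm_num), volume_ball_center x y,
            ENNReal.ofReal_mul (by norm_num), hrdef, ← edist_dist]
          norm_num
          ring
      _ ≤ _ := by
          rw [mul_add]
          gcongr
          exact le_mul_of_one_le_left (by positivity) (one_le_pow₀ (by norm_num))
  exact (ENNReal.mul_le_mul_iff_left hV0 hVT).1 key

end sobolev

/-! ### Weak derivatives on zero sets. -/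

section zeroSet

variable {n : ℕ} {F : Type*} [NormedAddCommGroup F] [NormedSpace ℝ F]

theorem ae_lt_top_of_setLIntegral_ball {w : Euc n → ℝ≥0∞} (hw : Measurable w)
    (h : ∀ x r, ∫⁻ y in ball x r, w y ≠ ⊤) : ∀ᵐ x, w x < ⊤ := by
  have h1 : ∀ k : ℕ, ∀ᵐ x, x ∈ ball (0 : Euc n) k → w x < ⊤ := fun k =>
    (ae_restrict_iff' measurableSet_ball).1 (ae_lt_top hw (h 0 k))
  filter_upwards [ae_all_iff.2 h1] with x hx
  obtain ⟨k, hk⟩ := exists_nat_gt ‖x‖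
  exact hx k (by simpa using hk)

theorem locallyIntegrable_toReal {w : Euc n → ℝ≥0∞} (hw : Measurable w)
    (h : ∀ x r, ∫⁻ y in ball x r, w y ≠ ⊤) : LocallyIntegrable fun x => (w x).toReal := fun x =>
  ⟨ball x 1, ball_mem_nhds x one_pos, integrable_toReal_of_lintegral_ne_top hw.aemeasurable (h x 1)⟩

theorem norm_mollify_le_toReal (f : Euc n → F) (k : ℕ) {x : Euc n}
    (h : ballMaximal (fun y => ‖f y‖ₑ) x < ⊤) :
    ‖mollify k f x‖ ≤ 2 ^ n * (ballMaximal (fun y => ‖f y‖ₑ) x).toReal := by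
  have := ENNReal.toReal_mono (ENNReal.mul_ne_top (by simp) h.ne) (enorm_mollify_le f k x)
  simpa [ENNReal.toReal_mul] using this

theorem integral_fderiv_mul_eq_neg {φ g : Euc n → ℝ} (hφ : ContDiff ℝ 1 φ)
    (hc : HasCompactSupport φ) (hg : ContDiff ℝ 1 g) (v : Euc n) :
    ∫ x, fderiv ℝ φ x v * g x = -∫ x, φ x * fderiv ℝ g x v := by
  have hc' : HasCompactSupport fun x => fderiv ℝ φ x v :=
    (hc.fderiv ℝ).comp_left (g := fun L : Euc n →L[ℝ] ℝ => L v) rfl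
  have hφ' : Continuous fun x => fderiv ℝ φ x v :=
    (hφ.continuous_fderiv one_ne_zero).clm_apply continuous_const
  have hg' : Continuous fun x => fderiv ℝ g x v :=
    (hg.continuous_fderiv one_ne_zero).clm_apply continuous_const
  rw [integral_mul_fderiv_eq_neg_fderiv_mul_of_integrable, neg_neg]
  · exact (hφ'.mul hg.continuous).integrable_of_hasCompactSupport hc'.mul_right
  · exact (hφ.continuous.mul hg').integrable_of_hasCompactSupport hc.mul_right
  · exact (hφ.continuous.mul hg.continuous).integrable_of_hasCompactSupport hc.mul_right
  · exact fun x _ => hφ.differentiable one_ne_zero x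
  · exact fun x _ => hg.differentiable one_ne_zero x

variable {u : Euc n → ℝ} {U : Euc n → Euc n →L[ℝ] ℝ}

/-- The chain rule for weak derivatives, in integrated form. -/
theorem IsWeakDerivative.integral_comp (h : IsWeakDerivative u U) (hu : Continuous u)
    (hM : ∀ x r, ∫⁻ y in ball x r, ballMaximal (fun y => ‖U y‖ₑ) y ≠ ⊤) {ψ ψ' : ℝ → ℝ} {A B : ℝ}
    (hψ : ∀ t, HasDerivAt ψ (ψ' t) t) (hψ' : Continuous ψ') (hA : ∀ t, |ψ t| ≤ A)
    (hB : ∀ t, |ψ' t| ≤ B) {φ : Euc n → ℝ} (hφ : ContDiff ℝ ∞ φ) (hc : HasCompactSupport φ)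
    (v : Euc n) :
    ∫ x, fderiv ℝ φ x v * ψ (u x) = -∫ x, φ x * (ψ' (u x) * U x v) := by
  set M := ballMaximal fun y => ‖U y‖ₑ
  have hB0 : 0 ≤ B := (abs_nonneg _).trans (hB 0)
  have hψc : Continuous ψ := continuous_iff_continuousAt.2 fun t => (hψ t).continuousAt
  have hψ1 : ContDiff ℝ 1 ψ := contDiff_one_iff_deriv.2
    ⟨fun t => (hψ t).differentiableAt, by rwa [show deriv ψ = ψ' from funext fun t => (hψ t).deriv]⟩
  have hfin : ∀ᵐ x, M x < ⊤ := ae_lt_top_of_setLIntegral_ball (measurable_ballMaximal _) hM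
  have hcU : ∀ k, ContDiff ℝ ∞ (mollify k u) := fun k => contDiff_mollify k h.locallyIntegrable
  have hc' : HasCompactSupport fun x => fderiv ℝ φ x v :=
    (hc.fderiv ℝ).comp_left (g := fun L : Euc n →L[ℝ] ℝ => L v) rfl
  have hφ' : Continuous fun x => fderiv ℝ φ x v :=
    (hφ.continuous_fderiv (by norm_num)).clm_apply continuous_const
  have heq : ∀ k, ∫ x, fderiv ℝ φ x v * ψ (mollify k u x) =
      -∫ x, φ x * (ψ' (mollify k u x) * mollify k U x v) := by
    intro k
    refine (integral_fderiv_mul_eq_neg (hφ.of_le (by norm_num)) hc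
      (hψ1.comp ((hcU k).of_le (by norm_num))) v).trans ?_
    congr 1
    refine integral_congr_ae (Eventually.of_forall fun x => ?_)
    have h1 := (hψ (mollify k u x)).comp_hasFDerivAt x
      (((hcU k).differentiable (by norm_num)) x).hasFDerivAt
    simp only [h1.fderiv, smul_apply, smul_eq_mul, fderiv_mollify h]
  have hL : Tendsto (fun k => ∫ x, fderiv ℝ φ x v * ψ (mollify k u x)) atTop
      (𝓝 (∫ x, fderiv ℝ φ x v * ψ (u x))) := by
    refine tendsto_integral_of_dominated_convergence (fun x => |fderiv ℝ φ x v| * A) (fun k => ?_)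
      ((hφ'.abs.mul continuous_const).integrable_of_hasCompactSupport hc'.abs.mul_right)
      (fun k => Eventually.of_forall fun x => ?_) (Eventually.of_forall fun x => ?_)
    · exact (hφ'.mul (hψc.comp (hcU k).continuous)).aestronglyMeasurable
    · rw [norm_mul, Real.norm_eq_abs, Real.norm_eq_abs]
      gcongr
      exact hA _
    · exact ((hψc.tendsto _).comp (tendsto_mollify_of_continuous hu x)).const_mul _
  have hR : Tendsto (fun k => ∫ x, φ x * (ψ' (mollify k u x) * mollify k U x v)) atTop
      (𝓝 (∫ x, φ x * (ψ' (u x) * U x v))) := by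
    refine tendsto_integral_of_dominated_convergence
      (fun x => (|φ x| * (B * 2 ^ n * ‖v‖)) • (M x).toReal) (fun k => ?_) ?_ (fun k => ?_) ?_
    · exact (hφ.continuous.mul ((hψ'.comp (hcU k).continuous).mul
        ((contDiff_mollify k h.locallyIntegrable_deriv).continuous.clm_apply
          continuous_const))).aestronglyMeasurable
    · exact (locallyIntegrable_toReal (measurable_ballMaximal _)
        hM).integrable_smul_left_of_hasCompactSupport (hφ.continuous.abs.mul continuous_const)
          hc.abs.mul_right
    · filter_upwards [hfin] with x hx
      rw [norm_mul, norm_mul, Real.norm_eq_abs, Real.norm_eq_abs, smul_eq_mul]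
      calc |φ x| * (|ψ' (mollify k u x)| * ‖mollify k U x v‖)
          ≤ |φ x| * (B * ((2 ^ n * (M x).toReal) * ‖v‖)) := by
            gcongr
            · exact hB _
            · exact (le_opNorm _ _).trans (by gcongr; exact norm_mollify_le_toReal U k hx)
        _ = _ := by ring
    · filter_upwards [ae_tendsto_mollify h.locallyIntegrable_deriv] with x hx
      refine Tendsto.const_mul _ (Tendsto.mul
        ((hψ'.tendsto _).comp (tendsto_mollify_of_continuous hu x)) ?_)
      exact ((ContinuousLinearMap.apply ℝ ℝ v).continuous.tendsto _).comp hx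
  refine tendsto_nhds_unique hL ?_
  simp only [heq]
  exact hR.neg

/-- The weak derivative of a continuous function vanishes almost everywhere on its zero set. -/
theorem IsWeakDerivative.ae_eq_zero_of_eq_zero (h : IsWeakDerivative u U) (hu : Continuous u)
    (hM : ∀ x r, ∫⁻ y in ball x r, ballMaximal (fun y => ‖U y‖ₑ) y ≠ ⊤) :
    ∀ᵐ x, u x = 0 → U x = 0 := by
  have hZ : MeasurableSet {x | u x = 0} := (isClosed_eq hu continuous_const).measurableSet
  have hUi : LocallyIntegrable ({x | u x = 0}.indicator U) := by
    have := LocallyIntegrable.indicator (f := U) (ε'' := Euc n →L[ℝ] ℝ)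
      h.locallyIntegrable_deriv hZ
    exact this
  have hzero : ∀ᵐ x, {x | u x = 0}.indicator U x = 0 := by
    refine ae_eq_zero_of_integral_contDiff_smul_eq_zero hUi fun φ hφ hc => ?_
    have hi : Integrable fun x => φ x • {x | u x = 0}.indicator U x :=
      hUi.integrable_smul_left_of_hasCompactSupport hφ.continuous hc
    ext v
    rw [ContinuousLinearMap.integral_apply hi, zero_apply]
    simp only [smul_apply, smul_eq_mul]
    have hc' : HasCompactSupport fun x => fderiv ℝ φ x v :=
      (hc.fderiv ℝ).comp_left (g := fun L : Euc n →L[ℝ] ℝ => L v) rfl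
    have hφ' : Continuous fun x => fderiv ℝ φ x v :=
      (hφ.continuous_fderiv (by norm_num)).clm_apply continuous_const
    -- The functions `arctan (a j * u) / a j` tend to zero uniformly, while the derivatives `1 / (1
    -- + (a j * u) ^ 2)` stay bounded by `1` and tend to the indicator of `{u = 0}`. The chain rule
    -- then shows that the indicator times `U` integrates to zero against every test function.
    set a : ℕ → ℝ := fun j => (j : ℝ) + 1 with ha
    have ha0 : ∀ j, 0 < a j := fun j => by positivity
    have hder : ∀ j t, HasDerivAt (fun t => Real.arctan (a j * t) / a j)
        (1 / (1 + (a j * t) ^ 2)) t := by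
      intro j t
      have h1 := (((hasDerivAt_id t).const_mul (a j)).arctan).div_const (a j)
      refine h1.congr_deriv ?_
      have := (ha0 j).ne'
      simp only [id]
      field_simp
    have hbd : ∀ j t, |Real.arctan (a j * t) / a j| ≤ Real.pi / 2 * (1 / a j) := by
      intro j t
      rw [abs_div, abs_of_pos (ha0 j), div_eq_mul_one_div]
      gcongr
      exact abs_le.2 ⟨(Real.neg_pi_div_two_lt_arctan _).le, (Real.arctan_lt_pi_div_two _).le⟩
    have hbd' : ∀ j t, |1 / (1 + (a j * t) ^ 2)| ≤ 1 := by
      intro j t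
      rw [abs_of_pos (by positivity), div_le_one (by positivity)]
      linarith [sq_nonneg (a j * t)]
    have ha1 : Tendsto (fun j => 1 / a j) atTop (𝓝 0) := tendsto_one_div_add_atTop_nhds_zero_nat
    have haT : Tendsto a atTop atTop := tendsto_natCast_atTop_atTop.atTop_add tendsto_const_nhds
    have heq : ∀ j, ∫ x, fderiv ℝ φ x v * (Real.arctan (a j * u x) / a j) =
        -∫ x, φ x * (1 / (1 + (a j * u x) ^ 2) * U x v) := fun j =>
      h.integral_comp hu hM (hder j) (Continuous.div continuous_const (by fun_prop)
        fun t => by positivity) (hbd j) (hbd' j) hφ hc v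
    have hL : Tendsto (fun j => ∫ x, fderiv ℝ φ x v * (Real.arctan (a j * u x) / a j)) atTop
        (𝓝 (∫ _ : Euc n, (0 : ℝ))) := by
      refine tendsto_integral_of_dominated_convergence (fun x => |fderiv ℝ φ x v| * (Real.pi / 2))
        (fun j => ?_)
        ((hφ'.abs.mul continuous_const).integrable_of_hasCompactSupport hc'.abs.mul_right)
        (fun j => Eventually.of_forall fun x => ?_) (Eventually.of_forall fun x => ?_)
      · exact (hφ'.mul ((Real.continuous_arctan.comp
          (continuous_const.mul hu)).div_const _)).aestronglyMeasurable
      · rw [norm_mul, Real.norm_eq_abs, Real.norm_eq_abs]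
        gcongr
        refine (hbd j _).trans (mul_le_of_le_one_right (by positivity) ?_)
        rw [div_le_one (ha0 j)]
        simp [ha]
      · rw [← mul_zero (fderiv ℝ φ x v)]
        refine Tendsto.const_mul _ (squeeze_zero_norm (fun j => hbd j _) ?_)
        simpa using ha1.const_mul (Real.pi / 2)
    have hR : Tendsto (fun j => ∫ x, φ x * (1 / (1 + (a j * u x) ^ 2) * U x v)) atTop
        (𝓝 (∫ x, φ x * {x | u x = 0}.indicator U x v)) := by
      refine tendsto_integral_of_dominated_convergence (fun x => ‖φ x • U x v‖) (fun j => ?_)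
        (h.integrable_right hφ hc v).norm (fun j => Eventually.of_forall fun x => ?_)
        (Eventually.of_forall fun x => ?_)
      · refine hφ.continuous.aestronglyMeasurable.mul (AEStronglyMeasurable.mul
          (Continuous.aestronglyMeasurable ?_) ?_)
        · exact Continuous.div continuous_const (by fun_prop) fun x => by positivity
        · exact h.locallyIntegrable_deriv.aestronglyMeasurable.apply_continuousLinearMap v
      · rw [norm_mul, norm_smul, norm_mul]
        gcongr
        exact mul_le_of_le_one_left (norm_nonneg _) (hbd' j _)
      · refine Tendsto.const_mul _ ?_
        by_cases hx : u x = 0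
        · rw [indicator_of_mem (show x ∈ {x | u x = 0} from hx)]
          simp [hx]
        · rw [indicator_of_notMem (show x ∉ {x | u x = 0} from hx), zero_apply,
            ← zero_mul (U x v)]
          refine Tendsto.mul_const _ ?_
          simp only [one_div]
          refine tendsto_inv_atTop_zero.comp (tendsto_atTop_add_const_left _ _ ?_)
          have h2 : Tendsto (fun j => a j ^ 2 * u x ^ 2) atTop atTop :=
            ((tendsto_pow_atTop two_ne_zero).comp haT).atTop_mul_const (by positivity)
          simpa only [mul_pow] using h2
    have h0 := tendsto_nhds_unique hL (by simp only [heq]; exact hR.neg)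
    rw [integral_zero] at h0
    linarith
  filter_upwards [hzero] with x hx hux
  rwa [indicator_of_mem (show x ∈ {x | u x = 0} from hux)] at hx

end zeroSet

/-! ### Alternating maps under rank one perturbations. -/

section alternating

open Function

variable {R M N ι : Type*} [CommRing R] [AddCommGroup M] [Module R M] [AddCommGroup N] [Module R N]
  [DecidableEq ι]

/-- Once `θ` occupies slot `k`, a multiple of `θ` added in another slot contributes a term with a
repeated argument. -/
theorem AlternatingMap.map_update_of_add_smul (f : M [⋀^ι]→ₗ[R] N) (v : ι → M) (a : ι → R) (θ : M)
    (k : ι) (s : Finset ι) (hk : k ∉ s) :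
    f (update (fun i => if i ∈ s then a i • θ + v i else v i) k θ) = f (update v k θ) := by
  induction s using Finset.induction_on with
  | empty => simp
  | insert l s hl ih =>
    rw [Finset.mem_insert, not_or] at hk
    set w := update (fun i => if i ∈ s then a i • θ + v i else v i) k θ with hw
    have h1 : update (fun i => if i ∈ insert l s then a i • θ + v i else v i) k θ =
        update w l (a l • θ + v l) := by
      ext i
      by_cases hi : i = k
      · subst hi; simp [hw, hk.1]
      · by_cases hil : i = l
        · subst hil; simp [hi]
        · simp [hw, hi, hil]
    have h2 : update w l (v l) = w := by
      rw [← show w l = v l by simp [hw, Ne.symm hk.1, hl], update_eq_self]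
    rw [h1, f.map_update_add, f.map_update_smul, h2, ih hk.2,
      f.map_eq_zero_of_eq (i := l) (j := k) _ (by simp [hw, hk.1]) (Ne.symm hk.1), smul_zero,
      zero_add]

/-- The matrix determinant lemma: an alternating map at a rank one perturbation. -/
theorem AlternatingMap.map_smul_add [Fintype ι] (f : M [⋀^ι]→ₗ[R] N) (v : ι → M) (a : ι → R)
    (θ : M) : f (fun i => a i • θ + v i) = f v + ∑ j, a j • f (update v j θ) := by
  have key : ∀ s : Finset ι, f (fun i => if i ∈ s then a i • θ + v i else v i) =
      f v + ∑ j ∈ s, a j • f (update v j θ) := by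
    intro s
    induction s using Finset.induction_on with
    | empty => simp
    | insert k s hk ih =>
      set w := fun i => if i ∈ s then a i • θ + v i else v i with hw
      have h1 : (fun i => if i ∈ insert k s then a i • θ + v i else v i) =
          update w k (a k • θ + v k) := by
        ext i
        by_cases hi : i = k
        · subst hi; simp
        · simp [hw, hi]
      have h2 : update w k (v k) = w := by
        rw [← show w k = v k by simp [hw, hk], update_eq_self]
      rw [h1, f.map_update_add, f.map_update_smul, h2, ih, f.map_update_of_add_smul v a θ k s hk,
        Finset.sum_insert hk]
      abel
  simpa using key Finset.univ

end alternating

/-! ### Determinants, cofactors and their divergence structure. -/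

/-- The determinant of `n` vectors of `ℝ^n`. -/
noncomputable def detForm (n : ℕ) : ContinuousMultilinearMap ℝ (fun _ : Fin n => Euc n) ℝ where
  toMultilinearMap := (EuclideanSpace.basisFun (Fin n) ℝ).toBasis.det.toMultilinearMap
  cont := by
    change Continuous fun v => (EuclideanSpace.basisFun (Fin n) ℝ).toBasis.det v
    simp only [Module.Basis.det_apply]
    refine Continuous.matrix_det (continuous_matrix fun i j => ?_)
    simp only [Module.Basis.toMatrix_apply, OrthonormalBasis.coe_toBasis_repr_apply,
      EuclideanSpace.basisFun_repr]
    fun_prop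

section det

open Function

variable {n : ℕ}

/-- The `i`-th standard basis vector of `ℝ^n`. -/
noncomputable abbrev stdVec {n : ℕ} (i : Fin n) : Euc n := EuclideanSpace.basisFun (Fin n) ℝ i

theorem norm_stdVec (i : Fin n) : ‖(stdVec i : Euc n)‖ = 1 := by simp

theorem detForm_eq (v : Fin n → Euc n) :
    detForm n v = (EuclideanSpace.basisFun (Fin n) ℝ).toBasis.det v := rfl

theorem linearMap_det_eq_detForm (L : Euc n →ₗ[ℝ] Euc n) :
    LinearMap.det L = detForm n fun i => L (stdVec i) := by
  have h := (EuclideanSpace.basisFun (Fin n) ℝ).toBasis.det_comp L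
    (EuclideanSpace.basisFun (Fin n) ℝ).toBasis
  rw [Module.Basis.det_self, mul_one] at h
  rw [← h, detForm_eq]
  rfl

/-- The linear part `⟨a, adj(A) θ⟩` of `a ↦ det (a ⊗ θ + A)`. -/
noncomputable def cofactorPairing (a : Euc n →L[ℝ] ℝ) (θ : Euc n) (A : Euc n →L[ℝ] Euc n) : ℝ :=
  ∑ j, a (stdVec j) * detForm n (update (fun i => A (stdVec i)) j θ)

theorem detForm_smul_add (a : Euc n →L[ℝ] ℝ) (θ : Euc n) (A : Euc n →L[ℝ] Euc n) :
    detForm n (fun i => a (stdVec i) • θ + A (stdVec i)) =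
      detForm n (fun i => A (stdVec i)) + cofactorPairing a θ A :=
  AlternatingMap.map_smul_add (EuclideanSpace.basisFun (Fin n) ℝ).toBasis.det _ _ _

theorem cofactorPairing_add (a b : Euc n →L[ℝ] ℝ) (θ : Euc n) (A : Euc n →L[ℝ] Euc n) :
    cofactorPairing (a + b) θ A = cofactorPairing a θ A + cofactorPairing b θ A := by
  simp only [cofactorPairing, add_apply, add_mul, Finset.sum_add_distrib]

theorem cofactorPairing_smul (c : ℝ) (a : Euc n →L[ℝ] ℝ) (θ : Euc n) (A : Euc n →L[ℝ] Euc n) :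
    cofactorPairing (c • a) θ A = c * cofactorPairing a θ A := by
  simp only [cofactorPairing, smul_apply, smul_eq_mul, mul_assoc, Finset.mul_sum]

theorem abs_detForm_le (A : Euc n →L[ℝ] Euc n) :
    |detForm n fun i => A (stdVec i)| ≤ ‖detForm n‖ * ‖A‖ ^ n := by
  refine ((detForm n).le_opNorm _).trans ?_
  gcongr
  calc ∏ i, ‖A (stdVec i)‖ ≤ ∏ _i : Fin n, ‖A‖ :=
        Finset.prod_le_prod (fun _ _ => norm_nonneg _) fun i _ =>
          (A.le_opNorm _).trans_eq (by rw [norm_stdVec, mul_one])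
    _ = ‖A‖ ^ n := by simp

/-- Each summand has one slot filled by `θ` and `n - 1` slots filled by `A`. The bound is linear in
`a`, so a Lipschitz bound on one factor can be paired with `|Dh| ^ (n - 1)`. -/
theorem abs_cofactorPairing_le (a : Euc n →L[ℝ] ℝ) {θ : Euc n} (A : Euc n →L[ℝ] Euc n)
    (hθ : ‖θ‖ ≤ 1) :
    |cofactorPairing a θ A| ≤ n * ‖detForm n‖ * (‖a‖ * ‖A‖ ^ (n - 1)) := by
  have h : ∀ j : Fin n, |a (stdVec j) * detForm n (update (fun i => A (stdVec i)) j θ)| ≤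
      ‖detForm n‖ * (‖a‖ * ‖A‖ ^ (n - 1)) := by
    intro j
    have h1 : |a (stdVec j)| ≤ ‖a‖ := (a.le_opNorm _).trans_eq (by rw [norm_stdVec, mul_one])
    have h2 : |detForm n (update (fun i => A (stdVec i)) j θ)| ≤ ‖detForm n‖ * ‖A‖ ^ (n - 1) := by
      refine ((detForm n).le_opNorm _).trans ?_
      gcongr
      rw [← Finset.mul_prod_erase _ _ (Finset.mem_univ j), update_self]
      calc ‖θ‖ * ∏ i ∈ Finset.univ.erase j, ‖update (fun i => A (stdVec i)) j θ i‖
          ≤ 1 * ∏ _i ∈ Finset.univ.erase j, ‖A‖ := by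
            gcongr with i hi
            rw [update_of_ne (Finset.ne_of_mem_erase hi)]
            exact (A.le_opNorm _).trans_eq (by rw [norm_stdVec, mul_one])
        _ = ‖A‖ ^ (n - 1) := by simp
    rw [abs_mul]
    calc _ ≤ ‖a‖ * (‖detForm n‖ * ‖A‖ ^ (n - 1)) := by gcongr
      _ = _ := by ring
  calc |cofactorPairing a θ A|
      ≤ ∑ j, |a (stdVec j) * detForm n (update (fun i => A (stdVec i)) j θ)| :=
        Finset.abs_sum_le_sum_abs _ _
    _ ≤ ∑ _j : Fin n, ‖detForm n‖ * (‖a‖ * ‖A‖ ^ (n - 1)) := Finset.sum_le_sum fun j _ => h j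
    _ = _ := by simp [mul_assoc]

@[fun_prop]
theorem continuous_update_stdVec (j : Fin n) :
    Continuous fun p : Euc n × (Euc n →L[ℝ] Euc n) =>
      (update (fun i => p.2 (stdVec i)) j p.1 : Fin n → Euc n) := by
  refine Continuous.update ?_ j continuous_fst
  exact continuous_pi fun i => continuous_snd.clm_apply continuous_const

theorem continuous_detForm_apply :
    Continuous fun A : Euc n →L[ℝ] Euc n => detForm n fun i => A (stdVec i) :=
  (detForm n).cont.comp (continuous_pi fun _ => continuous_id.clm_apply continuous_const)

theorem continuous_cofactorPairing :
    Continuous fun p : (Euc n →L[ℝ] ℝ) × Euc n × (Euc n →L[ℝ] Euc n) =>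
      cofactorPairing p.1 p.2.1 p.2.2 :=
  continuous_finsetSum _ fun j _ => (continuous_fst.clm_apply continuous_const).mul
    ((detForm n).cont.comp ((continuous_update_stdVec j).comp continuous_snd))

/-- The rows of the cofactor matrix of a smooth map are divergence free, tested against `φ g`. -/
theorem integral_cofactorPairing_add_eq_zero {φ : Euc n → ℝ} {g : Euc n → Euc n}
    (hφ : ContDiff ℝ 1 φ) (hc : HasCompactSupport φ) (hg : ContDiff ℝ 2 g) :
    ∫ x, (cofactorPairing (fderiv ℝ φ x) (g x) (fderiv ℝ g x) +
      n * φ x * detForm n fun i => fderiv ℝ g x (stdVec i)) = 0 := by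
  set V : Fin n → Euc n → Fin n → Euc n := fun j x =>
    update (fun i => fderiv ℝ g x (stdVec i)) j (g x) with hV
  have hg' : ContDiff ℝ 1 (fderiv ℝ g) := hg.fderiv_right (by norm_num)
  have hVd : ∀ j, ContDiff ℝ 1 (V j) := by
    intro j
    refine contDiff_pi.2 fun i => ?_
    by_cases hi : i = j
    · subst hi
      simpa [hV] using hg.of_le (by norm_num)
    · simp only [hV, update_of_ne hi]
      exact hg'.clm_apply contDiff_const
  have hF : ∀ j, ContDiff ℝ 1 fun x => detForm n (V j x) := fun j =>
    (detForm n).contDiff.comp (hVd j)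
  set H : Euc n → Fin n → Fin n → Euc n := fun x j i => fderiv ℝ (fderiv ℝ g) x (stdVec j) (stdVec i)
    with hH
  have hsymm : ∀ x i j, H x i j = H x j i := fun x i j =>
    (hg.contDiffAt.isSymmSndFDerivAt (by simp)) _ _
  -- Differentiating slot `j` replaces `g` by `∂_j g` and restores `det Dg`; the other slots give
  -- second derivatives.
  have hder : ∀ j x, fderiv ℝ (fun x => detForm n (V j x)) x (stdVec j) =
      detForm n (fun i => fderiv ℝ g x (stdVec i)) +
        ∑ i, if i = j then 0 else detForm n (update (V j x) i (H x j i)) := by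
    intro j x
    have h1 : HasFDerivAt (V j) (fderiv ℝ (V j) x) x :=
      ((hVd j).differentiable one_ne_zero x).hasFDerivAt
    have h2 := ((detForm n).hasFDerivAt (V j x)).comp x h1
    have h3 : ∀ i, fderiv ℝ (V j) x (stdVec j) i =
        if i = j then fderiv ℝ g x (stdVec j) else H x j i := by
      intro i
      have h4 : fderiv ℝ (V j) x (stdVec j) i = fderiv ℝ (fun x => V j x i) x (stdVec j) := by
        rw [((hasFDerivAt_pi'.1 h1) i).fderiv]
        rfl
      rw [h4]
      split_ifs with hi
      · subst hi
        simp [hV]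
      · simp only [hV, update_of_ne hi, hH]
        have h5 : HasFDerivAt (fun x => fderiv ℝ g x (stdVec i))
            ((ContinuousLinearMap.apply ℝ (Euc n) (stdVec i)).comp (fderiv ℝ (fderiv ℝ g) x)) x :=
          (ContinuousLinearMap.apply ℝ (Euc n) (stdVec i)).hasFDerivAt.comp x
            (hg'.differentiable one_ne_zero x).hasFDerivAt
        rw [h5.fderiv]
        rfl
    have h6 : fderiv ℝ (fun x => detForm n (V j x)) x (stdVec j) =
        ∑ i, detForm n (update (V j x) i (fderiv ℝ (V j) x (stdVec j) i)) := by
      have : fderiv ℝ (fun x => detForm n (V j x)) x = _ := h2.fderiv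
      rw [this, ContinuousLinearMap.comp_apply, ContinuousMultilinearMap.linearDeriv_apply]
    rw [h6, ← Finset.add_sum_erase _ _ (Finset.mem_univ j),
      ← Finset.add_sum_erase (f := fun i => if i = j then 0 else _) _ (Finset.mem_univ j)]
    simp only [if_true, zero_add]
    congr 1
    · rw [h3, if_pos rfl]
      simp [hV]
    · refine Finset.sum_congr rfl fun i hi => ?_
      rw [h3, if_neg (Finset.ne_of_mem_erase hi), if_neg (Finset.ne_of_mem_erase hi)]
  -- Exchanging columns `i` and `j` maps the term indexed by `(j, i)` to minus the one indexed by
  -- `(i, j)`, by symmetry of second derivatives; the double sum equals its own negative.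
  have hanti : ∀ x, ∑ j, ∑ i, (if i = j then 0 else detForm n (update (V j x) i (H x j i))) = 0 := by
    intro x
    have hswap : ∀ i j, i ≠ j → detForm n (update (V i x) j (H x i j)) =
        -detForm n (update (V j x) i (H x j i)) := by
      intro i j hij
      rw [detForm_eq, detForm_eq, ← AlternatingMap.map_swap _ _ hij]
      congr 1
      ext m : 1
      by_cases hmi : m = i
      · subst hmi
        simp [hV, hij, Ne.symm hij]
      · by_cases hmj : m = j
        · subst hmj
          simp [hsymm x m i]
        · simp [hV, Equiv.swap_apply_of_ne_of_ne hmi hmj, hmi, hmj]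
    have h1 : ∑ j, ∑ i, (if i = j then 0 else detForm n (update (V j x) i (H x j i))) =
        -∑ j, ∑ i, (if i = j then 0 else detForm n (update (V j x) i (H x j i))) := by
      conv_lhs => rw [Finset.sum_comm]
      rw [← Finset.sum_neg_distrib]
      refine Finset.sum_congr rfl fun i _ => ?_
      rw [← Finset.sum_neg_distrib]
      refine Finset.sum_congr rfl fun j _ => ?_
      by_cases hij : i = j
      · simp [hij]
      · rw [if_neg hij, if_neg (Ne.symm hij), hswap j i (Ne.symm hij)]
    linarith
  have hpoint : ∀ x, cofactorPairing (fderiv ℝ φ x) (g x) (fderiv ℝ g x) +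
      n * φ x * detForm n (fun i => fderiv ℝ g x (stdVec i)) =
      ∑ j, (fderiv ℝ φ x (stdVec j) * detForm n (V j x) +
        φ x * fderiv ℝ (fun x => detForm n (V j x)) x (stdVec j)) := by
    intro x
    rw [Finset.sum_add_distrib, ← Finset.mul_sum]
    simp only [hder, Finset.sum_add_distrib, hanti]
    simp only [cofactorPairing, Finset.sum_const, Finset.card_univ, Fintype.card_fin, hV]
    ring
  simp only [hpoint]
  have hc' : ∀ v, HasCompactSupport fun x => fderiv ℝ φ x v := fun v =>
    (hc.fderiv ℝ).comp_left (g := fun L : Euc n →L[ℝ] ℝ => L v) rfl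
  have hφ' : ∀ v, Continuous fun x => fderiv ℝ φ x v := fun v =>
    (hφ.continuous_fderiv one_ne_zero).clm_apply continuous_const
  have hi1 : ∀ j, Integrable fun x => fderiv ℝ φ x (stdVec j) * detForm n (V j x) := fun j =>
    ((hφ' _).mul (hF j).continuous).integrable_of_hasCompactSupport (hc' _).mul_right
  have hi2 : ∀ j, Integrable fun x =>
      φ x * fderiv ℝ (fun x => detForm n (V j x)) x (stdVec j) := fun j =>
    (hφ.continuous.mul (((hF j).continuous_fderiv one_ne_zero).clm_apply
      continuous_const)).integrable_of_hasCompactSupport hc.mul_right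
  refine (integral_finsetSum _ fun j _ => (hi1 j).add (hi2 j)).trans ?_
  refine Finset.sum_eq_zero fun j _ => ?_
  refine (integral_add (hi1 j) (hi2 j)).trans ?_
  rw [integral_fderiv_mul_eq_neg hφ hc (hF j), neg_add_cancel]

end det

/-! ### Tangential weak derivatives and the cutoff identity. -/

section divergence

variable {n : ℕ}

/-- From `t ≤ 1 + t ^ n`; it turns global `L^n` bounds on maximal functions into the local
integrability assumed above. -/
theorem setLIntegral_ball_ne_top_of_pow (hn : n ≠ 0) {w : Euc n → ℝ≥0∞}
    (h : ∫⁻ x, w x ^ n ≠ ⊤) (x : Euc n) (r : ℝ) : ∫⁻ y in ball x r, w y ≠ ⊤ := by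
  have h1 : ∀ t : ℝ≥0∞, t ≤ 1 + t ^ n := by
    intro t
    rcases le_total t 1 with ht | ht
    · exact ht.trans le_self_add
    · exact (le_self_pow ht hn).trans le_add_self
  refine ne_top_of_le_ne_top ?_ (lintegral_mono fun y => h1 (w y))
  rw [lintegral_add_left measurable_const, setLIntegral_one]
  exact ENNReal.add_ne_top.2 ⟨volume_ball_euc_ne_top x,
    ne_top_of_le_ne_top h (setLIntegral_le_lintegral _ _)⟩

theorem mul_pow_pred_le {R : Type*} [CommSemiring R] [LinearOrder R] [IsOrderedRing R]
    [CanonicallyOrderedAdd R] (hn : n ≠ 0) (a b : R) : a * b ^ (n - 1) ≤ a ^ n + b ^ n := by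
  rcases le_total a b with h | h
  · calc a * b ^ (n - 1) ≤ b * b ^ (n - 1) := by gcongr
      _ = b ^ n := mul_pow_sub_one hn b
      _ ≤ _ := le_add_self
  · calc a * b ^ (n - 1) ≤ a * a ^ (n - 1) := by gcongr
      _ = a ^ n := mul_pow_sub_one hn a
      _ ≤ _ := le_self_add

variable {g : Euc n → Euc n} {G : Euc n → Euc n →L[ℝ] Euc n}

theorem aestronglyMeasurable_innerSL_comp (hg : Continuous g) (hG : AEStronglyMeasurable G) :
    AEStronglyMeasurable fun x => (innerSL ℝ (g x)).comp (G x) := by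
  have h1 : AEStronglyMeasurable fun x => innerSL ℝ (g x) :=
    ((innerSL ℝ).continuous.comp hg).aestronglyMeasurable
  exact (ContinuousLinearMap.compL ℝ (Euc n) (Euc n) ℝ).aestronglyMeasurable_comp₂ h1 hG

/-- The weak derivative of a sphere-valued map is tangential. -/
theorem IsWeakDerivative.ae_inner_eq_zero (h : IsWeakDerivative g G) (hg : Continuous g)
    (hg1 : ∀ x, ‖g x‖ = 1)
    (hM : ∀ x r, ∫⁻ y in ball x r, ballMaximal (fun y => ‖G y‖ₑ) y ≠ ⊤) :
    ∀ᵐ x, ∀ v, inner ℝ (g x) (G x v) = 0 := by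
  set M := ballMaximal fun y => ‖G y‖ₑ
  set W : Euc n → Euc n →L[ℝ] ℝ := fun x => (innerSL ℝ (g x)).comp (G x) with hW
  have hWm : AEStronglyMeasurable W :=
    aestronglyMeasurable_innerSL_comp hg h.locallyIntegrable_deriv.aestronglyMeasurable
  have hWi : LocallyIntegrable W := h.locallyIntegrable_deriv.mono hWm
    (Eventually.of_forall fun x => (opNorm_comp_le _ _).trans_eq (by
      rw [innerSL_apply_norm, hg1, one_mul]))
  have hfin : ∀ᵐ x, M x < ⊤ := ae_lt_top_of_setLIntegral_ball (measurable_ballMaximal _) hM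
  have hcg : ∀ k, ContDiff ℝ ∞ (mollify k g) := fun k => contDiff_mollify k h.locallyIntegrable
  have hbd : ∀ k x, ‖mollify k g x‖ ≤ 1 := fun k x => norm_mollify_le (fun x => (hg1 x).le) k x
  have hzero : ∀ᵐ x, W x = 0 := by
    refine ae_eq_zero_of_integral_contDiff_smul_eq_zero hWi fun φ hφ hc => ?_
    have hi : Integrable fun x => φ x • W x :=
      hWi.integrable_smul_left_of_hasCompactSupport hφ.continuous hc
    ext v
    rw [ContinuousLinearMap.integral_apply hi, zero_apply]
    simp only [smul_apply, smul_eq_mul, hW, ContinuousLinearMap.comp_apply, innerSL_apply_apply]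
    have hc' : HasCompactSupport fun x => fderiv ℝ φ x v :=
      (hc.fderiv ℝ).comp_left (g := fun L : Euc n →L[ℝ] ℝ => L v) rfl
    have hφ' : Continuous fun x => fderiv ℝ φ x v :=
      (hφ.continuous_fderiv (by norm_num)).clm_apply continuous_const
    -- Integration by parts for `|g_k|^2`. In the limit `|g|^2 = 1`, so the left side vanishes and
    -- the right side becomes a multiple of the pairing `⟨g, G v⟩`.
    have heq : ∀ k, ∫ x, fderiv ℝ φ x v * ‖mollify k g x‖ ^ 2 =
        -∫ x, φ x * (2 * inner ℝ (mollify k g x) (mollify k G x v)) := by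
      intro k
      refine (integral_fderiv_mul_eq_neg (hφ.of_le (by norm_num)) hc
        (((hcg k).of_le (by norm_num)).norm_sq ℝ) v).trans ?_
      congr 1
      refine integral_congr_ae (Eventually.of_forall fun x => ?_)
      have h1 := (((hcg k).differentiable (by norm_num)) x).hasFDerivAt.norm_sq
      have h2 := fderiv_mollify h k x
      simp only [h1.fderiv, h2]
      simp [two_mul]
    have hL : Tendsto (fun k => ∫ x, fderiv ℝ φ x v * ‖mollify k g x‖ ^ 2) atTop
        (𝓝 (∫ x, fderiv ℝ φ x v * 1)) := by
      refine tendsto_integral_of_dominated_convergence (fun x => |fderiv ℝ φ x v|) (fun k => ?_)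
        (hφ'.abs.integrable_of_hasCompactSupport hc'.abs)
        (fun k => Eventually.of_forall fun x => ?_) (Eventually.of_forall fun x => ?_)
      · exact (hφ'.mul ((hcg k).continuous.norm.pow 2)).aestronglyMeasurable
      · rw [norm_mul, Real.norm_eq_abs, norm_pow, norm_norm]
        exact mul_le_of_le_one_right (abs_nonneg _) (pow_le_one₀ (norm_nonneg _) (hbd k x))
      · have := ((tendsto_mollify_of_continuous hg x).norm.pow 2).const_mul (fderiv ℝ φ x v)
        rwa [hg1, one_pow] at this
    have h0 : ∫ x, fderiv ℝ φ x v * 1 = 0 := by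
      rw [integral_fderiv_mul_eq_neg (hφ.of_le (by norm_num)) hc contDiff_const v]
      simp
    have hR : Tendsto (fun k => ∫ x, φ x * (2 * inner ℝ (mollify k g x) (mollify k G x v))) atTop
        (𝓝 (∫ x, φ x * (2 * inner ℝ (g x) (G x v)))) := by
      refine tendsto_integral_of_dominated_convergence
        (fun x => (|φ x| * (2 * 2 ^ n * ‖v‖)) • (M x).toReal) (fun k => ?_) ?_ (fun k => ?_) ?_
      · exact (hφ.continuous.mul (continuous_const.mul ((hcg k).continuous.inner
          ((contDiff_mollify k h.locallyIntegrable_deriv).continuous.clm_apply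
            continuous_const)))).aestronglyMeasurable
      · exact (locallyIntegrable_toReal (measurable_ballMaximal _)
          hM).integrable_smul_left_of_hasCompactSupport (hφ.continuous.abs.mul continuous_const)
            hc.abs.mul_right
      · filter_upwards [hfin] with x hx
        rw [norm_mul, norm_mul, Real.norm_eq_abs, smul_eq_mul, Real.norm_ofNat]
        calc |φ x| * (2 * ‖inner ℝ (mollify k g x) (mollify k G x v)‖)
            ≤ |φ x| * (2 * (1 * ((2 ^ n * (M x).toReal) * ‖v‖))) := by
              gcongr
              refine (norm_inner_le_norm _ _).trans ?_
              gcongr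
              · exact hbd k x
              · exact (le_opNorm _ _).trans (by gcongr; exact norm_mollify_le_toReal G k hx)
          _ = _ := by ring
      · filter_upwards [ae_tendsto_mollify h.locallyIntegrable_deriv] with x hx
        refine Tendsto.const_mul _ (Tendsto.const_mul _ ?_)
        exact (tendsto_mollify_of_continuous hg x).inner
          (((ContinuousLinearMap.apply ℝ (Euc n) v).continuous.tendsto _).comp hx)
    have h1 := tendsto_nhds_unique hL (by simp only [heq]; exact hR.neg)
    rw [h0] at h1
    have h2 : ∫ x, φ x * (2 * inner ℝ (g x) (G x v)) = 2 * ∫ x, φ x * inner ℝ (g x) (G x v) := by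
      rw [← integral_const_mul]
      exact integral_congr_ae (Eventually.of_forall fun x => by ring)
    linarith
  filter_upwards [hzero] with x hx v
  exact DFunLike.congr_fun hx v

/-- The range of `A` lies in the orthogonal complement of `θ`, so `A` is not surjective. -/
theorem detForm_eq_zero_of_inner_eq_zero {θ : Euc n} (hθ : ‖θ‖ = 1) {A : Euc n →L[ℝ] Euc n}
    (h : ∀ v, inner ℝ θ (A v) = 0) : detForm n (fun i => A (stdVec i)) = 0 := by
  by_contra hne
  have hdet : LinearMap.det (A : Euc n →ₗ[ℝ] Euc n) ≠ 0 := by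
    rw [linearMap_det_eq_detForm]
    exact hne
  obtain ⟨v, hv⟩ := (LinearMap.equivOfDetNeZero (A : Euc n →ₗ[ℝ] Euc n) hdet).surjective θ
  have h1 := h v
  rw [show A v = θ from hv, real_inner_self_eq_norm_sq, hθ] at h1
  norm_num at h1

theorem Filter.Tendsto.cofactorPairing {ι : Type*} {l : Filter ι} {a : ι → Euc n →L[ℝ] ℝ}
    {θ : ι → Euc n} {A : ι → Euc n →L[ℝ] Euc n} {a₀ : Euc n →L[ℝ] ℝ} {θ₀ : Euc n}
    {A₀ : Euc n →L[ℝ] Euc n} (ha : Tendsto a l (𝓝 a₀)) (hθ : Tendsto θ l (𝓝 θ₀))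
    (hA : Tendsto A l (𝓝 A₀)) :
    Tendsto (fun i => _root_.cofactorPairing (a i) (θ i) (A i)) l
      (𝓝 (_root_.cofactorPairing a₀ θ₀ A₀)) := by
  refine tendsto_finsetSum _ fun j _ => Tendsto.mul
    (((ContinuousLinearMap.apply ℝ ℝ (stdVec j)).continuous.tendsto _).comp ha) ?_
  refine ((detForm n).cont.tendsto _).comp (tendsto_pi_nhds.2 fun i => ?_)
  by_cases hi : i = j
  · subst hi
    simpa using hθ
  · simpa [hi, Function.comp_def] using
      ((ContinuousLinearMap.apply ℝ (Euc n) (stdVec i)).continuous.tendsto _).comp hA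

set_option maxHeartbeats 1000000 in
-- The smooth identity is applied to the mollified `g` with test function `χ * (η_k - c)`, where
-- `η_k` is the mollified `η`. In the limit its determinant term disappears because `det G = 0`.
-- That term has degree `n` in the derivative, which is why the maximal function is required to lie
-- in `L^n`.
theorem integral_cofactorPairing_cutoff_eq_zero (hn : n ≠ 0) (h : IsWeakDerivative g G)
    (hg : Continuous g) (hg1 : ∀ x, ‖g x‖ = 1)
    (hM : ∫⁻ y, ballMaximal (fun y => ‖G y‖ₑ) y ^ n ≠ ⊤) {η : Euc n → ℝ} {C : ℝ≥0}
    (hη : LipschitzWith C η) {χ : Euc n → ℝ} (hχ : ContDiff ℝ ∞ χ) (hc : HasCompactSupport χ)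
    (c : ℝ) :
    ∫ x, cofactorPairing ((η x - c) • fderiv ℝ χ x + χ x • fderiv ℝ η x) (g x) (G x) = 0 := by
  set M := ballMaximal fun y => ‖G y‖ₑ with hMdef
  have hM1 := setLIntegral_ball_ne_top_of_pow hn hM
  have hfin : ∀ᵐ x, M x < ⊤ := ae_lt_top_of_setLIntegral_ball (measurable_ballMaximal _) hM1
  have hdet : ∀ᵐ x, detForm n (fun i => G x (stdVec i)) = 0 := by
    filter_upwards [h.ae_inner_eq_zero hg hg1 hM1] with x hx
    exact detForm_eq_zero_of_inner_eq_zero (hg1 x) hx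
  have hηw := hη.isWeakDerivative
  have hcg : ∀ k, ContDiff ℝ ∞ (mollify k g) := fun k => contDiff_mollify k h.locallyIntegrable
  have hcη : ∀ k, ContDiff ℝ ∞ (mollify k η) := fun k => contDiff_mollify k hηw.locallyIntegrable
  have hbd : ∀ k x, ‖mollify k g x‖ ≤ 1 := fun k x => norm_mollify_le (fun x => (hg1 x).le) k x
  have hbη : ∀ k x, |mollify k η x - c| ≤ |η x| + C + |c| := by
    intro k x
    have h1 := dist_mollify_le_of_lipschitz hη k x
    rw [Real.dist_eq] at h1
    calc |mollify k η x - c| = |(mollify k η x - η x) + (η x - c)| := by congr 1; ring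
      _ ≤ |mollify k η x - η x| + |η x - c| := abs_add_le _ _
      _ ≤ C + (|η x| + |c|) := add_le_add h1 (abs_sub _ _)
      _ = _ := by ring
  have hbη' : ∀ k x, ‖mollify k (fderiv ℝ η) x‖ ≤ C := fun k x =>
    norm_mollify_le (fun x => norm_fderiv_le_of_lipschitz ℝ hη) k x
  have hχ' : Continuous (fderiv ℝ χ) := hχ.continuous_fderiv (by norm_num)
  have hder : ∀ k x, fderiv ℝ (fun x => χ x * (mollify k η x - c)) x =
      (mollify k η x - c) • fderiv ℝ χ x + χ x • mollify k (fderiv ℝ η) x := by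
    intro k x
    have h1 := (hχ.differentiable (by norm_num) x).hasFDerivAt
    have h2 := (((hcη k).differentiable (by norm_num) x).hasFDerivAt).sub_const c
    rw [fderiv_mollify hηw] at h2
    have h3 : fderiv ℝ (fun x => χ x * (mollify k η x - c)) x = _ := (h1.mul h2).fderiv
    rw [h3, add_comm]
  set d := ‖detForm n‖
  set L : Euc n → ℝ := fun x => |η x| + C + |c| with hLdef
  have hLc : Continuous L := (hη.continuous.abs.add continuous_const).add continuous_const
  have hL0 : ∀ x, 0 ≤ L x := fun x => by positivity
  set E : Euc n → ℝ := fun x => ‖fderiv ℝ χ x‖ * L x + |χ x| * C with hE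
  have hkey : ∀ k, ∫ x, (cofactorPairing
      ((mollify k η x - c) • fderiv ℝ χ x + χ x • mollify k (fderiv ℝ η) x) (mollify k g x)
        (mollify k G x) + n * (χ x * (mollify k η x - c)) *
          detForm n fun i => mollify k G x (stdVec i)) = 0 := by
    intro k
    have h1 := integral_cofactorPairing_add_eq_zero (φ := fun x => χ x * (mollify k η x - c))
      (g := mollify k g) ((hχ.mul ((hcη k).sub contDiff_const)).of_le (by norm_num)) hc.mul_right
      ((hcg k).of_le (by norm_cast))
    simpa only [hder, fderiv_mollify h] using h1
  have hlim : Tendsto (fun k => ∫ x, (cofactorPairing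
      ((mollify k η x - c) • fderiv ℝ χ x + χ x • mollify k (fderiv ℝ η) x) (mollify k g x)
        (mollify k G x) + n * (χ x * (mollify k η x - c)) *
          detForm n fun i => mollify k G x (stdVec i))) atTop
      (𝓝 (∫ x, (cofactorPairing ((η x - c) • fderiv ℝ χ x + χ x • fderiv ℝ η x) (g x) (G x) +
        n * (χ x * (η x - c)) * 0))) := by
    refine tendsto_integral_of_dominated_convergence
      (fun x => (n * d * E x + n * (|χ x| * L x) * d) • (1 + (2 ^ n * (M x).toReal) ^ n))
      (fun k => ?_) ?_ (fun k => ?_) ?_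
    · have hk := (contDiff_mollify k h.locallyIntegrable_deriv).continuous
      have hk2 := (contDiff_mollify k hηw.locallyIntegrable_deriv).continuous
      have hk3 := (hcη k).continuous
      refine Continuous.aestronglyMeasurable (Continuous.add ?_ (Continuous.mul ?_ ?_))
      · exact continuous_cofactorPairing.comp
          ((((hk3.sub continuous_const).smul hχ').add (hχ.continuous.smul hk2)).prodMk
            ((hcg k).continuous.prodMk hk))
      · exact continuous_const.mul (hχ.continuous.mul (hk3.sub continuous_const))
      · exact continuous_detForm_apply.comp hk
    · have hint : Integrable fun x => (M x ^ n).toReal :=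
        integrable_toReal_of_lintegral_ne_top ((measurable_ballMaximal _).pow_const n).aemeasurable hM
      have hloc : LocallyIntegrable fun x => 1 + (2 ^ n * (M x).toReal) ^ n := by
        refine (locallyIntegrable_const 1).add ?_
        have := (hint.const_mul ((2 ^ n) ^ n)).locallyIntegrable
        simpa only [ENNReal.toReal_pow, ← mul_pow] using this
      refine hloc.integrable_smul_left_of_hasCompactSupport ?_ ?_
      · exact (continuous_const.mul ((hχ'.norm.mul hLc).add (hχ.continuous.abs.mul
          continuous_const))).add ((continuous_const.mul (hχ.continuous.abs.mul hLc)).mul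
            continuous_const)
      · refine HasCompactSupport.add ?_ ?_
        · exact HasCompactSupport.mul_left (((hc.fderiv ℝ).norm.mul_right).add hc.abs.mul_right)
        · exact HasCompactSupport.mul_right (HasCompactSupport.mul_left hc.abs.mul_right)
    · filter_upwards [hfin] with x hx
      set q := 2 ^ n * (M x).toReal with hq
      have hq0 : 0 ≤ q := by positivity
      have hGq : ‖mollify k G x‖ ≤ q := norm_mollify_le_toReal G k hx
      have hq1 : q ^ (n - 1) ≤ 1 + q ^ n := by
        rcases le_total q 1 with hle | hle
        · exact (pow_le_one₀ hq0 hle).trans (le_add_of_nonneg_right (by positivity))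
        · exact (pow_le_pow_right₀ hle (Nat.sub_le n 1)).trans
            (le_add_of_nonneg_left zero_le_one)
      have hEb : ‖(mollify k η x - c) • fderiv ℝ χ x + χ x • mollify k (fderiv ℝ η) x‖ ≤ E x := by
        refine (norm_add_le _ _).trans ?_
        rw [norm_smul, norm_smul, mul_comm, Real.norm_eq_abs, Real.norm_eq_abs]
        exact add_le_add (mul_le_mul_of_nonneg_left (hbη k x) (norm_nonneg _))
          (mul_le_mul_of_nonneg_left (hbη' k x) (abs_nonneg _))
      have hE0 : 0 ≤ E x := (norm_nonneg _).trans hEb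
      rw [smul_eq_mul, add_mul]
      refine (norm_add_le _ _).trans (add_le_add ?_ ?_)
      · rw [Real.norm_eq_abs]
        refine (abs_cofactorPairing_le _ _ (hbd k x)).trans ?_
        rw [mul_assoc ((n : ℝ) * d)]
        gcongr ?_ * (?_ * ?_)
        exact (pow_le_pow_left₀ (norm_nonneg _) hGq _).trans hq1
      · rw [norm_mul, norm_mul, norm_mul, mul_assoc]
        simp only [Real.norm_eq_abs, Nat.abs_cast]
        rw [← mul_assoc, mul_assoc _ d]
        gcongr
        · exact hbη k x
        · refine (abs_detForm_le _).trans ?_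
          gcongr
          exact (pow_le_pow_left₀ (norm_nonneg _) hGq _).trans (le_add_of_nonneg_left zero_le_one)
    · filter_upwards [ae_tendsto_mollify h.locallyIntegrable_deriv,
        ae_tendsto_mollify hηw.locallyIntegrable_deriv, hdet] with x hx hx2 hx3
      have hx4 := tendsto_mollify_of_continuous hη.continuous x
      have hx5 := tendsto_mollify_of_continuous hg x
      refine Tendsto.add ?_ (Tendsto.mul ?_ ?_)
      · exact (((hx4.sub_const c).smul_const _).add (hx2.const_smul _)).cofactorPairing hx5 hx
      · exact ((hx4.sub_const c).const_mul _).const_mul _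
      · rw [← hx3]
        exact (continuous_detForm_apply.tendsto _).comp hx
  simp only [hkey, mul_zero, add_zero] at hlim
  exact (tendsto_nhds_unique hlim tendsto_const_nhds)

end divergence

/-! ### Vanishing of the global integral. -/

section vanishing

variable {n : ℕ}

theorem exists_lintegral_ballMaximal_pow_le (hn : 2 ≤ n) :
    ∃ C : ℝ≥0, ∀ u : Euc n → ℝ≥0∞, AEMeasurable u →
      ∫⁻ x, ballMaximal u x ^ n ≤ C * ∫⁻ x, u x ^ n := by
  refine ⟨2 ^ (2 * (n - 1) + 3) * 4 ^ n, fun u hu => ?_⟩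
  have h := lintegral_ballMaximal_pow_le (by omega) (show n - 1 ≠ 0 by omega) hu
  rw [show n - 1 + 1 = n by omega] at h
  exact_mod_cast h

theorem lintegral_ballMaximal_pow_ne_top (hn : 2 ≤ n) {u : Euc n → ℝ≥0∞} (hu : AEMeasurable u)
    (h : ∫⁻ x, u x ^ n ≠ ⊤) : ∫⁻ x, ballMaximal u x ^ n ≠ ⊤ := by
  obtain ⟨C, hC⟩ := exists_lintegral_ballMaximal_pow_le hn
  exact ne_top_of_le_ne_top (ENNReal.mul_ne_top ENNReal.coe_ne_top h) (hC u hu)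

theorem ENNReal.add_pow_le_two_pow_mul (a b : ℝ≥0∞) (m : ℕ) :
    (a + b) ^ m ≤ 2 ^ m * (a ^ m + b ^ m) := by
  have hmax : (max a b) ^ m ≤ a ^ m + b ^ m := by
    rcases le_total a b with h | h
    · rw [max_eq_right h]; exact le_add_self
    · rw [max_eq_left h]; exact le_self_add
  calc (a + b) ^ m ≤ (2 * max a b) ^ m := by
        rw [two_mul]
        gcongr
        · exact le_max_left _ _
        · exact le_max_right _ _
    _ = 2 ^ m * (max a b) ^ m := mul_pow _ _ _
    _ ≤ _ := by gcongr

theorem exists_cutoff (n : ℕ) : ∃ B : ℝ≥0, ∀ R : ℝ, 0 < R → ∃ χ : Euc n → ℝ,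
    ContDiff ℝ ∞ χ ∧ HasCompactSupport χ ∧ (∀ x, |χ x| ≤ 1) ∧ (∀ x, ‖x‖ < R → χ x = 1) ∧
      (∀ x, ‖fderiv ℝ χ x‖ ≤ B / R) ∧
      ∀ x, x ∉ closedBall (0 : Euc n) (2 * R) \ ball 0 R → fderiv ℝ χ x = 0 := by
  let b : ContDiffBump (0 : Euc n) := ⟨1, 2, one_pos, one_lt_two⟩
  have hb : ContDiff ℝ ∞ b := b.contDiff
  obtain ⟨B, hB⟩ := (b.hasCompactSupport.fderiv ℝ).exists_bound_of_continuous
    (hb.continuous_fderiv (by norm_num))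
  have hB0 : 0 ≤ B := (norm_nonneg _).trans (hB 0)
  refine ⟨⟨B, hB0⟩, fun R hR => ⟨fun x => b (R⁻¹ • x), ?_, ?_, ?_, ?_, ?_, ?_⟩⟩
  · exact hb.comp (contDiff_id.const_smul R⁻¹)
  · exact b.hasCompactSupport.comp_smul (inv_ne_zero hR.ne')
  · intro x
    rw [abs_of_nonneg b.nonneg]
    exact b.le_one
  · intro x hx
    refine b.one_of_mem_closedBall ?_
    rw [mem_closedBall_zero_iff, norm_smul, norm_inv, Real.norm_of_nonneg hR.le]
    change R⁻¹ * ‖x‖ ≤ 1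
    rw [inv_mul_le_one₀ hR]
    exact hx.le
  · intro x
    have h2 : HasFDerivAt (fun x : Euc n => R⁻¹ • x) (R⁻¹ • ContinuousLinearMap.id ℝ (Euc n)) x :=
      (hasFDerivAt_id x).const_smul R⁻¹
    have h1 : HasFDerivAt (fun x => b (R⁻¹ • x)) _ x :=
      ((hb.differentiable (by norm_num)) (R⁻¹ • x)).hasFDerivAt.comp x h2
    rw [h1.fderiv, comp_smul, norm_smul, norm_inv, Real.norm_of_nonneg hR.le, comp_id,
      div_eq_inv_mul]
    gcongr
    exact hB _
  · intro x hx
    by_cases hxR : ‖x‖ < R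
    · have : (fun x => b (R⁻¹ • x)) =ᶠ[𝓝 x] fun _ => (1 : ℝ) := by
        filter_upwards [isOpen_ball.mem_nhds (mem_ball_zero_iff.2 hxR)] with y hy
        refine b.one_of_mem_closedBall ?_
        rw [mem_closedBall_zero_iff, norm_smul, norm_inv, Real.norm_of_nonneg hR.le]
        change R⁻¹ * ‖y‖ ≤ 1
        rw [inv_mul_le_one₀ hR]
        exact (mem_ball_zero_iff.1 hy).le
      rw [this.fderiv_eq, fderiv_const_apply]
    · have hx2 : x ∈ (closedBall (0 : Euc n) (2 * R))ᶜ := fun h =>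
        hx ⟨h, by rwa [mem_ball_zero_iff]⟩
      have : (fun x => b (R⁻¹ • x)) =ᶠ[𝓝 x] fun _ => (0 : ℝ) := by
        filter_upwards [isClosed_closedBall.isOpen_compl.mem_nhds hx2] with y hy
        refine b.zero_of_le_dist ?_
        rw [mem_compl_iff, mem_closedBall_zero_iff, not_le] at hy
        rw [dist_zero_right, norm_smul, norm_inv, Real.norm_of_nonneg hR.le]
        change 2 ≤ R⁻¹ * ‖y‖
        rw [le_inv_mul_iff₀ hR]
        linarith
      rw [this.fderiv_eq, fderiv_const_apply]

/-- Some point carries a value not above the mean. It supplies the constant subtracted from `η` in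
the cutoff argument. -/
theorem exists_mem_annulus_mul_le (hn : n ≠ 0) {w : Euc n → ℝ≥0∞} (hw : Measurable w) {R : ℝ}
    (hR : 0 < R) : ∃ y ∈ closedBall (0 : Euc n) (2 * R) \ ball 0 R,
      w y * volume (closedBall (0 : Euc n) (2 * R) \ ball 0 R) ≤
        ∫⁻ x in closedBall (0 : Euc n) (2 * R) \ ball 0 R, w x := by
  set s := closedBall (0 : Euc n) (2 * R) \ ball 0 R
  have hsT : volume s ≠ ⊤ := ne_top_of_le_ne_top measure_closedBall_lt_top.ne
    (measure_mono sdiff_subset)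
  have hs0 : volume s ≠ 0 := by
    have : Nonempty (Fin n) := ⟨⟨0, by omega⟩⟩
    have hne : (ball (0 : Euc n) (2 * R) \ closedBall 0 R).Nonempty := by
      refine ⟨(3 / 2 * R) • stdVec (Classical.arbitrary (Fin n)), ?_, ?_⟩
      · rw [mem_ball_zero_iff, norm_smul, norm_stdVec, mul_one, Real.norm_of_nonneg (by positivity)]
        linarith
      · rw [mem_closedBall_zero_iff, norm_smul, norm_stdVec, mul_one,
          Real.norm_of_nonneg (by positivity)]
        linarith
    have hpos := (isOpen_ball.sdiff isClosed_closedBall).measure_pos volume hne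
    exact (hpos.trans_le (measure_mono
      (sdiff_subset_sdiff ball_subset_closedBall ball_subset_closedBall))).ne'
  obtain ⟨y, hy, h⟩ := exists_le_setLAverage hs0 hsT hw.aemeasurable
  refine ⟨y, hy, ?_⟩
  rw [setLAverage_eq] at h
  exact (ENNReal.le_div_iff_mul_le (Or.inl hs0) (Or.inl hsT)).1 h

theorem tendsto_setLIntegral_compl_ball {w : Euc n → ℝ≥0∞} (hw : Measurable w)
    (h : ∫⁻ x, w x ≠ ⊤) :
    Tendsto (fun j : ℕ => ∫⁻ x in (ball (0 : Euc n) ((j : ℝ) + 1))ᶜ, w x) atTop (𝓝 0) := by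
  have h1 : ∀ j : ℕ, ∫⁻ x in (ball (0 : Euc n) ((j : ℝ) + 1))ᶜ, w x =
      ∫⁻ x, (ball (0 : Euc n) ((j : ℝ) + 1))ᶜ.indicator w x := fun j =>
    (lintegral_indicator measurableSet_ball.compl _).symm
  simp only [h1]
  rw [← lintegral_zero (α := Euc n) (μ := volume)]
  refine tendsto_lintegral_of_dominated_convergence w
    (fun j => hw.indicator measurableSet_ball.compl)
    (fun j => Eventually.of_forall fun x => indicator_le_self _ _ x) h
    (Eventually.of_forall fun x => ?_)
  refine tendsto_const_nhds.congr' ?_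
  obtain ⟨k, hk⟩ := exists_nat_gt ‖x‖
  filter_upwards [eventually_ge_atTop k] with j hj
  rw [indicator_of_notMem]
  rw [mem_compl_iff, not_not, mem_ball_zero_iff]
  have : (k : ℝ) ≤ j := by exact_mod_cast hj
  linarith

theorem enorm_cofactorPairing_le (a : Euc n →L[ℝ] ℝ) {θ : Euc n} (A : Euc n →L[ℝ] Euc n)
    (hθ : ‖θ‖ ≤ 1) :
    ‖cofactorPairing a θ A‖ₑ ≤
      ENNReal.ofReal (n * ‖detForm n‖) * (‖a‖ₑ * ‖A‖ₑ ^ (n - 1)) := by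
  have h := ENNReal.ofReal_le_ofReal (abs_cofactorPairing_le a A hθ)
  rw [← Real.norm_eq_abs, ofReal_norm, ENNReal.ofReal_mul (by positivity),
    ENNReal.ofReal_mul (norm_nonneg _), ENNReal.ofReal_pow (norm_nonneg _), ofReal_norm,
    ofReal_norm] at h
  exact h

variable {g : Euc n → Euc n} {G : Euc n → Euc n →L[ℝ] Euc n}

theorem aestronglyMeasurable_cofactorPairing {a : Euc n → Euc n →L[ℝ] ℝ}
    (ha : AEStronglyMeasurable a) (hg : AEStronglyMeasurable g) (hG : AEStronglyMeasurable G) :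
    AEStronglyMeasurable fun x => cofactorPairing (a x) (g x) (G x) :=
  continuous_cofactorPairing.comp_aestronglyMeasurable (ha.prodMk (hg.prodMk hG))

theorem integrable_cofactorPairing (hn : n ≠ 0) {a : Euc n → Euc n →L[ℝ] ℝ}
    (ha : AEStronglyMeasurable a) (hg : AEStronglyMeasurable g) (hg1 : ∀ x, ‖g x‖ ≤ 1)
    (hG : AEStronglyMeasurable G) (ha' : ∫⁻ x, ‖a x‖ₑ ^ n ≠ ⊤) (hG' : ∫⁻ x, ‖G x‖ₑ ^ n ≠ ⊤) :
    Integrable fun x => cofactorPairing (a x) (g x) (G x) := by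
  refine ⟨aestronglyMeasurable_cofactorPairing ha hg hG, ?_⟩
  rw [hasFiniteIntegral_iff_enorm]
  calc ∫⁻ x, ‖cofactorPairing (a x) (g x) (G x)‖ₑ
      ≤ ∫⁻ x, ENNReal.ofReal (n * ‖detForm n‖) * (‖a x‖ₑ ^ n + ‖G x‖ₑ ^ n) := by
        gcongr with x
        refine (enorm_cofactorPairing_le _ _ (hg1 x)).trans ?_
        gcongr
        exact mul_pow_pred_le hn _ _
    _ = ENNReal.ofReal (n * ‖detForm n‖) * ((∫⁻ x, ‖a x‖ₑ ^ n) + ∫⁻ x, ‖G x‖ₑ ^ n) := by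
        rw [lintegral_const_mul' _ _ ENNReal.ofReal_ne_top, lintegral_add_left' (ha.enorm.pow_const n)]
    _ < ⊤ := ENNReal.mul_lt_top ENNReal.ofReal_lt_top (ENNReal.add_lt_top.2 ⟨ha'.lt_top, hG'.lt_top⟩)

/-- The choice `c = η y`, with `y` in the annulus, gives `|η x - c| ≤ C R (N x + N y)` there, and
the factor `R` cancels the `1 / R` from the cutoff. Since `y` is chosen with `N y ^ n` below its
mean, its contribution is also bounded by the integral of `N ^ n`. The result is a tail of a
convergent integral, with a constant independent of `R`. -/
theorem lintegral_enorm_cutoff_remainder_le (hn : n ≠ 0) (hg1 : ∀ x, ‖g x‖ = 1) {η : Euc n → ℝ}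
    {N : Euc n → ℝ≥0∞} (hN : Measurable N)
    (hηN : ∀ x y, edist (η x) (η y) ≤ 2 ^ (n + 1) * edist x y * (N x + N y)) {χ : Euc n → ℝ} {R : ℝ}
    (hR : 0 < R) {B : ℝ≥0} (hχ : ∀ x, ‖fderiv ℝ χ x‖ ≤ B / R)
    (hχ0 : ∀ x, x ∉ closedBall (0 : Euc n) (2 * R) \ ball 0 R → fderiv ℝ χ x = 0) :
    ∃ c : ℝ, ∫⁻ x, ‖cofactorPairing ((η x - c) • fderiv ℝ χ x) (g x) (G x)‖ₑ ≤
      ENNReal.ofReal (n * ‖detForm n‖) * (2 ^ (n + 1) * ENNReal.ofReal (4 * B)) * 2 ^ (n + 1) *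
        ∫⁻ x in (ball (0 : Euc n) R)ᶜ, (N x ^ n + ‖G x‖ₑ ^ n) := by
  set s := closedBall (0 : Euc n) (2 * R) \ ball 0 R with hs
  have hsm : MeasurableSet s := measurableSet_closedBall.diff measurableSet_ball
  obtain ⟨y, hy, hyN⟩ := exists_mem_annulus_mul_le hn (hN.pow_const n) hR
  set κ := ENNReal.ofReal (n * ‖detForm n‖)
  set T : ℝ≥0∞ := κ * (2 ^ (n + 1) * ENNReal.ofReal (4 * B)) with hT
  have hTt : T ≠ ⊤ := ENNReal.mul_ne_top ENNReal.ofReal_ne_top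
    (ENNReal.mul_ne_top (by simp) ENNReal.ofReal_ne_top)
  refine ⟨η y, ?_⟩
  have hpt : ∀ x, ‖cofactorPairing ((η x - η y) • fderiv ℝ χ x) (g x) (G x)‖ₑ ≤
      s.indicator (fun x => T * (2 ^ n * (N x ^ n + N y ^ n) + ‖G x‖ₑ ^ n)) x := by
    intro x
    by_cases hx : x ∈ s
    · rw [indicator_of_mem hx]
      have hd : edist x y ≤ ENNReal.ofReal (4 * R) := by
        rw [edist_dist]
        refine ENNReal.ofReal_le_ofReal ((dist_triangle_right x y 0).trans ?_)
        linarith [mem_closedBall.1 hx.1, mem_closedBall.1 hy.1]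
      calc ‖cofactorPairing ((η x - η y) • fderiv ℝ χ x) (g x) (G x)‖ₑ
          ≤ κ * ((edist (η x) (η y) * ‖fderiv ℝ χ x‖ₑ) * ‖G x‖ₑ ^ (n - 1)) := by
            refine (enorm_cofactorPairing_le _ _ (hg1 x).le).trans ?_
            rw [enorm_smul, edist_eq_enorm_sub]
        _ ≤ κ * (((2 ^ (n + 1) * ENNReal.ofReal (4 * R) * (N x + N y)) * ENNReal.ofReal (B / R)) *
              ‖G x‖ₑ ^ (n - 1)) := by
            gcongr
            · exact (hηN x y).trans (by gcongr)
            · rw [← ofReal_norm]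
              exact ENNReal.ofReal_le_ofReal (hχ x)
        _ = κ * (2 ^ (n + 1) * (ENNReal.ofReal (4 * R) * ENNReal.ofReal (B / R))) *
              ((N x + N y) * ‖G x‖ₑ ^ (n - 1)) := by ring
        _ = T * ((N x + N y) * ‖G x‖ₑ ^ (n - 1)) := by
            rw [← ENNReal.ofReal_mul (by positivity),
              show 4 * R * (B / R) = 4 * (B : ℝ) by field_simp]
        _ ≤ T * (2 ^ n * (N x ^ n + N y ^ n) + ‖G x‖ₑ ^ n) := by
            gcongr
            refine (mul_pow_pred_le hn _ _).trans ?_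
            gcongr
            exact ENNReal.add_pow_le_two_pow_mul _ _ _
    · rw [hχ0 x hx, smul_zero]
      simp [cofactorPairing]
  calc ∫⁻ x, ‖cofactorPairing ((η x - η y) • fderiv ℝ χ x) (g x) (G x)‖ₑ
      ≤ ∫⁻ x in s, T * (2 ^ n * (N x ^ n + N y ^ n) + ‖G x‖ₑ ^ n) := by
        rw [← lintegral_indicator hsm]
        exact lintegral_mono hpt
    _ = T * (2 ^ n * ((∫⁻ x in s, N x ^ n) + N y ^ n * volume s) + ∫⁻ x in s, ‖G x‖ₑ ^ n) := by
        rw [lintegral_const_mul' _ _ hTt, lintegral_add_left, lintegral_const_mul' _ _ (by simp),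
          lintegral_add_left (hN.pow_const n), setLIntegral_const]
        exact ((hN.pow_const n).add_const _).const_mul _
    _ ≤ T * (2 ^ n * ((∫⁻ x in s, N x ^ n) + ∫⁻ x in s, N x ^ n) +
          2 ^ (n + 1) * ∫⁻ x in s, ‖G x‖ₑ ^ n) := by
        gcongr
        exact le_mul_of_one_le_left (by positivity) (one_le_pow₀ (by norm_num))
    _ = T * 2 ^ (n + 1) * ∫⁻ x in s, (N x ^ n + ‖G x‖ₑ ^ n) := by
        rw [lintegral_add_left (hN.pow_const n)]
        ring
    _ ≤ _ := by
        gcongr 1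
        exact lintegral_mono_set fun x hx => hx.2

/-- The integral of `dη ∧ g^* vol_{S^{n-1}}` vanishes. -/
theorem integral_cofactorPairing_fderiv_eq_zero (hn : 2 ≤ n) (h : IsWeakDerivative g G)
    (hg : Continuous g) (hg1 : ∀ x, ‖g x‖ = 1) (hG : ∫⁻ x, ‖G x‖ₑ ^ n ≠ ⊤) {η : Euc n → ℝ}
    {C : ℝ≥0} (hη : LipschitzWith C η) (hη' : ∫⁻ x, ‖fderiv ℝ η x‖ₑ ^ n ≠ ⊤) :
    ∫ x, cofactorPairing (fderiv ℝ η x) (g x) (G x) = 0 := by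
  have hn0 : n ≠ 0 := by omega
  have hηw := hη.isWeakDerivative
  have hGm := h.locallyIntegrable_deriv.aestronglyMeasurable
  have hηm := hηw.locallyIntegrable_deriv.aestronglyMeasurable
  have hMG := lintegral_ballMaximal_pow_ne_top hn hGm.enorm hG
  have hMη := lintegral_ballMaximal_pow_ne_top hn hηm.enorm hη'
  set N := ballMaximal fun y => ‖fderiv ℝ η y‖ₑ with hN
  set M := ballMaximal fun y => ‖G y‖ₑ with hM
  have hηN := edist_le_edist_mul_ballMaximal hηw hη.continuous
    (setLIntegral_ball_ne_top_of_pow hn0 hMη)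
  have hint := integrable_cofactorPairing hn0 hηm hg.aestronglyMeasurable (fun x => (hg1 x).le) hGm
    hη' hG
  obtain ⟨B, hB⟩ := exists_cutoff n
  choose χ hχd hχc hχ1 hχone hχB hχ0 using fun j : ℕ => hB ((j : ℝ) + 1) (by positivity)
  have hlim : Tendsto (fun j => ∫ x, χ j x * cofactorPairing (fderiv ℝ η x) (g x) (G x)) atTop
      (𝓝 (∫ x, cofactorPairing (fderiv ℝ η x) (g x) (G x))) := by
    refine tendsto_integral_of_dominated_convergence
      (fun x => ‖cofactorPairing (fderiv ℝ η x) (g x) (G x)‖)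
      (fun j => (hχd j).continuous.aestronglyMeasurable.mul hint.aestronglyMeasurable) hint.norm
      (fun j => Eventually.of_forall fun x => ?_) (Eventually.of_forall fun x => ?_)
    · rw [norm_mul]
      exact mul_le_of_le_one_left (norm_nonneg _) (hχ1 j x)
    · refine tendsto_const_nhds.congr' ?_
      obtain ⟨k, hk⟩ := exists_nat_gt ‖x‖
      filter_upwards [eventually_ge_atTop k] with j hj
      rw [hχone, one_mul]
      have : (k : ℝ) ≤ j := by exact_mod_cast hj
      linarith
  set Λ : ℝ≥0∞ := ENNReal.ofReal (n * ‖detForm n‖) * (2 ^ (n + 1) * ENNReal.ofReal (4 * B)) *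
    2 ^ (n + 1) with hΛ
  have hΛt : Λ ≠ ⊤ := ENNReal.mul_ne_top (ENNReal.mul_ne_top ENNReal.ofReal_ne_top
    (ENNReal.mul_ne_top (by simp) ENNReal.ofReal_ne_top)) (by simp)
  set G₁ := hGm.mk G with hG₁
  have hGG : G =ᵐ[volume] G₁ := hGm.ae_eq_mk
  set w : Euc n → ℝ≥0∞ := fun x => N x ^ n + ‖G₁ x‖ₑ ^ n with hw
  have hwm : Measurable w := ((measurable_ballMaximal _).pow_const n).add
    (hGm.stronglyMeasurable_mk.enorm.pow_const n)
  have hwi : ∫⁻ x, w x ≠ ⊤ := by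
    rw [hw, lintegral_add_left ((measurable_ballMaximal _).pow_const n)]
    refine ENNReal.add_ne_top.2 ⟨hMη, ?_⟩
    rwa [← lintegral_congr_ae (hGG.mono fun x hx => by simp only [hx] :
      (fun x => ‖G x‖ₑ ^ n) =ᵐ[volume] fun x => ‖G₁ x‖ₑ ^ n)]
  -- The cutoff identity makes the localized integral the negative of the remainder containing `∇χ`.
  -- The constant `c` may depend on `j`, but the bound does not involve it.
  have hle : ∀ j : ℕ, ‖∫ x, χ j x * cofactorPairing (fderiv ℝ η x) (g x) (G x)‖ₑ ≤
      Λ * ∫⁻ x in (ball (0 : Euc n) ((j : ℝ) + 1))ᶜ, w x := by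
    intro j
    obtain ⟨c, hc⟩ := lintegral_enorm_cutoff_remainder_le (G := G) hn0 hg1 (measurable_ballMaximal _)
      hηN (by positivity) (hχB j) (hχ0 j)
    rw [← hΛ, ← hN] at hc
    have hcw : ∫⁻ x in (ball (0 : Euc n) ((j : ℝ) + 1))ᶜ, (N x ^ n + ‖G x‖ₑ ^ n) =
        ∫⁻ x in (ball (0 : Euc n) ((j : ℝ) + 1))ᶜ, w x :=
      lintegral_congr_ae (ae_restrict_of_ae (hGG.mono fun x hx => by simp only [hx, hw]))
    rw [hcw] at hc
    have hzero := integral_cofactorPairing_cutoff_eq_zero hn0 h hg hg1 hMG hη (hχd j) (hχc j) c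
    have hm1 : AEStronglyMeasurable fun x => (η x - c) • fderiv ℝ (χ j) x :=
      ((hη.continuous.sub continuous_const).smul
        ((hχd j).continuous_fderiv (by norm_num))).aestronglyMeasurable
    have hi1 : Integrable fun x => cofactorPairing ((η x - c) • fderiv ℝ (χ j) x) (g x) (G x) := by
      refine ⟨aestronglyMeasurable_cofactorPairing hm1 hg.aestronglyMeasurable hGm, ?_⟩
      rw [hasFiniteIntegral_iff_enorm]
      refine hc.trans_lt (ENNReal.mul_lt_top hΛt.lt_top ?_)
      exact (setLIntegral_le_lintegral _ _).trans_lt hwi.lt_top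
    have hi2 : Integrable fun x => χ j x * cofactorPairing (fderiv ℝ η x) (g x) (G x) :=
      hint.bdd_mul (hχd j).continuous.aestronglyMeasurable (Eventually.of_forall (hχ1 j))
    simp only [cofactorPairing_add, cofactorPairing_smul (χ j _)] at hzero
    rw [integral_add hi1 hi2] at hzero
    rw [← neg_eq_of_add_eq_zero_right hzero, enorm_neg]
    exact (enorm_integral_le_lintegral_enorm _).trans hc
  have h0 : Tendsto (fun j : ℕ => Λ * ∫⁻ x in (ball (0 : Euc n) ((j : ℝ) + 1))ᶜ, w x) atTop
      (𝓝 0) := by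
    rw [← mul_zero Λ]
    exact ENNReal.Tendsto.const_mul (tendsto_setLIntegral_compl_ball hwm hwi) (Or.inr hΛt)
  have h1 : Tendsto (fun j => ‖∫ x, χ j x * cofactorPairing (fderiv ℝ η x) (g x) (G x)‖ₑ) atTop
      (𝓝 0) := tendsto_of_tendsto_of_tendsto_of_le_of_le tendsto_const_nhds h0
    (fun j => zero_le) hle
  have h2 := tendsto_nhds_unique hlim.enorm h1
  rwa [enorm_eq_zero] at h2

end vanishing

/-! ### Lipschitz truncation and the level set inequality. -/

section levelSets

variable {n : ℕ}

theorem volume_lt_ne_top_of_pow {M : Euc n → ℝ≥0∞} (hM : Measurable M)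
    (h : ∫⁻ x, M x ^ n ≠ ⊤) {t : ℝ≥0} (ht : t ≠ 0) : volume {x | (t : ℝ≥0∞) < M x} ≠ ⊤ := by
  have h1 := mul_meas_ge_le_lintegral₀ (μ := volume) (hM.pow_const n).aemeasurable ((t : ℝ≥0∞) ^ n)
  have h2 : volume {x | (t : ℝ≥0∞) < M x} ≤ volume {x | (t : ℝ≥0∞) ^ n ≤ M x ^ n} :=
    measure_mono fun x (hx : (t : ℝ≥0∞) < M x) =>
      show (t : ℝ≥0∞) ^ n ≤ M x ^ n from pow_le_pow_left₀ zero_le hx.le n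
  intro htop
  rw [htop, top_le_iff] at h2
  rw [h2, ENNReal.mul_top (pow_ne_zero _ (by exact_mod_cast ht)), top_le_iff] at h1
  exact h h1

/-- Lipschitz truncation: on a sublevel set of the maximal function a continuous Sobolev function
agrees, together with its derivative, with a Lipschitz function. -/
theorem exists_lipschitz_truncation {f : Euc n → ℝ} {a : Euc n → Euc n →L[ℝ] ℝ}
    (hf : Continuous f) (h : IsWeakDerivative f a)
    (hM : ∀ x r, ∫⁻ y in ball x r, ballMaximal (fun y => ‖a y‖ₑ) y ≠ ⊤) (t : ℝ≥0) :
    ∃ η : Euc n → ℝ, LipschitzWith (2 ^ (n + 2) * t) η ∧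
      ∀ᵐ x, ballMaximal (fun y => ‖a y‖ₑ) x ≤ t → fderiv ℝ η x = a x := by
  set M := ballMaximal fun y => ‖a y‖ₑ with hMdef
  have hlip : LipschitzOnWith (2 ^ (n + 2) * t) f {x | M x ≤ t} := by
    intro x hx y hy
    refine (edist_le_edist_mul_ballMaximal h hf hM x y).trans ?_
    calc 2 ^ (n + 1) * edist x y * (M x + M y) ≤ 2 ^ (n + 1) * edist x y * (t + t) := by
          gcongr
          · exact hx
          · exact hy
      _ = _ := by push_cast; ring
  obtain ⟨η, hη, heq⟩ := hlip.extend_real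
  refine ⟨η, hη, ?_⟩
  have hηw := hη.isWeakDerivative
  -- Needed to apply the zero set result to `η - f`, which vanishes on the sublevel set.
  have hM2 : ∀ x r, ∫⁻ y in ball x r, ballMaximal (fun y => ‖fderiv ℝ η y - a y‖ₑ) y ≠ ⊤ := by
    intro x r
    have hle : ∀ y, ballMaximal (fun y => ‖fderiv ℝ η y - a y‖ₑ) y ≤
        (2 ^ (n + 2) * t : ℝ≥0) + M y := by
      intro y
      refine (ballMaximal_mono_ae
        (v := fun y => ((2 ^ (n + 2) * t : ℝ≥0) : ℝ≥0∞) + ‖a y‖ₑ)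
        (Eventually.of_forall fun z => ?_) y).trans
        ((ballMaximal_add_le aemeasurable_const y).trans ?_)
      · refine enorm_sub_le.trans ?_
        gcongr
        rw [← ofReal_norm, ← ENNReal.ofReal_coe_nnreal]
        exact ENNReal.ofReal_le_ofReal (norm_fderiv_le_of_lipschitz ℝ hη)
      · gcongr
        exact ballMaximal_const_le _ _
    refine ne_top_of_le_ne_top ?_ (lintegral_mono hle)
    rw [lintegral_add_left measurable_const, setLIntegral_const]
    exact ENNReal.add_ne_top.2 ⟨ENNReal.mul_ne_top ENNReal.coe_ne_top (volume_ball_euc_ne_top x),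
      hM x r⟩
  filter_upwards [(hηw.sub h).ae_eq_zero_of_eq_zero (hη.continuous.sub hf) hM2] with x hx hxt
  exact sub_eq_zero.1 (hx (sub_eq_zero.2 (heq hxt).symm))

/-- For the Lipschitz truncation `η` of `f` at level `t` the integral over the whole space is zero,
and on the sublevel set `∇η` agrees with `a`. The integral over that set is therefore minus the one
over the complement, where `|∇η|` is of order `t`. -/
theorem enorm_setIntegral_cofactorPairing_le (hn : 2 ≤ n) {f : Euc n → ℝ}
    {a : Euc n → Euc n →L[ℝ] ℝ} (hf : Continuous f) (ha : IsWeakDerivative f a) {g : Euc n → Euc n}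
    {G : Euc n → Euc n →L[ℝ] Euc n} (hg : Continuous g) (hG : IsWeakDerivative g G)
    (hg1 : ∀ x, ‖g x‖ = 1) {W : Euc n → ℝ≥0∞} (hWm : AEMeasurable W) (hW : ∫⁻ x, W x ^ n ≠ ⊤)
    (haW : ∀ x, ‖a x‖ₑ ≤ W x) (hGW : ∀ x, ‖G x‖ₑ ≤ W x) {t : ℝ≥0} (ht : t ≠ 0) :
    ‖∫ x in {x | ballMaximal W x ≤ t}, cofactorPairing (a x) (g x) (G x)‖ₑ ≤
      ENNReal.ofReal (n * ‖detForm n‖) * 2 ^ (n + 2) * t *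
        ∫⁻ x in {x | t < ballMaximal W x}, W x ^ (n - 1) := by
  have hn0 : n ≠ 0 := by omega
  set M := ballMaximal W with hM
  have hMm : Measurable M := measurable_ballMaximal W
  have hMi : ∫⁻ x, M x ^ n ≠ ⊤ := lintegral_ballMaximal_pow_ne_top hn hWm hW
  have haM : ∀ x, ballMaximal (fun y => ‖a y‖ₑ) x ≤ M x := fun x =>
    ballMaximal_mono_ae (Eventually.of_forall haW) x
  obtain ⟨η, hη, hηa⟩ := exists_lipschitz_truncation hf ha (fun x r => ne_top_of_le_ne_top
    (setLIntegral_ball_ne_top_of_pow hn0 hMi x r) (lintegral_mono haM)) t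
  set F : Set (Euc n) := {x | M x ≤ t} with hF
  have hFm : MeasurableSet F := measurableSet_le hMm measurable_const
  have hFc : Fᶜ = {x | t < M x} := by ext x; simp [hF]
  have hηF : ∀ᵐ x, x ∈ F → fderiv ℝ η x = a x := hηa.mono fun x hx hxF => hx ((haM x).trans hxF)
  have hηL : ∀ x, ‖fderiv ℝ η x‖ₑ ≤ 2 ^ (n + 2) * t := by
    intro x
    rw [← ofReal_norm]
    refine (ENNReal.ofReal_le_ofReal (norm_fderiv_le_of_lipschitz ℝ hη)).trans_eq ?_
    rw [ENNReal.ofReal_coe_nnreal]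
    push_cast
    rfl
  -- On the sublevel set `∇η = a`; on the complement `∇η` is bounded and the measure is finite by
  -- Chebyshev's inequality.
  have hη' : ∫⁻ x, ‖fderiv ℝ η x‖ₑ ^ n ≠ ⊤ := by
    rw [← lintegral_add_compl _ hFm]
    refine ENNReal.add_ne_top.2 ⟨?_, ?_⟩
    · refine ne_top_of_le_ne_top hW (le_trans ?_ (setLIntegral_le_lintegral F _))
      refine lintegral_mono_ae ((ae_restrict_iff' hFm).2 ?_)
      filter_upwards [hηF] with x hx hxF
      rw [hx hxF]
      gcongr
      exact haW x
    · refine ne_top_of_le_ne_top ?_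
        (lintegral_mono fun x => pow_le_pow_left₀ zero_le (hηL x) n)
      rw [setLIntegral_const, hFc]
      exact ENNReal.mul_ne_top (ENNReal.pow_ne_top (ENNReal.mul_ne_top (by simp)
        ENNReal.coe_ne_top)) (volume_lt_ne_top_of_pow hMm hMi ht)
  have hG' : ∫⁻ x, ‖G x‖ₑ ^ n ≠ ⊤ := ne_top_of_le_ne_top hW
    (lintegral_mono fun x => pow_le_pow_left₀ zero_le (hGW x) n)
  have hint : Integrable fun x => cofactorPairing (fderiv ℝ η x) (g x) (G x) :=
    integrable_cofactorPairing hn0 hη.isWeakDerivative.locallyIntegrable_deriv.aestronglyMeasurable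
      hg.aestronglyMeasurable (fun x => (hg1 x).le)
      hG.locallyIntegrable_deriv.aestronglyMeasurable hη' hG'
  have hzero := integral_cofactorPairing_fderiv_eq_zero hn hG hg hg1 hG' hη hη'
  rw [← integral_add_compl hFm hint] at hzero
  have hcongr : ∫ x in F, cofactorPairing (fderiv ℝ η x) (g x) (G x) =
      ∫ x in F, cofactorPairing (a x) (g x) (G x) := by
    refine integral_congr_ae ((ae_restrict_iff' hFm).2 ?_)
    filter_upwards [hηF] with x hx hxF
    rw [hx hxF]
  rw [hcongr] at hzero
  rw [eq_neg_of_add_eq_zero_left hzero, enorm_neg, hFc]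
  refine (enorm_integral_le_lintegral_enorm _).trans ?_
  rw [← lintegral_const_mul' _ _ (ENNReal.mul_ne_top (ENNReal.mul_ne_top ENNReal.ofReal_ne_top
    (by simp)) ENNReal.coe_ne_top)]
  refine lintegral_mono fun x => ?_
  calc ‖cofactorPairing (fderiv ℝ η x) (g x) (G x)‖ₑ
      ≤ ENNReal.ofReal (n * ‖detForm n‖) * ((2 ^ (n + 2) * t) * W x ^ (n - 1)) := by
        refine (enorm_cofactorPairing_le _ _ (hg1 x).le).trans ?_
        gcongr
        · exact hηL x
        · exact hGW x
    _ = _ := by ring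

/-- The projection of `ℝ × ℝ^n` to the line. -/
noncomputable abbrev ambientFst (n : ℕ) : Ambient n →L[ℝ] ℝ := WithLp.fstL 2 ℝ ℝ (Euc n)

/-- The projection of `ℝ × ℝ^n` to `ℝ^n`. -/
noncomputable abbrev ambientSnd (n : ℕ) : Ambient n →L[ℝ] Euc n := WithLp.sndL 2 ℝ ℝ (Euc n)

theorem norm_ambientFst_comp_le (L : Euc n →L[ℝ] Ambient n) : ‖(ambientFst n).comp L‖ ≤ ‖L‖ :=
  opNorm_le_bound _ (norm_nonneg _) fun v => (WithLp.norm_fst_le _ _).trans (L.le_opNorm v)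

theorem norm_ambientSnd_comp_le (L : Euc n →L[ℝ] Ambient n) : ‖(ambientSnd n).comp L‖ ≤ ‖L‖ :=
  opNorm_le_bound _ (norm_nonneg _) fun v => (WithLp.norm_snd_le _ _).trans (L.le_opNorm v)

/-- In the frame at `h x` the derivative is the rank one perturbation `a ⊗ θ + G`, so the matrix
determinant lemma applies. -/
theorem cylinderJacobian_eq (h : Euc n → ℝ × UnitSphere n) (Dh : Euc n → Euc n →L[ℝ] Ambient n)
    (x : Euc n) :
    cylinderJacobian h Dh x = detForm n (fun i => (ambientSnd n).comp (Dh x) (stdVec i)) +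
      cofactorPairing ((ambientFst n).comp (Dh x)) (h x).2 ((ambientSnd n).comp (Dh x)) := by
  rw [cylinderJacobian, linearMap_det_eq_detForm, ← detForm_smul_add]
  rfl

/-- The integral of `|Dh|^n` over a sublevel set of the maximal function. -/
theorem exists_setLIntegral_sublevel_le (hn : 2 ≤ n) {K : ℝ} (hK : 0 ≤ K) :
    ∃ B c : ℝ≥0, ∀ (h : Euc n → ℝ × UnitSphere n) (Dh : Euc n → Euc n →L[ℝ] Ambient n)
      (σ : Euc n → ℝ), Continuous h → IsWeakDerivative (fun x => cylinderIncl (h x)) Dh →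
      ∫⁻ x, ‖Dh x‖ₑ ^ n ≠ ⊤ → AEMeasurable σ → (∀ᵐ x, 0 ≤ σ x) →
      (∀ᵐ x, ‖Dh x‖ ^ n ≤ K * cylinderJacobian h Dh x + σ x ^ n) →
      ∃ S : Euc n → ℝ≥0∞, AEMeasurable S ∧ (∀ x, S x ≤ c * ‖Dh x‖ₑ ^ n) ∧
        (∀ᵐ x, S x ≤ ENNReal.ofReal (σ x) ^ n) ∧ ∀ t : ℝ≥0, t ≠ 0 →
          ∫⁻ x in {x | ballMaximal (fun y => ‖Dh y‖ₑ) x ≤ t}, ‖Dh x‖ₑ ^ n ≤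
            B * t * (∫⁻ x in {x | t < ballMaximal (fun y => ‖Dh y‖ₑ) x}, ‖Dh x‖ₑ ^ (n - 1)) +
              ∫⁻ x in {x | ballMaximal (fun y => ‖Dh y‖ₑ) x ≤ t}, S x := by
  have hn0 : n ≠ 0 := by omega
  set d : ℝ := n * ‖detForm n‖ with hd
  have hd0 : 0 ≤ d := by positivity
  refine ⟨K.toNNReal * d.toNNReal * 2 ^ (n + 2), (1 + K * d).toNNReal, ?_⟩
  intro h Dh σ hh hw hDi hσm hσ0 hineq
  set f : Euc n → ℝ := fun x => (h x).1 with hf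
  set g : Euc n → Euc n := fun x => (h x).2 with hg
  set a : Euc n → Euc n →L[ℝ] ℝ := fun x => (ambientFst n).comp (Dh x) with ha
  set G : Euc n → Euc n →L[ℝ] Euc n := fun x => (ambientSnd n).comp (Dh x) with hG
  have hfc : Continuous f := continuous_fst.comp hh
  have hgc : Continuous g := continuous_subtype_val.comp (continuous_snd.comp hh)
  have hg1 : ∀ x, ‖g x‖ = 1 := fun x => mem_sphere_zero_iff_norm.1 (h x).2.2
  have haw : IsWeakDerivative f a := hw.clm_comp (ambientFst n)
  have hGw : IsWeakDerivative g G := hw.clm_comp (ambientSnd n)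
  have haD : ∀ x, ‖a x‖ ≤ ‖Dh x‖ := fun x => norm_ambientFst_comp_le _
  have hGD : ∀ x, ‖G x‖ ≤ ‖Dh x‖ := fun x => norm_ambientSnd_comp_le _
  have haD' : ∀ x, ‖a x‖ₑ ≤ ‖Dh x‖ₑ := fun x => enorm_le_iff_norm_le.2 (haD x)
  have hGD' : ∀ x, ‖G x‖ₑ ≤ ‖Dh x‖ₑ := fun x => enorm_le_iff_norm_le.2 (hGD x)
  have hDm := hw.locallyIntegrable_deriv.aestronglyMeasurable
  have hpow : ∀ x, ENNReal.ofReal (‖Dh x‖ ^ n) = ‖Dh x‖ₑ ^ n := fun x => by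
    rw [ENNReal.ofReal_pow (norm_nonneg _), ofReal_norm]
  have hDint : Integrable fun x => ‖Dh x‖ ^ n := by
    refine ⟨(hDm.norm.pow n), ?_⟩
    rw [hasFiniteIntegral_iff_enorm]
    simpa only [enorm_pow, enorm_norm] using hDi.lt_top
  have haDi : ∫⁻ x, ‖a x‖ₑ ^ n ≠ ⊤ := ne_top_of_le_ne_top hDi
    (lintegral_mono fun x => pow_le_pow_left₀ zero_le (haD' x) n)
  have hGDi : ∫⁻ x, ‖G x‖ₑ ^ n ≠ ⊤ := ne_top_of_le_ne_top hDi
    (lintegral_mono fun x => pow_le_pow_left₀ zero_le (hGD' x) n)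
  have hMG := lintegral_ballMaximal_pow_ne_top hn
    hGw.locallyIntegrable_deriv.aestronglyMeasurable.enorm hGDi
  set P : Euc n → ℝ := fun x => cofactorPairing (a x) (g x) (G x) with hP
  have hPi : Integrable P := integrable_cofactorPairing hn0
    haw.locallyIntegrable_deriv.aestronglyMeasurable hgc.aestronglyMeasurable (fun x => (hg1 x).le)
    hGw.locallyIntegrable_deriv.aestronglyMeasurable haDi hGDi
  have hPb : ∀ x, |P x| ≤ d * ‖Dh x‖ ^ n := by
    intro x
    refine (abs_cofactorPairing_le _ _ (hg1 x).le).trans ?_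
    rw [← hd, ← mul_pow_sub_one hn0 ‖Dh x‖]
    gcongr
    · exact haD x
    · exact hGD x
  -- Capping `σ ^ n` is harmless because `‖Dh‖ ^ n - K * P ≤ (1 + K * d) * ‖Dh‖ ^ n` holds anyway.
  -- The cap makes the error small where the maximal function is small, which is what later allows
  -- the exponent `n - ε`.
  set s : Euc n → ℝ := fun x => min (σ x ^ n) ((1 + K * d) * ‖Dh x‖ ^ n) with hs
  have hJ : ∀ᵐ x, ‖Dh x‖ ^ n ≤ K * P x + s x := by
    filter_upwards [hineq, hGw.ae_inner_eq_zero hgc hg1 (setLIntegral_ball_ne_top_of_pow hn0 hMG)]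
      with x hx hx2
    rw [cylinderJacobian_eq, detForm_eq_zero_of_inner_eq_zero (hg1 x) hx2, zero_add] at hx
    rw [hs, ← sub_le_iff_le_add', le_min_iff]
    refine ⟨sub_le_iff_le_add'.2 hx, ?_⟩
    have h1 : -(K * P x) ≤ K * (d * ‖Dh x‖ ^ n) := by
      rw [← mul_neg]
      exact mul_le_mul_of_nonneg_left ((neg_le_abs _).trans (hPb x)) hK
    linarith
  have hsm : AEStronglyMeasurable s :=
    ((hσm.pow_const n).min ((hDm.norm.aemeasurable.pow_const n).const_mul _)).aestronglyMeasurable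
  have hs0 : ∀ᵐ x, 0 ≤ s x := by
    filter_upwards [hσ0] with x hx
    exact le_min (by positivity) (by positivity)
  have hsi : Integrable s := by
    refine (hDint.const_mul (1 + K * d)).mono' hsm ?_
    filter_upwards [hs0] with x hx
    rw [Real.norm_of_nonneg hx]
    exact min_le_right _ _
  refine ⟨fun x => ENNReal.ofReal (s x), hsm.aemeasurable.ennreal_ofReal, fun x => ?_, ?_,
    fun t ht => ?_⟩
  · refine (ENNReal.ofReal_le_ofReal (min_le_right _ _)).trans_eq ?_
    rw [ENNReal.ofReal_mul (by positivity), hpow]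
    rfl
  · filter_upwards [hσ0] with x hx
    rw [← ENNReal.ofReal_pow hx]
    exact ENNReal.ofReal_le_ofReal (min_le_left _ _)
  · set F : Set (Euc n) := {x | ballMaximal (fun y => ‖Dh y‖ₑ) x ≤ t}
    have hkey := enorm_setIntegral_cofactorPairing_le hn hfc haw hgc hGw hg1 hDm.enorm hDi haD' hGD' ht
    have hreal : ∫ x in F, ‖Dh x‖ ^ n ≤ K * |∫ x in F, P x| + ∫ x in F, s x := by
      calc ∫ x in F, ‖Dh x‖ ^ n ≤ ∫ x in F, (K * P x + s x) :=
            integral_mono_ae hDint.restrict ((hPi.const_mul K).add hsi).restrict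
              (ae_restrict_of_ae hJ)
        _ = K * (∫ x in F, P x) + ∫ x in F, s x := by
            rw [integral_add (hPi.const_mul K).restrict hsi.restrict, integral_const_mul]
        _ ≤ _ := by
            gcongr
            exact le_abs_self _
    have hL : ∫⁻ x in F, ‖Dh x‖ₑ ^ n = ENNReal.ofReal (∫ x in F, ‖Dh x‖ ^ n) := by
      rw [ofReal_integral_eq_lintegral_ofReal hDint.restrict
        (Eventually.of_forall fun x => by positivity)]
      simp only [hpow]
    rw [hL]
    refine (ENNReal.ofReal_le_ofReal hreal).trans ?_
    rw [ENNReal.ofReal_add (by positivity)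
      (integral_nonneg_of_ae (ae_restrict_of_ae hs0)), ENNReal.ofReal_mul hK,
      ofReal_integral_eq_lintegral_ofReal hsi.restrict (ae_restrict_of_ae hs0),
      ← Real.norm_eq_abs, ofReal_norm]
    gcongr ?_ + _
    calc ENNReal.ofReal K * ‖∫ x in F, P x‖ₑ ≤ ENNReal.ofReal K *
          (ENNReal.ofReal d * 2 ^ (n + 2) * t *
            ∫⁻ x in {x | t < ballMaximal (fun y => ‖Dh y‖ₑ) x}, ‖Dh x‖ₑ ^ (n - 1)) := by
          gcongr
      _ = _ := by
          push_cast
          simp only [ENNReal.ofReal]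
          ring

end levelSets

/-! ### Pointwise estimates for the dyadic logarithmic weights. -/

section dyadicWeights

/-- The weight `∑ (k + 1) ^ (n - 1)` over the `k < N` with `t ≤ 2 ^ (-k)`. -/
noncomputable def lowSum (n N : ℕ) (t : ℝ≥0∞) : ℝ≥0∞ :=
  ∑ k ∈ Finset.range N, if t ≤ 2⁻¹ ^ k then ((k : ℝ≥0∞) + 1) ^ (n - 1) else 0

/-- The sum of `(k + 1) ^ (n - 1) * 2 ^ (-k)` over the `k < N` with `2 ^ (-k) < t`. -/
noncomputable def highSum (n N : ℕ) (t : ℝ≥0∞) : ℝ≥0∞ :=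
  ∑ k ∈ Finset.range N, if 2⁻¹ ^ k < t then ((k : ℝ≥0∞) + 1) ^ (n - 1) * 2⁻¹ ^ k else 0

theorem exists_tsum_pow_mul_geometric_le (m : ℕ) {r : ℝ≥0} (hr0 : r ≠ 0) (hr : r < 1) :
    ∃ c : ℝ≥0, ∑' j : ℕ, ((j : ℝ≥0∞) + 1) ^ m * (r : ℝ≥0∞) ^ j ≤ c := by
  have h1 : Summable fun j : ℕ => ((j : ℝ) + 1) ^ m * (r : ℝ) ^ j := by
    have h2 := summable_pow_mul_geometric_of_norm_lt_one m (r := (r : ℝ))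
      (by rw [Real.norm_of_nonneg r.coe_nonneg]; exact_mod_cast hr)
    have h3 := ((summable_nat_add_iff 1).2 h2).mul_right (r : ℝ)⁻¹
    refine h3.congr fun j => ?_
    have : (r : ℝ) ≠ 0 := by exact_mod_cast hr0
    push_cast
    field_simp
    ring
  have h4 : Summable fun j : ℕ => ((j : ℝ≥0) + 1) ^ m * r ^ j := by
    rw [← NNReal.summable_coe]
    simpa using h1
  refine ⟨∑' j : ℕ, ((j : ℝ≥0) + 1) ^ m * r ^ j, ?_⟩
  rw [ENNReal.coe_tsum h4]
  push_cast
  exact le_rfl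

/-- Telescoping of `(m + 1) ^ n - m ^ n ≤ n * (m + 1) ^ (n - 1)`. The `if` only accounts for `n =
0`, where the left side is `1`. -/
theorem pow_le_mul_sum_range (n m : ℕ) :
    m ^ n ≤ n * ∑ k ∈ Finset.range m, (k + 1) ^ (n - 1) + if n = 0 then 1 else 0 := by
  rcases Nat.eq_zero_or_pos n with rfl | hn
  · simp
  have step : ∀ m j : ℕ, (m + 1) ^ (j + 1) ≤ (j + 1) * (m + 1) ^ j + m ^ (j + 1) := by
    intro m j
    induction j with
    | zero => simp [add_comm]
    | succ j ih =>
      calc (m + 1) ^ (j + 1 + 1) = (m + 1) ^ (j + 1) + m * (m + 1) ^ (j + 1) := by ring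
        _ ≤ (m + 1) ^ (j + 1) + m * ((j + 1) * (m + 1) ^ j + m ^ (j + 1)) := by gcongr
        _ ≤ (m + 1) ^ (j + 1) + ((j + 1) * ((m + 1) * (m + 1) ^ j) + m ^ (j + 1 + 1)) := by
          have : m * ((j + 1) * (m + 1) ^ j) ≤ (j + 1) * ((m + 1) * (m + 1) ^ j) := by
            calc _ = (j + 1) * (m * (m + 1) ^ j) := by ring
              _ ≤ _ := by gcongr; omega
          calc _ = (m + 1) ^ (j + 1) + (m * ((j + 1) * (m + 1) ^ j) + m ^ (j + 1 + 1)) := by ring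
            _ ≤ _ := by gcongr
        _ = _ := by ring
  rw [if_neg hn.ne', add_zero]
  obtain ⟨j, rfl⟩ : ∃ j, n = j + 1 := ⟨n - 1, by omega⟩
  induction m with
  | zero => simp
  | succ m ih =>
    rw [Finset.sum_range_succ, mul_add]
    refine (step m j).trans ?_
    rw [add_comm]
    exact add_le_add ih (by simp)

theorem pow_le_mul_lowSum {n m N : ℕ} (hn : n ≠ 0) (hmN : m ≤ N) {t : ℝ≥0∞}
    (ht : ∀ k < m, t ≤ 2⁻¹ ^ k) : (m : ℝ≥0∞) ^ n ≤ n * lowSum n N t := by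
  have h := pow_le_mul_sum_range n m
  rw [if_neg hn, add_zero] at h
  have h2 : (m : ℝ≥0∞) ^ n ≤ n * ∑ k ∈ Finset.range m, ((k : ℝ≥0∞) + 1) ^ (n - 1) := by
    exact_mod_cast h
  refine h2.trans ?_
  gcongr
  calc ∑ k ∈ Finset.range m, ((k : ℝ≥0∞) + 1) ^ (n - 1)
      = ∑ k ∈ Finset.range m, if t ≤ 2⁻¹ ^ k then ((k : ℝ≥0∞) + 1) ^ (n - 1) else 0 :=
        Finset.sum_congr rfl fun k hk => by rw [if_pos (ht k (Finset.mem_range.1 hk))]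
    _ ≤ _ := Finset.sum_le_sum_of_subset (Finset.range_mono hmN)

theorem highSum_eq_zero {n m N : ℕ} (hNm : N ≤ m) {t : ℝ≥0∞} (ht : ∀ k < m, t ≤ 2⁻¹ ^ k) :
    highSum n N t = 0 :=
  Finset.sum_eq_zero fun k hk => if_neg (not_lt.2 (ht k ((Finset.mem_range.1 hk).trans_le hNm)))

/-- Only indices `k = m + j` contribute. The inequality `m + j + 1 ≤ (m + 1) * (j + 1)` separates
the variables, leaving a convergent series in `j` and the factor `2 ^ (-m) ≤ t`. -/
theorem exists_highSum_le (n : ℕ) : ∃ c : ℝ≥0, ∀ (m N : ℕ) (t : ℝ≥0∞), 2⁻¹ ^ m ≤ t →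
    (∀ k < m, t ≤ 2⁻¹ ^ k) → highSum n N t ≤ c * (((m : ℝ≥0∞) + 1) ^ (n - 1) * t) := by
  obtain ⟨c, hc⟩ := exists_tsum_pow_mul_geometric_le (n - 1) (r := 2⁻¹) (by norm_num) (by
    rw [inv_lt_one₀ (by norm_num)]; norm_num)
  refine ⟨c, fun m N t hmt ht => ?_⟩
  calc highSum n N t ≤ ∑ k ∈ Finset.range (m + N),
        if 2⁻¹ ^ k < t then ((k : ℝ≥0∞) + 1) ^ (n - 1) * 2⁻¹ ^ k else 0 :=
        Finset.sum_le_sum_of_subset (Finset.range_mono (by omega))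
    _ = ∑ j ∈ Finset.range N, if 2⁻¹ ^ (m + j) < t then
          (((m + j : ℕ) : ℝ≥0∞) + 1) ^ (n - 1) * 2⁻¹ ^ (m + j) else 0 := by
        rw [Finset.sum_range_add, Finset.sum_eq_zero, zero_add]
        exact fun k hk => if_neg (not_lt.2 (ht k (Finset.mem_range.1 hk)))
    _ ≤ ∑ j ∈ Finset.range N, (((m : ℝ≥0∞) + 1) ^ (n - 1) * 2⁻¹ ^ m) *
          (((j : ℝ≥0∞) + 1) ^ (n - 1) * 2⁻¹ ^ j) := by
        refine Finset.sum_le_sum fun j _ => ?_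
        split_ifs
        · have h1 : (((m + j : ℕ) : ℝ≥0∞) + 1) ≤ ((m : ℝ≥0∞) + 1) * ((j : ℝ≥0∞) + 1) := by
            have : m + j + 1 ≤ (m + 1) * (j + 1) := by nlinarith [Nat.zero_le (m * j)]
            exact_mod_cast this
          calc _ ≤ (((m : ℝ≥0∞) + 1) * ((j : ℝ≥0∞) + 1)) ^ (n - 1) * 2⁻¹ ^ (m + j) := by gcongr
            _ = _ := by rw [mul_pow, pow_add]; ring
        · exact zero_le
    _ = (((m : ℝ≥0∞) + 1) ^ (n - 1) * 2⁻¹ ^ m) *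
          ∑ j ∈ Finset.range N, (((j : ℝ≥0∞) + 1) ^ (n - 1) * 2⁻¹ ^ j) := by
        rw [Finset.mul_sum]
    _ ≤ (((m : ℝ≥0∞) + 1) ^ (n - 1) * t) * c := by
        gcongr
        refine (ENNReal.sum_le_tsum _).trans (le_trans (le_of_eq ?_) hc)
        rw [ENNReal.coe_inv (by norm_num)]
        rfl
    _ = _ := mul_comm _ _

/-- Young's inequality with a small parameter, by comparing `t` with `δ * y`. -/
theorem exists_mul_pow_pred_le (n : ℕ) (hn : n ≠ 0) {δ : ℝ≥0} (hδ : δ ≠ 0) :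
    ∃ C : ℝ≥0, ∀ t y : ℝ≥0∞, t * y ^ (n - 1) ≤ δ * y ^ n + C * t ^ n := by
  refine ⟨(δ⁻¹) ^ (n - 1), fun t y => ?_⟩
  have hδ' : (δ : ℝ≥0∞) ≠ 0 := by exact_mod_cast hδ
  rcases le_total t (δ * y) with h | h
  · calc t * y ^ (n - 1) ≤ δ * y * y ^ (n - 1) := by gcongr
      _ = δ * y ^ n := by rw [mul_assoc, mul_pow_sub_one hn]
      _ ≤ _ := le_self_add
  · have h2 : y ≤ (δ⁻¹ : ℝ≥0) * t := by
      rw [ENNReal.coe_inv hδ]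
      calc y = (δ : ℝ≥0∞)⁻¹ * (δ * y) := by
            rw [← mul_assoc, ENNReal.inv_mul_cancel hδ' ENNReal.coe_ne_top, one_mul]
        _ ≤ _ := by gcongr
    calc t * y ^ (n - 1) ≤ t * ((δ⁻¹ : ℝ≥0) * t) ^ (n - 1) := by gcongr
      _ = ((δ⁻¹) ^ (n - 1) : ℝ≥0) * (t * t ^ (n - 1)) := by rw [mul_pow]; push_cast; ring
      _ = ((δ⁻¹) ^ (n - 1) : ℝ≥0) * t ^ n := by rw [mul_pow_sub_one hn]
      _ ≤ _ := le_add_self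

theorem exists_first_dyadic_lt {t : ℝ≥0∞} (ht : t ≠ 0) :
    ∃ m : ℕ, 2⁻¹ ^ m < t ∧ ∀ k < m, t ≤ 2⁻¹ ^ k := by
  have hex : ∃ m : ℕ, 2⁻¹ ^ m < t := ENNReal.exists_inv_two_pow_lt ht
  classical
  exact ⟨Nat.find hex, Nat.find_spec hex, fun k hk => not_lt.1 (Nat.find_min hex hk)⟩

/-- The error term of the level set summation is absorbed. -/
theorem exists_mul_highSum_le (n : ℕ) (hn : n ≠ 0) (A B : ℝ≥0) :
    ∃ C : ℝ≥0, ∀ (N : ℕ) (t w : ℝ≥0∞), w ≤ A * t →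
      B * (w ^ (n - 1) * highSum n N t) ≤ 2⁻¹ * (w ^ n * lowSum n N t) + C * t ^ n := by
  obtain ⟨c, hc⟩ := exists_highSum_le n
  -- Chosen so that the coefficient of `w ^ n * lowSum n N t` ends up at most `1 / 2`; the `+ 1`
  -- keeps the denominator nonzero.
  set δ : ℝ≥0 := (2 * (B * c + 1) * (2 ^ n * n))⁻¹ with hδdef
  have hn' : (n : ℝ≥0) ≠ 0 := by exact_mod_cast hn
  have hδ : δ ≠ 0 := by positivity
  have hδ2 : B * c * δ * (2 ^ n * n) ≤ 2⁻¹ := by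
    have h1 : (B * c + 1) * δ * (2 ^ n * n) = 2⁻¹ := by
      rw [hδdef]
      field_simp
    rw [← h1]
    gcongr
    exact le_self_add
  obtain ⟨C₁, hC₁⟩ := exists_mul_pow_pred_le n hn hδ
  refine ⟨B * c * (δ * (2 ^ n * A ^ n) + C₁) + 1, fun N t w hw => ?_⟩
  rcases eq_or_ne t 0 with rfl | ht0
  · have : highSum n N 0 = 0 := highSum_eq_zero le_rfl fun k _ => zero_le
    simp [this]
  obtain ⟨m, hm1, hm2⟩ := exists_first_dyadic_lt ht0
  rcases le_total N m with hNm | hmN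
  · rw [highSum_eq_zero hNm hm2]
    simp
  -- Here `m + 1` plays the role of `log (1 / t)`: the error is a multiple of `t * y ^ (n - 1)`, and
  -- `y ^ n` is bounded through `lowSum` up to a multiple of `w ^ n ≤ (A * t) ^ n`.
  set y := w * ((m : ℝ≥0∞) + 1) with hy
  have hyn : y ^ n ≤ (2 ^ n * n) * (w ^ n * lowSum n N t) + (2 ^ n * A ^ n) * t ^ n := by
    have h1 : ((m : ℝ≥0∞) + 1) ^ n ≤ 2 ^ n * (n * lowSum n N t + 1) := by
      refine (ENNReal.add_pow_le_two_pow_mul _ _ _).trans ?_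
      rw [one_pow]
      gcongr
      exact pow_le_mul_lowSum hn hmN hm2
    calc y ^ n = w ^ n * ((m : ℝ≥0∞) + 1) ^ n := mul_pow _ _ _
      _ ≤ w ^ n * (2 ^ n * (n * lowSum n N t + 1)) := by gcongr
      _ = (2 ^ n * n) * (w ^ n * lowSum n N t) + 2 ^ n * w ^ n := by ring
      _ ≤ (2 ^ n * n) * (w ^ n * lowSum n N t) + 2 ^ n * (A * t) ^ n := by gcongr
      _ = _ := by rw [mul_pow]; ring
  calc B * (w ^ (n - 1) * highSum n N t)
      ≤ B * (w ^ (n - 1) * (c * (((m : ℝ≥0∞) + 1) ^ (n - 1) * t))) := by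
        gcongr
        exact hc m N t hm1.le hm2
    _ = B * c * (t * y ^ (n - 1)) := by rw [hy, mul_pow]; ring
    _ ≤ B * c * (δ * y ^ n + C₁ * t ^ n) := by gcongr; exact hC₁ t y
    _ ≤ B * c * (δ * ((2 ^ n * n) * (w ^ n * lowSum n N t) + (2 ^ n * A ^ n) * t ^ n) +
          C₁ * t ^ n) := by gcongr
    _ = (B * c * δ * (2 ^ n * n) : ℝ≥0) * (w ^ n * lowSum n N t) +
          (B * c * (δ * (2 ^ n * A ^ n) + C₁) : ℝ≥0) * t ^ n := by push_cast; ring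
    _ ≤ (2⁻¹ : ℝ≥0) * (w ^ n * lowSum n N t) +
          (B * c * (δ * (2 ^ n * A ^ n) + C₁) + 1 : ℝ≥0) * t ^ n := by
        gcongr
        exact le_self_add
    _ = _ := by rw [ENNReal.coe_inv (by norm_num)]; rfl

/-- Interpolating the two bounds on `s` with exponents `1 - ε / n` and `ε / n` gives a multiple of
`τ ^ (n - ε) * t ^ ε`. An index `k` counts only if `t ≤ 2 ^ (-k)`, so `t ^ ε` supplies geometric
decay that beats the weights `(k + 1) ^ (n - 1)`. -/
theorem exists_mul_lowSum_le (n : ℕ) {ε : ℝ} (hε : 0 < ε) (hεn : ε < n) (c : ℝ≥0) :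
    ∃ C : ℝ≥0, ∀ (N : ℕ) (s t τ : ℝ≥0∞), s ≤ c * t ^ n → s ≤ τ ^ n →
      s * lowSum n N t ≤ C * τ ^ ((n : ℝ) - ε) := by
  have hn : (0 : ℝ) < n := hε.trans hεn
  have hθ0 : 0 ≤ ε / n := by positivity
  have hθ1 : 0 ≤ 1 - ε / n := by
    rw [sub_nonneg, div_le_one hn]
    exact hεn.le
  set r : ℝ≥0 := (2⁻¹ : ℝ≥0) ^ ε with hr
  have hr0 : r ≠ 0 := by
    rw [hr, Ne, NNReal.rpow_eq_zero_iff]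
    norm_num
  have hr1 : r < 1 := NNReal.rpow_lt_one (by rw [inv_lt_one₀ (by norm_num)]; norm_num) hε
  obtain ⟨C, hC⟩ := exists_tsum_pow_mul_geometric_le (n - 1) hr0 hr1
  refine ⟨c ^ (ε / n) * C, fun N s t τ hst hsτ => ?_⟩
  have hs : s ≤ c ^ (ε / n) * τ ^ ((n : ℝ) - ε) * t ^ ε := by
    calc s = s ^ (1 - ε / n) * s ^ (ε / n) := by
          rw [← ENNReal.rpow_add_of_nonneg _ _ hθ1 hθ0, sub_add_cancel, ENNReal.rpow_one]
      _ ≤ (τ ^ n) ^ (1 - ε / n) * (c * t ^ n) ^ (ε / n) := by gcongr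
      _ = τ ^ ((n : ℝ) - ε) * (c ^ (ε / n) * t ^ ε) := by
          rw [ENNReal.mul_rpow_of_nonneg _ _ hθ0, ← ENNReal.rpow_natCast, ← ENNReal.rpow_natCast,
            ← ENNReal.rpow_mul, ← ENNReal.rpow_mul]
          congr 2
          · field_simp
          · congr 1
            field_simp
      _ = _ := by ring
  calc s * lowSum n N t = ∑ k ∈ Finset.range N,
        s * (if t ≤ 2⁻¹ ^ k then ((k : ℝ≥0∞) + 1) ^ (n - 1) else 0) := Finset.mul_sum _ _ _
    _ ≤ ∑ k ∈ Finset.range N, (c ^ (ε / n) * τ ^ ((n : ℝ) - ε)) *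
          (((k : ℝ≥0∞) + 1) ^ (n - 1) * (r : ℝ≥0∞) ^ k) := by
        refine Finset.sum_le_sum fun k _ => ?_
        split_ifs with h
        · have htk : t ^ ε ≤ (r : ℝ≥0∞) ^ k := by
            refine (ENNReal.rpow_le_rpow h hε.le).trans_eq ?_
            rw [hr, ENNReal.coe_rpow_of_nonneg _ hε.le, ENNReal.coe_inv (by norm_num),
              ← ENNReal.rpow_natCast, ← ENNReal.rpow_natCast, ← ENNReal.rpow_mul,
              ← ENNReal.rpow_mul, mul_comm]
            rfl
          calc s * ((k : ℝ≥0∞) + 1) ^ (n - 1)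
              ≤ (c ^ (ε / n) * τ ^ ((n : ℝ) - ε) * t ^ ε) * ((k : ℝ≥0∞) + 1) ^ (n - 1) := by
                gcongr
            _ ≤ (c ^ (ε / n) * τ ^ ((n : ℝ) - ε) * (r : ℝ≥0∞) ^ k) *
                  ((k : ℝ≥0∞) + 1) ^ (n - 1) := by gcongr
            _ = _ := by ring
        · simp
    _ = (c ^ (ε / n) * τ ^ ((n : ℝ) - ε)) *
          ∑ k ∈ Finset.range N, (((k : ℝ≥0∞) + 1) ^ (n - 1) * (r : ℝ≥0∞) ^ k) := by
        rw [Finset.mul_sum]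
    _ ≤ (c ^ (ε / n) * τ ^ ((n : ℝ) - ε)) * C := by
        gcongr
        exact (ENNReal.sum_le_tsum _).trans hC
    _ = _ := by
        rw [ENNReal.coe_mul, ENNReal.coe_rpow_of_nonneg _ hθ0]
        ring

theorem logOneAddInv_le_natCast {t : ℝ≥0∞} {m : ℕ} (h : 1 + t⁻¹ ≤ 2 ^ m) :
    logOneAddInv t ≤ m := by
  rw [logOneAddInv]
  have h1 : ENNReal.log (1 + t⁻¹) ≤ ((m : ℝ) : EReal) := by
    refine (ENNReal.log_monotone h).trans ?_
    have h2 : (2 : ℝ≥0∞) ^ m = ENNReal.ofReal (2 ^ m) := by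
      rw [ENNReal.ofReal_pow (by norm_num), ENNReal.ofReal_ofNat]
    rw [h2, ENNReal.log_ofReal_of_pos (by positivity), EReal.coe_le_coe_iff, Real.log_pow]
    have : Real.log 2 ≤ 1 := Real.log_two_lt_d9.le.trans (by norm_num)
    exact mul_le_of_le_one_right (by positivity) this
  refine (EReal.toENNReal_le_toENNReal h1).trans ?_
  rw [EReal.toENNReal_of_ne_top (EReal.coe_ne_top _), EReal.toReal_coe, ENNReal.ofReal_natCast]

/-- If `m` is the first index with `2 ^ (-m) < t`, then `1 + 1 / t ≤ 2 ^ (m + 1)`, so the logarithm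
is at most `m + 1`. As `N` depends on `t`, a supremum over `N` is taken in the application. -/
theorem logOneAddInv_pow_le {n : ℕ} (hn : n ≠ 0) {t : ℝ≥0∞} (ht : t ≠ 0) :
    ∃ N, logOneAddInv t ^ n ≤ 2 ^ n * n * (1 + lowSum n N t) := by
  obtain ⟨m, hm1, hm2⟩ := exists_first_dyadic_lt ht
  refine ⟨m, ?_⟩
  have hn1 : (1 : ℝ≥0∞) ≤ n := by exact_mod_cast Nat.one_le_iff_ne_zero.2 hn
  have h1 : logOneAddInv t ≤ (m + 1 : ℕ) := by
    refine logOneAddInv_le_natCast ?_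
    have h2 : t⁻¹ ≤ 2 ^ m := by
      rw [← inv_inv (2 ^ m : ℝ≥0∞), ENNReal.inv_le_inv, ENNReal.inv_pow]
      exact hm1.le
    calc 1 + t⁻¹ ≤ 2 ^ m + 2 ^ m := add_le_add (one_le_pow₀ (by norm_num)) h2
      _ = 2 ^ (m + 1) := by ring
  calc logOneAddInv t ^ n ≤ ((m + 1 : ℕ) : ℝ≥0∞) ^ n := by gcongr
    _ = ((m : ℝ≥0∞) + 1) ^ n := by push_cast; rfl
    _ ≤ 2 ^ n * ((m : ℝ≥0∞) ^ n + 1 ^ n) := ENNReal.add_pow_le_two_pow_mul _ _ _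
    _ ≤ 2 ^ n * (n * lowSum n m t + n) := by
        gcongr
        · exact pow_le_mul_lowSum hn le_rfl hm2
        · rwa [one_pow]
    _ = _ := by ring

end dyadicWeights

/-! ### Summation of the level set inequality. -/

section summation

variable {α : Type*} [MeasurableSpace α] {μ : Measure α}

@[fun_prop]
theorem measurable_lowSum (n N : ℕ) : Measurable (lowSum n N) :=
  Finset.measurable_fun_sum _ fun _ _ => Measurable.ite measurableSet_Iic measurable_const
    measurable_const

theorem lowSum_mono (n : ℕ) {N N' : ℕ} (h : N ≤ N') (t : ℝ≥0∞) : lowSum n N t ≤ lowSum n N' t :=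
  Finset.sum_le_sum_of_subset (Finset.range_mono h)

theorem lintegral_mul_lowSum (n N : ℕ) {f M : α → ℝ≥0∞} (hf : AEMeasurable f μ)
    (hM : Measurable M) :
    ∫⁻ x, f x * lowSum n N (M x) ∂μ =
      ∑ k ∈ Finset.range N, ((k : ℝ≥0∞) + 1) ^ (n - 1) * ∫⁻ x in {x | M x ≤ 2⁻¹ ^ k}, f x ∂μ := by
  have hm : ∀ k : ℕ, MeasurableSet {x | M x ≤ 2⁻¹ ^ k} := fun k =>
    measurableSet_le hM measurable_const
  simp only [lowSum, Finset.mul_sum]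
  rw [lintegral_finsetSum']
  · refine Finset.sum_congr rfl fun k _ => ?_
    rw [← lintegral_const_mul' _ _ (by finiteness), ← lintegral_indicator (hm k)]
    refine lintegral_congr fun x => ?_
    by_cases h : M x ≤ 2⁻¹ ^ k
    · rw [if_pos h, indicator_of_mem (show x ∈ {x | M x ≤ 2⁻¹ ^ k} from h), mul_comm]
    · rw [if_neg h, indicator_of_notMem (show x ∉ {x | M x ≤ 2⁻¹ ^ k} from h), mul_zero]
  · exact fun k _ => hf.mul (Measurable.ite (hm k) measurable_const measurable_const).aemeasurable

theorem lintegral_mul_highSum (n N : ℕ) {f M : α → ℝ≥0∞} (hf : AEMeasurable f μ)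
    (hM : Measurable M) :
    ∫⁻ x, f x * highSum n N (M x) ∂μ =
      ∑ k ∈ Finset.range N, ((k : ℝ≥0∞) + 1) ^ (n - 1) * 2⁻¹ ^ k *
        ∫⁻ x in {x | 2⁻¹ ^ k < M x}, f x ∂μ := by
  have hm : ∀ k : ℕ, MeasurableSet {x | 2⁻¹ ^ k < M x} := fun k =>
    measurableSet_lt measurable_const hM
  simp only [highSum, Finset.mul_sum]
  rw [lintegral_finsetSum']
  · refine Finset.sum_congr rfl fun k _ => ?_
    rw [← lintegral_const_mul' _ _ (ENNReal.mul_ne_top (by finiteness)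
      (ENNReal.pow_ne_top (by norm_num))), ← lintegral_indicator (hm k)]
    refine lintegral_congr fun x => ?_
    by_cases h : 2⁻¹ ^ k < M x
    · rw [if_pos h, indicator_of_mem (show x ∈ {x | 2⁻¹ ^ k < M x} from h), mul_comm]
    · rw [if_neg h, indicator_of_notMem (show x ∉ {x | 2⁻¹ ^ k < M x} from h), mul_zero]
  · exact fun k _ => hf.mul (Measurable.ite (hm k) measurable_const measurable_const).aemeasurable

/-- Letting the level tend to infinity in the level set inequality. -/
theorem lintegral_pow_le_of_level_le {n : ℕ} (hn : n ≠ 0) {A B : ℝ≥0} {W M S : α → ℝ≥0∞}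
    (hM : Measurable M) (hW : AEMeasurable W μ) (hMi : ∫⁻ x, M x ^ n ∂μ ≠ ⊤)
    (hWM : ∀ᵐ x ∂μ, W x ≤ A * M x)
    (hlevel : ∀ t : ℝ≥0, t ≠ 0 → ∫⁻ x in {x | M x ≤ t}, W x ^ n ∂μ ≤
      B * t * (∫⁻ x in {x | t < M x}, W x ^ (n - 1) ∂μ) + ∫⁻ x in {x | M x ≤ t}, S x ∂μ) :
    ∫⁻ x, W x ^ n ∂μ ≤ ∫⁻ x, S x ∂μ := by
  have hMfin : ∀ᵐ x ∂μ, M x < ⊤ := by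
    filter_upwards [ae_lt_top (hM.pow_const n) hMi] with x hx
    exact (ENNReal.pow_lt_top_iff.1 hx).resolve_right hn
  set t : ℕ → ℝ≥0 := fun j => (j : ℝ≥0) + 1 with ht
  have hml : ∀ j, MeasurableSet {x | M x ≤ t j} := fun j => measurableSet_le hM measurable_const
  have hmg : ∀ j, MeasurableSet {x | (t j : ℝ≥0∞) < M x} := fun j =>
    measurableSet_lt measurable_const hM
  have hev : ∀ᵐ x ∂μ, ∀ᶠ j in atTop, M x ≤ t j := by
    filter_upwards [hMfin] with x hx
    obtain ⟨k, hk⟩ := ENNReal.exists_nat_gt hx.ne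
    filter_upwards [eventually_ge_atTop k] with j hj
    refine hk.le.trans ?_
    have : (k : ℝ≥0) ≤ t j := by
      rw [ht]
      exact (Nat.cast_le.2 hj).trans le_self_add
    exact_mod_cast this
  have htail : Tendsto (fun j => ∫⁻ x in {x | (t j : ℝ≥0∞) < M x}, M x ^ n ∂μ) atTop (𝓝 0) := by
    have h1 : ∀ j, ∫⁻ x in {x | (t j : ℝ≥0∞) < M x}, M x ^ n ∂μ =
        ∫⁻ x, {x | (t j : ℝ≥0∞) < M x}.indicator (fun x => M x ^ n) x ∂μ := fun j =>
      (lintegral_indicator (hmg j) _).symm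
    simp only [h1]
    rw [← lintegral_zero (α := α) (μ := μ)]
    refine tendsto_lintegral_of_dominated_convergence (fun x => M x ^ n)
      (fun j => (hM.pow_const n).indicator (hmg j))
      (fun j => Eventually.of_forall fun x => indicator_le_self _ _ x) hMi ?_
    filter_upwards [hev] with x hx
    refine tendsto_const_nhds.congr' ?_
    filter_upwards [hx] with j hj
    rw [indicator_of_notMem]
    exact not_lt.2 hj
  -- On `{M > t}` one has `t * W ^ (n - 1) ≤ A ^ (n - 1) * M ^ n`, so the error is a tail of `∫ M ^
  -- n` and disappears as `t → ∞`.
  have hbound : ∀ j, ∫⁻ x, {x | M x ≤ t j}.indicator (fun x => W x ^ n) x ∂μ ≤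
      (B * A ^ (n - 1) : ℝ≥0) * (∫⁻ x in {x | (t j : ℝ≥0∞) < M x}, M x ^ n ∂μ) +
        ∫⁻ x, S x ∂μ := by
    intro j
    rw [lintegral_indicator (hml j)]
    refine (hlevel (t j) (by positivity)).trans (add_le_add ?_ (setLIntegral_le_lintegral _ _))
    rw [← lintegral_const_mul' _ _ (by finiteness), ← lintegral_const_mul' _ _ (by finiteness)]
    refine lintegral_mono_ae ((ae_restrict_iff' (hmg j)).2 ?_)
    filter_upwards [hWM] with x hx hxt
    have hxt' : (t j : ℝ≥0∞) ≤ M x := le_of_lt hxt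
    calc (B : ℝ≥0∞) * t j * W x ^ (n - 1) ≤ B * M x * (A * M x) ^ (n - 1) := by gcongr
      _ = (B * A ^ (n - 1) : ℝ≥0) * (M x * M x ^ (n - 1)) := by rw [mul_pow]; push_cast; ring
      _ = _ := by rw [mul_pow_sub_one hn]
  refine lintegral_le_of_tendsto_of_le (fun j => (hW.pow_const n).indicator (hml j)) ?_ hbound ?_
  · filter_upwards [hev] with x hx
    refine tendsto_const_nhds.congr' ?_
    filter_upwards [hx] with j hj
    rw [indicator_of_mem]
    exact hj
  · have := (ENNReal.Tendsto.const_mul (a := ((B * A ^ (n - 1) : ℝ≥0) : ℝ≥0∞)) htail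
      (Or.inr ENNReal.coe_ne_top)).add_const (∫⁻ x, S x ∂μ)
    rwa [mul_zero, zero_add] at this

/-- Summation of the level set inequality over dyadic levels with logarithmic weights. -/
theorem exists_lintegral_pow_mul_log_le {n : ℕ} (hn : n ≠ 0) {ε : ℝ} (hε : 0 < ε) (hεn : ε < n)
    (A A' B c : ℝ≥0) :
    ∃ C : ℝ≥0, ∀ (W M S τ : α → ℝ≥0∞), AEMeasurable W μ → Measurable M → AEMeasurable S μ →
      ∫⁻ x, W x ^ n ∂μ ≠ ⊤ → ∫⁻ x, M x ^ n ∂μ ≤ A' * ∫⁻ x, W x ^ n ∂μ →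
      (∀ᵐ x ∂μ, W x ≤ A * M x) → (∀ᵐ x ∂μ, S x ≤ c * W x ^ n) → (∀ᵐ x ∂μ, S x ≤ τ x ^ n) →
      (∀ t : ℝ≥0, t ≠ 0 → ∫⁻ x in {x | M x ≤ t}, W x ^ n ∂μ ≤
        B * t * (∫⁻ x in {x | t < M x}, W x ^ (n - 1) ∂μ) + ∫⁻ x in {x | M x ≤ t}, S x ∂μ) →
      ∫⁻ x, W x ^ n * logOneAddInv (M x) ^ n ∂μ ≤
        C * ((∫⁻ x, τ x ^ n ∂μ) + ∫⁻ x, τ x ^ ((n : ℝ) - ε) ∂μ) := by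
  obtain ⟨C₁, hC₁⟩ := exists_mul_highSum_le n hn A B
  obtain ⟨C₂, hC₂⟩ := exists_mul_lowSum_le n hε hεn (c * A ^ n)
  refine ⟨2 ^ n * n * (1 + (2 * (C₁ * A') + 2 * C₂)), ?_⟩
  intro W M S τ hW hM hS hWi hMW hWM hSW hSτ hlevel
  have hMi : ∫⁻ x, M x ^ n ∂μ ≠ ⊤ :=
    ne_top_of_le_ne_top (ENNReal.mul_ne_top ENNReal.coe_ne_top hWi) hMW
  set Q := (∫⁻ x, τ x ^ n ∂μ) + ∫⁻ x, τ x ^ ((n : ℝ) - ε) ∂μ with hQ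
  have hWQ : ∫⁻ x, W x ^ n ∂μ ≤ Q := by
    refine (lintegral_pow_le_of_level_le hn hM hW hMi hWM hlevel).trans ?_
    exact (lintegral_mono_ae hSτ).trans le_self_add
  have hlow : ∀ N, ∫⁻ x, W x ^ n * lowSum n N (M x) ∂μ ≤ (2 * (C₁ * A') + 2 * C₂ : ℝ≥0) * Q := by
    intro N
    set X := ∫⁻ x, W x ^ n * lowSum n N (M x) ∂μ with hX
    -- For fixed `N` the weight is bounded; finiteness is what permits subtracting `2⁻¹ * X` below.
    have hXfin : X ≠ ⊤ := by
      have hle : ∀ t, lowSum n N t ≤ ∑ k ∈ Finset.range N, ((k : ℝ≥0∞) + 1) ^ (n - 1) := fun t =>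
        Finset.sum_le_sum fun k _ => by split_ifs <;> simp
      have hfin : ∑ k ∈ Finset.range N, ((k : ℝ≥0∞) + 1) ^ (n - 1) ≠ ⊤ :=
        ENNReal.sum_ne_top.2 fun k _ => by finiteness
      refine ne_top_of_le_ne_top ?_ (lintegral_mono fun x => mul_le_mul_right (hle (M x)) (W x ^ n))
      rw [lintegral_mul_const' _ _ hfin]
      exact ENNReal.mul_ne_top hWi hfin
    have hsum : X ≤ (∫⁻ x, B * (W x ^ (n - 1) * highSum n N (M x)) ∂μ) +
        ∫⁻ x, S x * lowSum n N (M x) ∂μ := by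
      rw [hX, lintegral_const_mul' _ _ ENNReal.coe_ne_top,
        lintegral_mul_lowSum n N (hW.pow_const n) hM, lintegral_mul_lowSum n N hS hM,
        lintegral_mul_highSum n N (hW.pow_const _) hM, Finset.mul_sum, ← Finset.sum_add_distrib]
      refine Finset.sum_le_sum fun k _ => ?_
      have hk := hlevel (2⁻¹ ^ k) (by positivity)
      have hcast : (((2⁻¹ : ℝ≥0) ^ k : ℝ≥0) : ℝ≥0∞) = 2⁻¹ ^ k := by
        rw [ENNReal.coe_pow, ENNReal.coe_inv (by norm_num)]
        rfl
      rw [hcast] at hk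
      calc _ ≤ ((k : ℝ≥0∞) + 1) ^ (n - 1) * (B * 2⁻¹ ^ k *
            (∫⁻ x in {x | 2⁻¹ ^ k < M x}, W x ^ (n - 1) ∂μ) +
              ∫⁻ x in {x | M x ≤ 2⁻¹ ^ k}, S x ∂μ) := by gcongr
        _ = _ := by ring
    have h1 : ∫⁻ x, B * (W x ^ (n - 1) * highSum n N (M x)) ∂μ ≤ 2⁻¹ * X + C₁ * (A' * Q) := by
      calc _ ≤ ∫⁻ x, (2⁻¹ * (W x ^ n * lowSum n N (M x)) + C₁ * M x ^ n) ∂μ := by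
            refine lintegral_mono_ae ?_
            filter_upwards [hWM] with x hx
            exact hC₁ N (M x) (W x) hx
        _ = 2⁻¹ * X + C₁ * ∫⁻ x, M x ^ n ∂μ := by
            rw [lintegral_add_right _ ((hM.pow_const n).const_mul _),
              lintegral_const_mul' _ _ (by norm_num), lintegral_const_mul' _ _ ENNReal.coe_ne_top]
        _ ≤ _ := by
            gcongr
            exact hMW.trans (by gcongr)
    have h2 : ∫⁻ x, S x * lowSum n N (M x) ∂μ ≤ C₂ * Q := by
      calc _ ≤ ∫⁻ x, C₂ * τ x ^ ((n : ℝ) - ε) ∂μ := by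
            refine lintegral_mono_ae ?_
            filter_upwards [hWM, hSW, hSτ] with x hx hx2 hx3
            refine hC₂ N _ _ _ (hx2.trans ?_) hx3
            calc c * W x ^ n ≤ c * (A * M x) ^ n := by gcongr
              _ = _ := by rw [mul_pow]; push_cast; ring
        _ = C₂ * ∫⁻ x, τ x ^ ((n : ℝ) - ε) ∂μ := lintegral_const_mul' _ _ ENNReal.coe_ne_top
        _ ≤ _ := by
            gcongr
            exact le_add_self
    have h3 : 2⁻¹ * X + 2⁻¹ * X ≤ 2⁻¹ * X + (C₁ * (A' * Q) + C₂ * Q) := by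
      rw [← add_mul, ENNReal.inv_two_add_inv_two, one_mul, ← add_assoc]
      exact hsum.trans (add_le_add h1 h2)
    have h4 := (ENNReal.add_le_add_iff_left (ENNReal.mul_ne_top (by norm_num) hXfin)).1 h3
    calc X = 2 * (2⁻¹ * X) := by
          rw [← mul_assoc, ENNReal.mul_inv_cancel (by norm_num) (by norm_num), one_mul]
      _ ≤ 2 * (C₁ * (A' * Q) + C₂ * Q) := by gcongr
      _ = _ := by push_cast; ring
  have hmeas : ∀ N, AEMeasurable (fun x => W x ^ n * lowSum n N (M x)) μ := fun N =>
    (hW.pow_const n).mul ((measurable_lowSum n N).comp hM).aemeasurable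
  have hsup : ∫⁻ x, ⨆ N, W x ^ n * lowSum n N (M x) ∂μ ≤
      (2 * (C₁ * A') + 2 * C₂ : ℝ≥0) * Q := by
    rw [lintegral_iSup' hmeas (Eventually.of_forall fun x N N' h =>
      mul_le_mul_right (lowSum_mono n h _) _)]
    exact iSup_le hlow
  calc ∫⁻ x, W x ^ n * logOneAddInv (M x) ^ n ∂μ
      ≤ ∫⁻ x, 2 ^ n * n * (W x ^ n + ⨆ N, W x ^ n * lowSum n N (M x)) ∂μ := by
        refine lintegral_mono_ae ?_
        filter_upwards [hWM] with x hx
        -- Where `M` vanishes so does `W`, and the infinite logarithm is multiplied by zero.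
        rcases eq_or_ne (M x) 0 with h0 | h0
        · rw [h0, mul_zero, nonpos_iff_eq_zero] at hx
          rw [hx, zero_pow hn, zero_mul]
          exact zero_le
        · obtain ⟨N, hN⟩ := logOneAddInv_pow_le hn h0
          calc W x ^ n * logOneAddInv (M x) ^ n
              ≤ W x ^ n * (2 ^ n * n * (1 + lowSum n N (M x))) := by gcongr
            _ = 2 ^ n * n * (W x ^ n + W x ^ n * lowSum n N (M x)) := by ring
            _ ≤ _ := by
                gcongr
                exact le_iSup (fun N => W x ^ n * lowSum n N (M x)) N
    _ = 2 ^ n * n * ((∫⁻ x, W x ^ n ∂μ) + ∫⁻ x, ⨆ N, W x ^ n * lowSum n N (M x) ∂μ) := by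
        rw [lintegral_const_mul' _ _ (by finiteness), lintegral_add_left' (hW.pow_const n)]
    _ ≤ 2 ^ n * n * (Q + (2 * (C₁ * A') + 2 * C₂ : ℝ≥0) * Q) := by gcongr
    _ = _ := by push_cast; ring

end summation

/-! ### Assembly of the estimate. -/

theorem lemma7p2 (n : ℕ) (K ε : ℝ) (hK : 1 ≤ K) (hε : 0 < ε) (hεn : ε < (n : ℝ) - 1) :
    ∃ C : ℝ≥0, ∀ (h : Euc n → ℝ × UnitSphere n) (Dh : Euc n → Euc n →L[ℝ] Ambient n)
      (σ : Euc n → ℝ),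
      Continuous h →
      (∃ x y, h x ≠ h y) →
      MemSobolevLocal (n : ℝ≥0∞) (fun x => cylinderIncl (h x)) →
      IsWeakDerivative (fun x => cylinderIncl (h x)) Dh →
      MemLp (fun x => ‖Dh x‖) (n : ℝ≥0∞) volume →
      (∀ᵐ x, 0 ≤ σ x) →
      MemLp σ (ENNReal.ofReal ((n : ℝ) - ε)) volume →
      MemLp σ (n : ℝ≥0∞) volume →
      (∀ᵐ x, ‖Dh x‖ ^ n ≤ K * cylinderJacobian h Dh x + σ x ^ n) →
      (∫⁻ x, ‖Dh x‖ₑ ^ n * logOneAddInv (hlMaximal (fun y => ‖Dh y‖) x) ^ n)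
          ≤ C * ∫⁻ x, ENNReal.ofReal (σ x ^ n + σ x ^ ((n : ℝ) - ε)) ∧
        (∫⁻ x, ENNReal.ofReal (σ x ^ n + σ x ^ ((n : ℝ) - ε))) < ⊤ := by
  have hn : 2 ≤ n := by
    have h1 : (1 : ℝ) < n := by linarith
    exact_mod_cast h1
  have hn0 : n ≠ 0 := by omega
  have hp : 0 < (n : ℝ) - ε := by linarith
  obtain ⟨B, c, hBc⟩ := exists_setLIntegral_sublevel_le hn (zero_le_one.trans hK)
  obtain ⟨A', hA'⟩ := exists_lintegral_ballMaximal_pow_le hn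
  -- The value `2 ^ n` for `A` is the constant in the almost everywhere bound of `|Dh|` by its
  -- maximal function. All constants are fixed before `h` and `σ` are introduced.
  obtain ⟨C, hC⟩ := exists_lintegral_pow_mul_log_le (μ := (volume : Measure (Euc n))) hn0 hε
    (by linarith) (2 ^ n) A' B c
  refine ⟨C, fun h Dh σ hh _ _ hw hDp hσ0 hσp hσn hineq => ?_⟩
  have hpow : ∀ {f : Euc n → ℝ}, MemLp f (n : ℝ≥0∞) volume → ∫⁻ x, ‖f x‖ₑ ^ n ≠ ⊤ := by
    intro f hf
    have := (lintegral_rpow_enorm_lt_top_of_eLpNorm_lt_top (by exact_mod_cast hn0) (by simp)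
      hf.eLpNorm_lt_top).ne
    simpa using this
  have hDi : ∫⁻ x, ‖Dh x‖ₑ ^ n ≠ ⊤ := by simpa only [enorm_norm] using hpow hDp
  have hDm := hw.locallyIntegrable_deriv.aestronglyMeasurable
  have hσm := hσn.aestronglyMeasurable.aemeasurable
  obtain ⟨S, hSm, hSc, hSσ, hlevel⟩ := hBc h Dh σ hh hw hDi hσm hσ0 hineq
  have hmain := hC (fun x => ‖Dh x‖ₑ) (ballMaximal fun y => ‖Dh y‖ₑ) S
    (fun x => ENNReal.ofReal (σ x)) hDm.enorm (measurable_ballMaximal _) hSm hDi (hA' _ hDm.enorm)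
    (by simpa using ae_enorm_le_ballMaximal hw.locallyIntegrable_deriv)
    (Eventually.of_forall hSc) hSσ hlevel
  have hσint : ∫⁻ x, ENNReal.ofReal (σ x ^ n + σ x ^ ((n : ℝ) - ε)) =
      (∫⁻ x, ENNReal.ofReal (σ x) ^ n) + ∫⁻ x, ENNReal.ofReal (σ x) ^ ((n : ℝ) - ε) := by
    rw [← lintegral_add_left' (hσm.ennreal_ofReal.pow_const n)]
    refine lintegral_congr_ae ?_
    filter_upwards [hσ0] with x hx
    rw [ENNReal.ofReal_add (by positivity) (by positivity), ENNReal.ofReal_pow hx,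
      ENNReal.ofReal_rpow_of_nonneg hx hp.le]
  have hmax : hlMaximal (fun y => ‖Dh y‖) = ballMaximal fun y => ‖Dh y‖ₑ := by
    ext x
    simp only [hlMaximal, ballMaximal, enorm_norm]
  refine ⟨?_, ?_⟩
  · rw [hσint, hmax]
    exact hmain
  · have h1 : ∫⁻ x, ENNReal.ofReal (σ x) ^ n ≠ ⊤ := ne_top_of_le_ne_top (hpow hσn)
      (lintegral_mono fun x => pow_le_pow_left₀ zero_le (Real.ofReal_le_enorm _) n)
    have h2 : ∫⁻ x, ENNReal.ofReal (σ x) ^ ((n : ℝ) - ε) ≠ ⊤ := by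
      have h3 := (lintegral_rpow_enorm_lt_top_of_eLpNorm_lt_top (by simpa using hp) (by simp)
        hσp.eLpNorm_lt_top).ne
      rw [ENNReal.toReal_ofReal hp.le] at h3
      exact ne_top_of_le_ne_top h3
        (lintegral_mono fun x => ENNReal.rpow_le_rpow (Real.ofReal_le_enorm _) hp.le)
    rw [hσint]
    exact ENNReal.add_lt_top.2 ⟨h1.lt_top, h2.lt_top⟩
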